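/- Notation. Write $H=(0,\infty)\times\mathbb{R}$ with coordinates $(x,v)$. Let $$M(a,b,z)=\sum_{n\ge 0}\frac{(a)_n}{(b)_n}\frac{z^n}{n!}$$ be Kummer's function, and for non-integer $b$ and $z\ge 0$ let $$U(a,b,z)=\frac{\Gamma(1-b)}{\Gamma(a-b+1)}M(a,b,z)+\frac{\Gamma(b-1)}{\Gamma(a)}z^{1-b}M(a-b+1,2-b,z)$$ be Tricomi's function. A function $h$ on $H$ is $d$-homogeneous if $h(r^3x,rv)=r^{d}h(x,v)$ for all $r>0$. Polynomials in $(x,v)$ are graded by giving $x$ degree $3$ and $v$ degree $1$; $\mathcal{P}_k$ is the space of real polynomials of degree at most $k$ (so $\mathcal P_k=\{0\}$ for $k<0$). Given $F$ on $H$ and $g$ on $(0,\infty)$, consider $$v\,\partial_xh-\partial_{vv}h=F\ \text{ in } H,\qquad h=g\ \text{ on }\{x=0\}\times\{v>0\}.\tag{1}$$ A classical solution of (1) is a function $h$ whose derivatives $\partial_xh,\partial_vh,\partial_{vv}h$ exist and are continuous in $H$, that satisfies the equation pointwise, and for which $h(x,v)\to g(v_0)$ as $H\ni(x,v)\to(0,v_0)$,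 for every $v_0>0$. A weak solution of (1) is a function $h$ such that $h$ and its weak derivative $\partial_vh$ are in $L^2(H\cap B)$ for every ball $B$, and $$-\iint_H h\,v\,\partial_x\psi+\iint_H\partial_vh\,\partial_v\psi=\int_0^\infty g(v)\,\psi(0,v)\,v\,dv+\iint_H F\psi$$ for every $\psi\in C_c^\infty(\mathbb{R}^2)$ with $\operatorname{supp}\psi\cap\{x=0\}\subset\{v\ge 0\}$. A weak solution of $v\partial_xh-\partial_{vv}h=0$ in an open set $Q$ (without boundary condition) is defined in the same way, with $H$ replaced by $Q$, with $F=0$, with $\psi\in C_c^\infty(Q)$ and without the boundary integral. We say that $h$ does not grow exponentially if for every $\varepsilon>0$ we have $h(x,v)=O(e^{\varepsilon|(x,v)|})$ as $|(x,v)|\to\infty$ in $H$. For integers $m\ge -1$ let $\lambda_m=\frac16+m$, $M_m=\Gamma(\frac76+m)/\Gamma(\frac16-m)$, $c_{-1}=1$, $c_m=(-1)^m$ for $m\ge 0$, and $$\phi_m(x,v)=\begin{cases}c_m\,x^{\lambda_m}\,U\!\left(-\frac16-m,\frac23,-\frac{v^3}{9x}\right)&\text{if }v<0,\\[1mm] c_mM_m\,x^{\lambda_m}\,e^{-\frac{v^3}{9x}}\,U\!\left(\frac56+m,\frac23,\frac{v^3}{9x}\right)&\text{if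 }v\ge 0.\end{cases}$$ For integers $l\ge 0$ let $$\psi_l(x,v)=x^{\frac{3l+2}{3}}\left(M\!\left(-\tfrac{3l+2}{3},\tfrac23,-\tfrac{v^3}{9x}\right)+\frac{\Gamma(\frac23)}{\Gamma(-\frac{3l+2}{3})}\frac{\Gamma(-\frac{3l+1}{3})}{\Gamma(\frac43)}\frac{v}{(9x)^{1/3}}M\!\left(-\tfrac{3l+1}{3},\tfrac43,-\tfrac{v^3}{9x}\right)\right).$$ Theorem. (i) For every integer $m\ge -1$, $\phi_m$ is $3\lambda_m$-homogeneous and is a classical solution of (1) with $F=0$, $g=0$. For every $m\ge 0$ it is also a weak solution of (1) with $F=0$, $g=0$. For every $R>0$, $\phi_{-1}$ is a weak solution of $v\partial_x\phi_{-1}-\partial_{vv}\phi_{-1}=0$ in $((1/R^3,\infty)\times\mathbb{R})\cup((0,\infty)\times(-\infty,-1/R))$. (ii) Let $\lambda\ge 0$ be an integer, let $p$ be a homogeneous polynomial of degree $\lambda-2$ (so $p=0$ if $\lambda<2$) and let $a\in\mathbb{R}$, with $p\ne 0$ or $a\ne 0$. Let $h$ be a $\lambda$-homogeneous classical or weak solution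 of (1) with $F=p$ and $g(v)=av^\lambda$ that does not grow exponentially. Then there are a homogeneous polynomial $P$ of degree $\lambda$ and a $\mu\in\mathbb{R}$ with $$h=P+\mu\,\psi_{\lfloor\lambda/3\rfloor}\quad\text{in }H,$$ and $\mu=0$ if $\lambda=3l$ or $\lambda=3l+1$ for an integer $l\ge0$. The number $\mu$ is unique, even if $P$ is only required to lie in $\mathcal{P}_\lambda$. (For weak solutions homogeneity, the growth bound and all identities are understood almost everywhere.) (iii) Conversely, let $\lambda\ge 0$ be an integer, $P$ a homogeneous polynomial of degree $\lambda$, and $\mu\in\mathbb{R}$, with $\mu=0$ if $\lambda=3l$ or $\lambda=3l+1$ for an integer $l\ge0$. Then $h=P+\mu\psi_{\lfloor\lambda/3\rfloor}$ is $\lambda$-homogeneous, does not grow exponentially, and is both a classical and a weak solution of (1) with $F=p$ and $g(v)=av^\lambda$ for some homogeneous polynomial $p$ of degree $\lambda-2$ and some $a\in\mathbb{R}$. -/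

import Mathlib

open MeasureTheory Filter Topology
open scoped ContDiff

/-- Kummer's confluent hypergeometric function of the first kind,
`M(a, b, z) = ∑ (a)_n / (b)_n * z ^ n / n!`, for real parameters with `b ∉ {0, -1, -2, …}`. -/
noncomputable def kummerM (a b z : ℝ) : ℝ :=
  ∑' n : ℕ, (ascPochhammer ℝ n).eval a / (ascPochhammer ℝ n).eval b * z ^ n / (n.factorial : ℝ)

/-- Tricomi's confluent hypergeometric function `U(a, b, z)` for real `a`, real non-integer `b`
and `z ≥ 0` (principal branch). At a pole of `Γ` the factor `1 / Γ` is read as `0`; this agrees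
with Lean's conventions. -/
noncomputable def tricomiU (a b z : ℝ) : ℝ :=
  Real.Gamma (1 - b) / Real.Gamma (a - b + 1) * kummerM a b z +
    Real.Gamma (b - 1) / Real.Gamma a * z ^ (1 - b) * kummerM (a - b + 1) (2 - b) z

/-- The exponent `λ_m = 1/6 + m`. -/
noncomputable def lamExp (m : ℤ) : ℝ := 1 / 6 + m

/-- The sign `c_m`: `1` for `m = -1` and `(-1) ^ m` for `m ≥ 0`. -/
noncomputable def cSign (m : ℤ) : ℝ := if m = -1 then 1 else (-1) ^ m

/-- The constant `M_m = Γ(7/6 + m) / Γ(1/6 - m)`. -/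
noncomputable def mConst (m : ℤ) : ℝ := Real.Gamma (7 / 6 + m) / Real.Gamma (1 / 6 - m)

/-- The function `φ_m`; points of the plane are `z = (x, v)`. -/
noncomputable def phi (m : ℤ) (z : ℝ × ℝ) : ℝ :=
  if z.2 < 0 then
    cSign m * z.1 ^ lamExp m * tricomiU (-(1 / 6) - m) (2 / 3) (-z.2 ^ 3 / (9 * z.1))
  else
    cSign m * mConst m * z.1 ^ lamExp m * Real.exp (-z.2 ^ 3 / (9 * z.1)) *
      tricomiU (5 / 6 + m) (2 / 3) (z.2 ^ 3 / (9 * z.1))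

/-- The function `ψ_l`. -/
noncomputable def psi (l : ℕ) (z : ℝ × ℝ) : ℝ :=
  z.1 ^ ((3 * l + 2 : ℝ) / 3) *
    (kummerM (-((3 * l + 2 : ℝ) / 3)) (2 / 3) (-z.2 ^ 3 / (9 * z.1)) +
      Real.Gamma (2 / 3) / Real.Gamma (-((3 * l + 2 : ℝ) / 3)) *
        (Real.Gamma (-((3 * l + 1 : ℝ) / 3)) / Real.Gamma (4 / 3)) *
        (z.2 / (9 * z.1) ^ (1 / 3 : ℝ)) *
        kummerM (-((3 * l + 1 : ℝ) / 3)) (4 / 3) (-z.2 ^ 3 / (9 * z.1)))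

/-- The half-plane `{x > 0} × ℝ`. -/
def halfPlane : Set (ℝ × ℝ) := {z | 0 < z.1}

/-- `h` is a classical solution of `v ∂ₓh - ∂ᵥᵥh = F` in `{x > 0} × ℝ` with `h = g` on
`{x = 0} × {v > 0}`: the derivatives `∂ₓh, ∂ᵥh, ∂ᵥᵥh` exist and are continuous in the open
half-plane, the equation holds pointwise, and `h` attains the boundary values `g` continuously. -/
structure IsClassicalSolution (F : ℝ × ℝ → ℝ) (g : ℝ → ℝ) (h : ℝ × ℝ → ℝ) : Prop where
  diff_x : ∀ x v : ℝ, 0 < x → DifferentiableAt ℝ (fun y => h (y, v)) x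
  diff_v : ∀ x v : ℝ, 0 < x → DifferentiableAt ℝ (fun w => h (x, w)) v
  diff_vv : ∀ x v : ℝ, 0 < x → DifferentiableAt ℝ (deriv fun w => h (x, w)) v
  cont_x : ContinuousOn (fun z : ℝ × ℝ => deriv (fun y => h (y, z.2)) z.1) halfPlane
  cont_v : ContinuousOn (fun z : ℝ × ℝ => deriv (fun w => h (z.1, w)) z.2) halfPlane
  cont_vv : ContinuousOn (fun z : ℝ × ℝ => deriv (deriv fun w => h (z.1, w)) z.2) halfPlane
  equation : ∀ x v : ℝ, 0 < x →
    v * deriv (fun y => h (y, v)) x - deriv (deriv fun w => h (x, w)) v = F (x, v)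
  boundary : ∀ v : ℝ, 0 < v → Tendsto h (𝓝[halfPlane] (0, v)) (𝓝 (g v))

/-- `f ∈ L²(Q ∩ B)` for every ball `B` (square integrable locally, up to the boundary of `Q`). -/
def IsLocL2 (Q : Set (ℝ × ℝ)) (f : ℝ × ℝ → ℝ) : Prop :=
  ∀ R : ℝ, MemLp f 2 (volume.restrict (Q ∩ Metric.closedBall 0 R))

/-- The partial derivative `∂ₓψ` of a smooth function. -/
noncomputable def dx (ψ : ℝ × ℝ → ℝ) (z : ℝ × ℝ) : ℝ := fderiv ℝ ψ z (1, 0)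

/-- The partial derivative `∂ᵥψ` of a smooth function. -/
noncomputable def dv (ψ : ℝ × ℝ → ℝ) (z : ℝ × ℝ) : ℝ := fderiv ℝ ψ z (0, 1)

/-- `w` is the weak derivative `∂ᵥh` in the open set `Q`. -/
def IsWeakDerivV (Q : Set (ℝ × ℝ)) (h w : ℝ × ℝ → ℝ) : Prop :=
  ∀ ψ : ℝ × ℝ → ℝ, ContDiff ℝ ∞ ψ → HasCompactSupport ψ → tsupport ψ ⊆ Q →
    ∫ z in Q, h z * dv ψ z = -∫ z in Q, w z * ψ z

/-- `h` is a weak solution of `v ∂ₓh - ∂ᵥᵥh = F` in the open set `Q`, without boundary condition: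
`h` and its weak derivative `∂ᵥh` are locally square integrable, and the equation holds against
all smooth test functions with compact support in `Q`. -/
def IsWeakSolutionIn (Q : Set (ℝ × ℝ)) (F h : ℝ × ℝ → ℝ) : Prop :=
  ∃ w : ℝ × ℝ → ℝ, IsLocL2 Q h ∧ IsLocL2 Q w ∧ IsWeakDerivV Q h w ∧
    ∀ ψ : ℝ × ℝ → ℝ, ContDiff ℝ ∞ ψ → HasCompactSupport ψ → tsupport ψ ⊆ Q →
      -(∫ z in Q, h z * (z.2 * dx ψ z)) + ∫ z in Q, w z * dv ψ z = ∫ z in Q, F z * ψ z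

/-- `h` is a weak solution of `v ∂ₓh - ∂ᵥᵥh = F` in `{x > 0} × ℝ` with `h = g` on
`{x = 0} × {v > 0}`: `h` and its weak derivative `∂ᵥh` are square integrable on bounded parts of
the half-plane, and the equation holds against all smooth compactly supported test functions on
the plane whose support meets the line `{x = 0}` only in `{v ≥ 0}`. -/
def IsWeakSolution (F : ℝ × ℝ → ℝ) (g : ℝ → ℝ) (h : ℝ × ℝ → ℝ) : Prop :=
  ∃ w : ℝ × ℝ → ℝ, IsLocL2 halfPlane h ∧ IsLocL2 halfPlane w ∧ IsWeakDerivV halfPlane h w ∧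
    ∀ ψ : ℝ × ℝ → ℝ, ContDiff ℝ ∞ ψ → HasCompactSupport ψ →
      (∀ z ∈ tsupport ψ, z.1 = 0 → 0 ≤ z.2) →
      -(∫ z in halfPlane, h z * (z.2 * dx ψ z)) + ∫ z in halfPlane, w z * dv ψ z =
        (∫ v in Set.Ioi (0 : ℝ), g v * ψ (0, v) * v) + ∫ z in halfPlane, F z * ψ z

/-- `h` is homogeneous of (kinetic) degree `d` in the half-plane:
`h(r³x, rv) = r ^ d * h(x, v)`. -/
def IsKinHomogeneous (d : ℝ) (h : ℝ × ℝ → ℝ) : Prop :=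
  ∀ r : ℝ, 0 < r → ∀ z ∈ halfPlane, h (r ^ 3 * z.1, r * z.2) = r ^ d * h z

/-- Homogeneity of degree `d` for functions defined up to null sets. -/
def IsKinHomogeneousAE (d : ℝ) (h : ℝ × ℝ → ℝ) : Prop :=
  ∀ r : ℝ, 0 < r → ∀ᵐ z ∂(volume.restrict halfPlane), h (r ^ 3 * z.1, r * z.2) = r ^ d * h z

/-- `h` does not grow exponentially as `|(x, v)| → ∞` in the half-plane: it is `O(exp(ε|(x, v)|))`
for every `ε > 0`. -/
def NoExpGrowth (h : ℝ × ℝ → ℝ) : Prop :=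
  ∀ ε : ℝ, 0 < ε → ∃ C R : ℝ, ∀ z ∈ halfPlane, R ≤ ‖z‖ → |h z| ≤ C * Real.exp (ε * ‖z‖)

/-- Absence of exponential growth for functions defined up to null sets. -/
def NoExpGrowthAE (h : ℝ × ℝ → ℝ) : Prop :=
  ∀ ε : ℝ, 0 < ε → ∃ C R : ℝ, ∀ᵐ z ∂(volume.restrict halfPlane),
    R ≤ ‖z‖ → |h z| ≤ C * Real.exp (ε * ‖z‖)

/-- The function `(x, v) ↦ p(x, v)` of a polynomial in two variables. -/
noncomputable def polyFun (p : MvPolynomial (Fin 2) ℝ) (z : ℝ × ℝ) : ℝ :=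
  MvPolynomial.eval ![z.1, z.2] p

/-- `p` is a homogeneous polynomial of kinetic degree `k`, where `x` has degree `3` and `v` has
degree `1`. For `k < 0` only `p = 0` qualifies. -/
def IsKinHomogPoly (p : MvPolynomial (Fin 2) ℝ) (k : ℤ) : Prop :=
  MvPolynomial.IsWeightedHomogeneous (![3, 1] : Fin 2 → ℤ) p k

/-- `p` is a polynomial of kinetic degree at most `k`, that is, `p ∈ 𝒫_k`. -/
def IsKinPoly (p : MvPolynomial (Fin 2) ℝ) (k : ℤ) : Prop :=
  ∀ d ∈ p.support, Finsupp.weight (![3, 1] : Fin 2 → ℤ) d ≤ k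

/-!
# Homogeneous solutions of the stationary kinetic equation in a half-plane

A function which is homogeneous of degree `3 * lam` has the form `x ^ lam * f (v / x ^ (1 / 3))`
(`selfSim`), and it solves `v ∂ₓh = ∂ᵥᵥh` exactly if `f'' + t ^ 2 / 3 * f' + a * t * f = 0` with
`a = -lam` (`IsProfileOn`). In the variable `z = -t ^ 3 / 9` this is Kummer's equation with
parameters `a` and `2 / 3`, so that the profiles form a plane, spanned by `profE` and `profO`. One of
them is distinguished: `profU a` is Tricomi's function on `t ≤ 0`. By its Laplace integral
(`laplaceInt_eq_profU`) and the three-term relation in `a` it has polynomial growth as `t → -∞`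
(`exists_abs_profU_le`), whereas by the Wronskian identity every profile which is not a multiple of
it grows like `exp (|t| ^ 3 / 9)` (`IsProfileOn.eq_const_mul_profU`).

*The functions `φ_m`.* Reflection `t ↦ -t` and multiplication by `exp (-t ^ 3 / 9)` carry profiles
with parameter `2 / 3 - a` to profiles with parameter `a`. For `a = -lamExp m` the result is a
multiple of `profU a`, by the reflection formula of the Gamma function (`profU_eq_mConst_mul`).
Hence both branches of `φ_m` belong to the profile `profU a`, which decays on `t ≥ 0` faster than any
power and gives the boundary value zero.

*Classification.* The operator `v ∂ₓ - ∂ᵥᵥ` maps homogeneous polynomials onto homogeneous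
polynomials (`exists_kinOp_eq`). After subtraction of a polynomial a homogeneous solution is thus
self-similar with a profile `κ * profU (-λ / 3)`. For `λ = 3 * l` and `λ = 3 * l + 1` one of the two
Kummer series in `profU` drops out and the other one terminates, and the solution is a polynomial;
for `λ = 3 * l + 2` it is a multiple of `ψ_l` (`exists_eq_polyFun_add_psi`). The coefficient of `ψ_l`
is unique because `ψ_l(x, 0) = x ^ (l + 2 / 3)` is not a polynomial in `x`. For weak solutions,
homogeneity almost everywhere gives a locally bounded profile almost everywhere
(`exists_ae_eq_selfSim`); test functions `η(x) * χ(v / x ^ (1 / 3))` show that it solves the equation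
of profiles in the sense of distributions (`integral_profile_eq_zero`), and such profiles are
classical (`exists_profile_ae_eq`).

*Weak solutions.* Explicit solutions are weak solutions by integration by parts on `{x > ε}` and
`ε → 0` (`HasKinDerivs.isWeakSolution`). This needs local boundedness, and local square integrability
of the `v`-derivative, which follow from bounds by powers of `x ^ (1 / 3) + |v|`
(`IsAdmissibleProfile`). For `ψ_l` such a bound on `v > 0` holds since
`(t ^ (3 * a) * U(a))'` is a multiple of `t ^ (3 * a - 1) * U(a + 1)`, which permits descent from
`a = 1 / 3`, where the equation is symmetric under reflection (`exists_tendsto_profU_neg`).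
-/

/-! ### Kummer's function -/

/-- The coefficient of `z ^ n` in Kummer's function `M(a, b, z)`. -/
noncomputable def kummerCoeff (a b : ℝ) (n : ℕ) : ℝ :=
  (ascPochhammer ℝ n).eval a / (ascPochhammer ℝ n).eval b / (n.factorial : ℝ)

theorem kummerM_eq_tsum (a b z : ℝ) : kummerM a b z = ∑' n, kummerCoeff a b n * z ^ n := by
  unfold kummerM kummerCoeff
  exact tsum_congr fun n => by ring

theorem ascPochhammer_eval_ne_zero_of_pos {b : ℝ} (hb : 0 < b) (n : ℕ) :
    (ascPochhammer ℝ n).eval b ≠ 0 :=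
  (ascPochhammer_pos n b hb).ne'

theorem abs_ascPochhammer_div_le (a : ℝ) {b K : ℝ} (hb : 0 < b)
    (hK : ∀ n : ℕ, |a + n| ≤ K * (b + n)) (n : ℕ) :
    |(ascPochhammer ℝ n).eval a / (ascPochhammer ℝ n).eval b| ≤ K ^ n := by
  induction n with
  | zero => simp
  | succ n ih =>
    have hbn : 0 < b + n := by positivity
    rw [ascPochhammer_succ_eval, ascPochhammer_succ_eval, mul_div_mul_comm, abs_mul, pow_succ]
    refine mul_le_mul ih ?_ (abs_nonneg _) ((abs_nonneg _).trans ih)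
    rw [abs_div, abs_of_pos hbn, div_le_iff₀ hbn]
    exact hK n

theorem abs_kummerCoeff_mul_pow_le (a : ℝ) {b K : ℝ} (hb : 0 < b)
    (hK : ∀ n : ℕ, |a + n| ≤ K * (b + n)) (z : ℝ) (n : ℕ) :
    |kummerCoeff a b n * z ^ n| ≤ (K * |z|) ^ n / n.factorial := by
  unfold kummerCoeff
  have h0 : (0 : ℝ) < n.factorial := by positivity
  rw [abs_mul, abs_div, abs_of_pos h0, abs_pow, mul_pow, div_mul_eq_mul_div]
  gcongr
  exact abs_ascPochhammer_div_le a hb hK n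

theorem exists_abs_add_le_mul (a : ℝ) {b : ℝ} (hb : 0 < b) (n : ℕ) :
    |a + n| ≤ (|a| / b + 1) * (b + n) := by
  have h1 : |a + n| ≤ |a| + n := (abs_add_le _ _).trans (by simp)
  have h2 : (|a| / b + 1) * (b + n) = |a| + b + |a| / b * n + n := by
    field_simp
    ring
  have h3 : 0 ≤ |a| / b * n := by positivity
  linarith

theorem summable_norm_kummerCoeff (a : ℝ) {b : ℝ} (hb : 0 < b) (z : ℝ) :
    Summable fun n => ‖kummerCoeff a b n * z ^ n‖ :=
  Summable.of_nonneg_of_le (fun _ => norm_nonneg _)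
    (fun n => abs_kummerCoeff_mul_pow_le a hb (exists_abs_add_le_mul a hb) z n)
    (Real.summable_pow_div_factorial _)

theorem summable_kummerCoeff (a : ℝ) {b : ℝ} (hb : 0 < b) (z : ℝ) :
    Summable fun n => kummerCoeff a b n * z ^ n :=
  (summable_norm_kummerCoeff a hb z).of_norm

theorem hasSum_kummerM (a : ℝ) {b : ℝ} (hb : 0 < b) (z : ℝ) :
    HasSum (fun n => kummerCoeff a b n * z ^ n) (kummerM a b z) := by
  rw [kummerM_eq_tsum]
  exact (summable_kummerCoeff a hb z).hasSum

/-- The hypothesis amounts to `|a| ≤ b`; Kummer's series is then dominated term by term by the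
exponential series. -/
theorem abs_kummerM_le_exp (a : ℝ) {b : ℝ} (hb : 0 < b)
    (h : ∀ n : ℕ, |a + n| ≤ b + n) (z : ℝ) : |kummerM a b z| ≤ Real.exp |z| := by
  have h1 := NormedSpace.expSeries_div_hasSum_exp (𝔸 := ℝ) |z|
  rw [← Real.exp_eq_exp_ℝ] at h1
  have h2 := hasSum_kummerM a hb z
  rw [← Real.norm_eq_abs]
  refine h2.norm_le_of_bounded h1 fun n => ?_
  simpa using abs_kummerCoeff_mul_pow_le a hb (K := 1) (by simpa using h) z n

theorem kummerCoeff_zero (a b : ℝ) : kummerCoeff a b 0 = 1 := by simp [kummerCoeff]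

theorem kummerM_zero (a b : ℝ) : kummerM a b 0 = 1 := by
  rw [kummerM_eq_tsum, tsum_eq_single 0]
  · simp [kummerCoeff_zero]
  · intro n hn
    simp [hn]

theorem ascPochhammer_succ_eval_left (a : ℝ) (n : ℕ) :
    (ascPochhammer ℝ (n + 1)).eval a = a * (ascPochhammer ℝ n).eval (a + 1) := by
  rw [ascPochhammer_succ_left]
  simp [Polynomial.eval_comp]

theorem succ_mul_kummerCoeff_succ (a b : ℝ) (n : ℕ) :
    (n + 1) * kummerCoeff a b (n + 1) = a / b * kummerCoeff (a + 1) (b + 1) n := by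
  unfold kummerCoeff
  rw [ascPochhammer_succ_eval_left, ascPochhammer_succ_eval_left, Nat.factorial_succ]
  push_cast
  have : (n : ℝ) + 1 ≠ 0 := by positivity
  have h0 : (n.factorial : ℝ) ≠ 0 := by positivity
  rw [mul_div_mul_comm]
  field_simp

theorem add_mul_succ_mul_kummerCoeff_succ (a : ℝ) {b : ℝ} (hb : 0 < b) (n : ℕ) :
    (b + n) * ((n + 1) * kummerCoeff a b (n + 1)) = (a + n) * kummerCoeff a b n := by
  unfold kummerCoeff
  have h1 := ascPochhammer_eval_ne_zero_of_pos hb n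
  have h2 : b + n ≠ 0 := by positivity
  rw [ascPochhammer_succ_eval, ascPochhammer_succ_eval, Nat.factorial_succ]
  push_cast
  have : (n : ℝ) + 1 ≠ 0 := by positivity
  have h0 : (n.factorial : ℝ) ≠ 0 := by positivity
  field_simp

theorem hasDerivAt_kummerM (a : ℝ) {b : ℝ} (hb : 0 < b) (z : ℝ) :
    HasDerivAt (kummerM a b) (a / b * kummerM (a + 1) (b + 1) z) z := by
  have hb1 : 0 < b + 1 := by positivity
  set R := |z| + 1
  have hsucc : ∀ (n : ℕ) (y : ℝ), kummerCoeff a b (n + 1) * (((n + 1 : ℕ) : ℝ) * y ^ (n + 1 - 1)) =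
      a / b * (kummerCoeff (a + 1) (b + 1) n * y ^ n) := by
    intro n y
    rw [← mul_assoc (a / b), ← succ_mul_kummerCoeff_succ]
    push_cast
    ring_nf
  have hsum : Summable fun n : ℕ => |kummerCoeff a b n| * (n * R ^ (n - 1)) := by
    refine (summable_nat_add_iff 1).1 ?_
    refine ((summable_norm_kummerCoeff (a + 1) hb1 R).mul_left |a / b|).congr fun n => ?_
    have hR : 0 ≤ R := by positivity
    rw [Real.norm_eq_abs, ← abs_mul, ← hsucc, abs_mul]
    congr 1
    exact abs_of_nonneg (by positivity)
  have hz : z ∈ Metric.ball (0 : ℝ) R := by simp [R]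
  have hfun : kummerM a b = fun z => ∑' n, kummerCoeff a b n * z ^ n :=
    funext (kummerM_eq_tsum a b)
  have key := hasDerivAt_tsum_of_isPreconnected (t := Metric.ball (0 : ℝ) R) hsum
    Metric.isOpen_ball (convex_ball _ _).isPreconnected
    (g := fun n z => kummerCoeff a b n * z ^ n)
    (g' := fun n z => kummerCoeff a b n * (n * z ^ (n - 1)))
    (fun n y _ => (hasDerivAt_pow n y).const_mul _)
    (fun n y hy => by
      rw [Real.norm_eq_abs, abs_mul, abs_mul, abs_pow, Nat.abs_cast]
      have : |y| ≤ R := by simpa using (mem_ball_zero_iff.1 hy).le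
      gcongr) hz (summable_kummerCoeff a hb z) hz
  rw [hfun]
  refine key.congr_deriv ?_
  have hS : Summable fun n : ℕ => kummerCoeff a b n * (n * z ^ (n - 1)) := by
    refine (summable_nat_add_iff 1).1 ?_
    exact ((summable_kummerCoeff (a + 1) hb1 z).mul_left (a / b)).congr fun n => (hsucc n z).symm
  rw [hS.tsum_eq_zero_add, tsum_congr (fun n => hsucc n z), tsum_mul_left, kummerM_eq_tsum]
  simp

theorem hasSum_mul_deriv_kummerM (a : ℝ) {b : ℝ} (hb : 0 < b) (z : ℝ) :
    HasSum (fun n : ℕ => n * (kummerCoeff a b n * z ^ n))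
      (z * (a / b * kummerM (a + 1) (b + 1) z)) := by
  have h := (hasSum_kummerM (a + 1) (b := b + 1) (by positivity) z).mul_left (z * (a / b))
  rw [← mul_assoc]
  refine (hasSum_nat_add_iff' 1).1 ?_
  simp only [Finset.sum_range_one, Nat.cast_zero, zero_mul, sub_zero]
  refine h.congr_fun fun n => ?_
  have := succ_mul_kummerCoeff_succ a b n
  push_cast
  linear_combination z ^ (n + 1) * this

/-- `z M' = a (M(a + 1) - M(a))`. -/
theorem mul_deriv_kummerM (a : ℝ) {b : ℝ} (hb : 0 < b) (z : ℝ) :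
    z * (a / b * kummerM (a + 1) (b + 1) z) = a * (kummerM (a + 1) b z - kummerM a b z) := by
  refine (hasSum_mul_deriv_kummerM a hb z).unique ?_
  refine (((hasSum_kummerM (a + 1) hb z).sub (hasSum_kummerM a hb z)).mul_left a).congr_fun ?_
  intro n
  have h : a * (ascPochhammer ℝ n).eval (a + 1) = (ascPochhammer ℝ n).eval a * (a + n) := by
    rw [← ascPochhammer_succ_eval_left, ascPochhammer_succ_eval]
  unfold kummerCoeff
  linear_combination (-z ^ n / (ascPochhammer ℝ n).eval b / (n.factorial : ℝ)) * h

/-- `z M' = (b - a) M(a - 1) + (a - b + z) M(a)`, shifted by one in `a`. -/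
theorem mul_deriv_kummerM' (a : ℝ) {b : ℝ} (hb : 0 < b) (z : ℝ) :
    z * ((a + 1) / b * kummerM (a + 1 + 1) (b + 1) z) =
      (b - (a + 1)) * kummerM a b z + (a + 1 - b + z) * kummerM (a + 1) b z := by
  have h1 := ((hasSum_mul_deriv_kummerM (a + 1) hb z).sub
    ((hasSum_kummerM a hb z).mul_left (b - (a + 1)))).sub
    ((hasSum_kummerM (a + 1) hb z).mul_left (a + 1 - b))
  have h2 := (hasSum_nat_add_iff' 1).2 h1
  have h3 := (hasSum_kummerM (a + 1) hb z).mul_left z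
  have h4 := h2.unique (h3.congr_fun fun n => ?_)
  · simp only [Finset.sum_range_one, kummerCoeff_zero] at h4
    push_cast at h4
    linear_combination h4
  · unfold kummerCoeff
    have hn := ascPochhammer_eval_ne_zero_of_pos hb n
    have h2 : b + n ≠ 0 := by positivity
    have h5 : (n : ℝ) + 1 ≠ 0 := by positivity
    have h0 : (n.factorial : ℝ) ≠ 0 := by positivity
    rw [ascPochhammer_succ_eval_left a n, ascPochhammer_succ_eval, ascPochhammer_succ_eval,
      Nat.factorial_succ]
    push_cast
    field_simp
    ring

/-- The three-term relation in the first parameter. -/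
theorem kummerM_contiguous (a : ℝ) {b : ℝ} (hb : 0 < b) (z : ℝ) :
    (b - (a + 1)) * kummerM a b z + (2 * (a + 1) - b + z) * kummerM (a + 1) b z =
      (a + 1) * kummerM (a + 1 + 1) b z := by
  linear_combination mul_deriv_kummerM (a + 1) hb z - mul_deriv_kummerM' a hb z

/-- Kummer's equation `z M'' + (b - z) M' - a M = 0`. -/
theorem kummerM_ode (a : ℝ) {b : ℝ} (hb : 0 < b) (z : ℝ) :
    z * (a / b * ((a + 1) / (b + 1) * kummerM (a + 1 + 1) (b + 1 + 1) z)) +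
      (b - z) * (a / b * kummerM (a + 1) (b + 1) z) - a * kummerM a b z = 0 := by
  have hb1 : 0 < b + 1 := by positivity
  have h1 := (hasSum_mul_deriv_kummerM (a + 1) hb1 z).mul_left (a / b)
  have h2 := (hasSum_kummerM (a + 1) hb1 z).mul_left (b * (a / b))
  have h3 := hasSum_mul_deriv_kummerM a hb z
  have h4 := (hasSum_kummerM a hb z).mul_left a
  have h := (((h1.add h2).sub h3).sub h4).unique (hasSum_zero.congr_fun fun n => ?_)
  · linear_combination h
  · have e1 := succ_mul_kummerCoeff_succ a b n
    have e2 := add_mul_succ_mul_kummerCoeff_succ a hb n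
    linear_combination z ^ n * e2 - z ^ n * (b + n) * e1

theorem contDiff_kummerM_nat (k : ℕ) : ∀ (a : ℝ) {b : ℝ}, 0 < b →
    ContDiff ℝ k (kummerM a b) := by
  induction k with
  | zero =>
    intro a b hb
    exact contDiff_zero.2 (continuous_iff_continuousAt.2 fun z =>
      (hasDerivAt_kummerM a hb z).continuousAt)
  | succ k ih =>
    intro a b hb
    push_cast
    refine contDiff_succ_iff_deriv.2 ⟨fun z => (hasDerivAt_kummerM a hb z).differentiableAt,
      fun h => absurd h (by simp), ?_⟩
    rw [funext fun z => (hasDerivAt_kummerM a hb z).deriv]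
    exact contDiff_const.mul (ih (a + 1) (by positivity))

theorem contDiff_kummerM (a : ℝ) {b : ℝ} (hb : 0 < b) : ContDiff ℝ ∞ (kummerM a b) :=
  contDiff_infty.2 fun k => contDiff_kummerM_nat k a hb

/-! ### The equation of self-similar profiles -/

/-- `f` is a profile with parameter `a` on `s`: there it solves the equation
`f'' + t ^ 2 / 3 * f' + a * t * f = 0`, which says that `x ^ (-a) * f (v / x ^ (1 / 3))` solves
`v ∂ₓh = ∂ᵥᵥh`. In the variable `z = -t ^ 3 / 9` it becomes Kummer's equation with parameters
`a` and `2 / 3`, but it is regular at the origin. -/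
structure IsProfileOn (s : Set ℝ) (a : ℝ) (f : ℝ → ℝ) : Prop where
  hasDerivAt : ∀ t ∈ s, HasDerivAt f (deriv f t) t
  hasDerivAt_deriv : ∀ t ∈ s, HasDerivAt (deriv f) (-(a * t * f t) - t ^ 2 / 3 * deriv f t) t

theorem IsProfileOn.of_hasDerivAt {s : Set ℝ} {a : ℝ} {f f' : ℝ → ℝ} (hs : IsOpen s)
    (h1 : ∀ t ∈ s, HasDerivAt f (f' t) t)
    (h2 : ∀ t ∈ s, HasDerivAt f' (-(a * t * f t) - t ^ 2 / 3 * f' t) t) : IsProfileOn s a f := by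
  refine ⟨fun t ht => (h1 t ht).differentiableAt.hasDerivAt, fun t ht => ?_⟩
  rw [(h1 t ht).deriv]
  refine (h2 t ht).congr_of_eventuallyEq ?_
  filter_upwards [hs.mem_nhds ht] with u hu using (h1 u hu).deriv

theorem IsProfileOn.mono {s s' : Set ℝ} {a : ℝ} {f : ℝ → ℝ} (h : IsProfileOn s a f)
    (hs : s' ⊆ s) : IsProfileOn s' a f :=
  ⟨fun t ht => h.1 t (hs ht), fun t ht => h.2 t (hs ht)⟩

theorem IsProfileOn.linear_comb {s : Set ℝ} {a : ℝ} {f g : ℝ → ℝ} (hs : IsOpen s)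
    (hf : IsProfileOn s a f) (hg : IsProfileOn s a g) (c d : ℝ) :
    IsProfileOn s a (fun t => c * f t + d * g t) := by
  refine .of_hasDerivAt hs (f' := fun t => c * deriv f t + d * deriv g t)
    (fun t ht => ((hf.1 t ht).const_mul c).add ((hg.1 t ht).const_mul d)) fun t ht => ?_
  refine (((hf.2 t ht).const_mul c).add ((hg.2 t ht).const_mul d)).congr_deriv ?_
  ring

theorem IsProfileOn.const_mul {s : Set ℝ} {a : ℝ} {f : ℝ → ℝ} (hs : IsOpen s)
    (hf : IsProfileOn s a f) (c : ℝ) : IsProfileOn s a (fun t => c * f t) := by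
  simpa using hf.linear_comb hs hf c 0

theorem IsProfileOn.continuous {a : ℝ} {f : ℝ → ℝ} (hf : IsProfileOn Set.univ a f) :
    Continuous f :=
  continuous_iff_continuousAt.2 fun t => (hf.1 t trivial).continuousAt

theorem IsProfileOn.continuous_deriv {a : ℝ} {f : ℝ → ℝ} (hf : IsProfileOn Set.univ a f) :
    Continuous (deriv f) :=
  continuous_iff_continuousAt.2 fun t => (hf.2 t trivial).continuousAt

theorem hasDerivAt_neg_cube_div (t : ℝ) :
    HasDerivAt (fun t : ℝ => -t ^ 3 / 9) (-(t ^ 2 / 3)) t := by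
  refine (((hasDerivAt_pow 3 t).neg).div_const 9).congr_deriv ?_
  norm_num
  ring

theorem hasDerivAt_exp_cube (t : ℝ) :
    HasDerivAt (fun t : ℝ => Real.exp (t ^ 3 / 9)) (Real.exp (t ^ 3 / 9) * (t ^ 2 / 3)) t := by
  have h : HasDerivAt (fun t : ℝ => t ^ 3 / 9) (t ^ 2 / 3) t := by
    refine ((hasDerivAt_pow 3 t).div_const 9).congr_deriv ?_
    norm_num
    ring
  exact h.exp

/-- Solutions `y` of Kummer's equation with parameters `a` and `2 / 3`, with derivatives `y₁` and `y₂`,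
give profiles through the substitution `z = -t ^ 3 / 9`. -/
theorem IsProfileOn.of_kummer {s : Set ℝ} {a : ℝ} {y y₁ y₂ : ℝ → ℝ} (hs : IsOpen s)
    (h1 : ∀ t ∈ s, HasDerivAt y (y₁ (-t ^ 3 / 9)) (-t ^ 3 / 9))
    (h2 : ∀ t ∈ s, HasDerivAt y₁ (y₂ (-t ^ 3 / 9)) (-t ^ 3 / 9))
    (h3 : ∀ t ∈ s, -t ^ 3 / 9 * y₂ (-t ^ 3 / 9) + (2 / 3 - -t ^ 3 / 9) * y₁ (-t ^ 3 / 9)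
      - a * y (-t ^ 3 / 9) = 0) :
    IsProfileOn s a (fun t => y (-t ^ 3 / 9)) := by
  refine .of_hasDerivAt hs (f' := fun t => y₁ (-t ^ 3 / 9) * -(t ^ 2 / 3))
    (fun t ht => (h1 t ht).comp t (hasDerivAt_neg_cube_div t)) fun t ht => ?_
  have hq : HasDerivAt (fun t : ℝ => -(t ^ 2 / 3)) (-(2 * t / 3)) t := by
    refine (((hasDerivAt_pow 2 t).div_const 3).neg).congr_deriv ?_
    norm_num
  refine (((h2 t ht).comp t (hasDerivAt_neg_cube_div t)).mul hq).congr_deriv ?_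
  simp only [Function.comp]
  linear_combination (-t) * h3 t ht

/-- The profile with parameter `a`, value `1` and slope `0` at the origin. -/
noncomputable def profE (a t : ℝ) : ℝ := kummerM a (2 / 3) (-t ^ 3 / 9)

/-- The profile with parameter `a`, value `0` and slope `1` at the origin. -/
noncomputable def profO (a t : ℝ) : ℝ := t * kummerM (a + 1 / 3) (4 / 3) (-t ^ 3 / 9)

theorem contDiff_profE (a : ℝ) : ContDiff ℝ ∞ (profE a) :=
  (contDiff_kummerM a (by norm_num)).comp (by fun_prop)

theorem contDiff_profO (a : ℝ) : ContDiff ℝ ∞ (profO a) :=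
  contDiff_id.mul ((contDiff_kummerM (a + 1 / 3) (by norm_num)).comp (by fun_prop))

theorem hasDerivAt_profE (a t : ℝ) :
    HasDerivAt (profE a)
      (a / (2 / 3) * kummerM (a + 1) (2 / 3 + 1) (-t ^ 3 / 9) * -(t ^ 2 / 3)) t :=
  (hasDerivAt_kummerM a (by norm_num) _).comp t (hasDerivAt_neg_cube_div t)

theorem hasDerivAt_profO (a t : ℝ) :
    HasDerivAt (profO a) (kummerM (a + 1 / 3) (4 / 3) (-t ^ 3 / 9) +
      t * ((a + 1 / 3) / (4 / 3) * kummerM (a + 1 / 3 + 1) (4 / 3 + 1) (-t ^ 3 / 9) *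
        -(t ^ 2 / 3))) t := by
  refine ((hasDerivAt_id t).mul ((hasDerivAt_kummerM (a + 1 / 3) (b := 4 / 3) (by norm_num)
    _).comp t (hasDerivAt_neg_cube_div t))).congr_deriv ?_
  simp

theorem isProfileOn_profE (a : ℝ) : IsProfileOn Set.univ a (profE a) := by
  refine .of_kummer isOpen_univ (y := kummerM a (2 / 3))
    (y₁ := fun z => a / (2 / 3) * kummerM (a + 1) (2 / 3 + 1) z)
    (y₂ := fun z => a / (2 / 3) * ((a + 1) / (2 / 3 + 1) * kummerM (a + 1 + 1) (2 / 3 + 1 + 1) z))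
    (fun t _ => hasDerivAt_kummerM a (by norm_num) _)
    (fun t _ => (hasDerivAt_kummerM (a + 1) (by norm_num) _).const_mul _)
    fun t _ => kummerM_ode a (by norm_num) _

theorem isProfileOn_profO (a : ℝ) : IsProfileOn Set.univ a (profO a) := by
  refine .of_hasDerivAt isOpen_univ (fun t _ => hasDerivAt_profO a t) fun t _ => ?_
  have hc := hasDerivAt_neg_cube_div t
  have k1 := (hasDerivAt_kummerM (a + 1 / 3) (b := 4 / 3) (by norm_num) (-t ^ 3 / 9)).comp t hc
  have k2 := (hasDerivAt_kummerM (a + 1 / 3 + 1) (b := 4 / 3 + 1) (by norm_num)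
    (-t ^ 3 / 9)).comp t hc
  have hq : HasDerivAt (fun t : ℝ => -(t ^ 2 / 3)) (-(2 * t / 3)) t := by
    refine (((hasDerivAt_pow 2 t).div_const 3).neg).congr_deriv ?_
    norm_num
  have ode := kummerM_ode (a + 1 / 3) (b := 4 / 3) (by norm_num) (-t ^ 3 / 9)
  refine (k1.add ((hasDerivAt_id t).mul
    ((k2.const_mul ((a + 1 / 3) / (4 / 3))).mul hq))).congr_deriv ?_
  simp only [Function.comp, id, profO, Pi.mul_apply]
  linear_combination (-t ^ 2) * ode

theorem profE_zero (a : ℝ) : profE a 0 = 1 := by simp [profE, kummerM_zero]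

theorem profO_zero (a : ℝ) : profO a 0 = 0 := by simp [profO]

theorem deriv_profE_zero (a : ℝ) : deriv (profE a) 0 = 0 := by
  simp [(hasDerivAt_profE a 0).deriv]

theorem deriv_profO_zero (a : ℝ) : deriv (profO a) 0 = 1 := by
  simp [(hasDerivAt_profO a 0).deriv, kummerM_zero]

/-- The Wronskian of two profiles is a multiple of `exp (-t ^ 3 / 9)`. -/
theorem IsProfileOn.wronskian {s : Set ℝ} {a : ℝ} {f g : ℝ → ℝ} (hs : IsOpen s)
    (hc : Convex ℝ s) (hf : IsProfileOn s a f) (hg : IsProfileOn s a g) :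
    ∃ c, ∀ t ∈ s, Real.exp (t ^ 3 / 9) * (f t * deriv g t - deriv f t * g t) = c := by
  have hd : ∀ t ∈ s, HasDerivAt
      (fun t => Real.exp (t ^ 3 / 9) * (f t * deriv g t - deriv f t * g t)) 0 t := fun t ht => by
    refine ((hasDerivAt_exp_cube t).mul
      (((hf.1 t ht).mul (hg.2 t ht)).sub ((hf.2 t ht).mul (hg.1 t ht)))).congr_deriv ?_
    simp only [Pi.sub_apply, Pi.mul_apply]
    ring
  refine hs.exists_is_const_of_deriv_eq_zero hc.isPreconnected
    (fun t ht => (hd t ht).differentiableAt.differentiableWithinAt) fun t ht => (hd t ht).deriv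

theorem wronskian_profE_profO (a t : ℝ) :
    Real.exp (t ^ 3 / 9) * (profE a t * deriv (profO a) t - deriv (profE a) t * profO a t) = 1 := by
  obtain ⟨c, hc⟩ := (isProfileOn_profE a).wronskian isOpen_univ convex_univ (isProfileOn_profO a)
  have h0 := hc 0 trivial
  simp [profE_zero, profO_zero, deriv_profO_zero] at h0
  rw [hc t trivial, h0]

/-- On a convex open set the profiles are the linear combinations of `profE` and `profO`. -/
theorem IsProfileOn.exists_eq {s : Set ℝ} {a : ℝ} {f : ℝ → ℝ} (hs : IsOpen s) (hc : Convex ℝ s)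
    (hf : IsProfileOn s a f) : ∃ c d, ∀ t ∈ s, f t = c * profE a t + d * profO a t ∧
      deriv f t = c * deriv (profE a) t + d * deriv (profO a) t := by
  obtain ⟨c, h1⟩ := hf.wronskian hs hc ((isProfileOn_profO a).mono (Set.subset_univ s))
  obtain ⟨d, h2⟩ := IsProfileOn.wronskian hs hc
    ((isProfileOn_profE a).mono (Set.subset_univ s)) hf
  refine ⟨c, d, fun t ht => ?_⟩
  have h3 := wronskian_profE_profO a t
  rw [← h1 t ht, ← h2 t ht]
  constructor
  · linear_combination (-f t) * h3
  · linear_combination (-deriv f t) * h3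

theorem IsProfileOn.eq_univ {a : ℝ} {f : ℝ → ℝ} (hf : IsProfileOn Set.univ a f) (t : ℝ) :
    f t = f 0 * profE a t + deriv f 0 * profO a t := by
  obtain ⟨c, d, h⟩ := hf.exists_eq isOpen_univ convex_univ
  have h0 := h 0 trivial
  simp only [profE_zero, profO_zero, deriv_profE_zero, deriv_profO_zero] at h0
  rw [(h t trivial).1, h0.1, h0.2]
  ring

theorem IsProfileOn.ext {a : ℝ} {f g : ℝ → ℝ} (hf : IsProfileOn Set.univ a f)
    (hg : IsProfileOn Set.univ a g) (h0 : f 0 = g 0) (h1 : deriv f 0 = deriv g 0) : f = g := by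
  funext t
  rw [hf.eq_univ, hg.eq_univ, h0, h1]

/-- Kummer's transformation in terms of profiles: reflection and multiplication by
`exp (-t ^ 3 / 9)` turn the parameter `a` into `2 / 3 - a`. -/
theorem IsProfileOn.reflect {a : ℝ} {f : ℝ → ℝ} (hf : IsProfileOn Set.univ a f) :
    IsProfileOn Set.univ (2 / 3 - a) (fun t => Real.exp (-t ^ 3 / 9) * f (-t)) := by
  have hE : ∀ t : ℝ, HasDerivAt (fun t : ℝ => Real.exp (-t ^ 3 / 9))
      (Real.exp (-t ^ 3 / 9) * -(t ^ 2 / 3)) t := fun t => (hasDerivAt_neg_cube_div t).exp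
  have hf1 : ∀ t, HasDerivAt (fun t => f (-t)) (-deriv f (-t)) t := fun t =>
    ((hf.1 (-t) trivial).comp t (hasDerivAt_neg t)).congr_deriv (by ring)
  have hf2 : ∀ t, HasDerivAt (fun t => deriv f (-t))
      (-(-(a * -t * f (-t)) - t ^ 2 / 3 * deriv f (-t))) t := fun t => by
    refine ((hf.2 (-t) trivial).comp t (hasDerivAt_neg t)).congr_deriv ?_
    ring
  refine .of_hasDerivAt isOpen_univ (f' := fun t => Real.exp (-t ^ 3 / 9) * -(t ^ 2 / 3) * f (-t) +
    Real.exp (-t ^ 3 / 9) * -deriv f (-t)) (fun t _ => (hE t).mul (hf1 t)) fun t _ => ?_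
  have hq : HasDerivAt (fun t : ℝ => -(t ^ 2 / 3)) (-(2 * t / 3)) t := by
    refine (((hasDerivAt_pow 2 t).div_const 3).neg).congr_deriv ?_
    norm_num
  refine ((((hE t).mul hq).mul (hf1 t)).add ((hE t).mul (hf2 t).neg)).congr_deriv ?_
  simp only [Pi.mul_apply, Pi.neg_apply]
  ring

/-- The profile which on `t ≤ 0` is Tricomi's function `U(a, 2 / 3, -t ^ 3 / 9)`. -/
noncomputable def profU (a t : ℝ) : ℝ :=
  Real.Gamma (1 / 3) / Real.Gamma (a + 1 / 3) * profE a t +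
    -(Real.Gamma (-(1 / 3)) / Real.Gamma a / 9 ^ (1 / 3 : ℝ)) * profO a t

theorem isProfileOn_profU (a : ℝ) : IsProfileOn Set.univ a (profU a) :=
  (isProfileOn_profE a).linear_comb isOpen_univ (isProfileOn_profO a) _ _

theorem profU_zero (a : ℝ) : profU a 0 = Real.Gamma (1 / 3) / Real.Gamma (a + 1 / 3) := by
  simp [profU, profE_zero, profO_zero]

theorem hasDerivAt_profU (a t : ℝ) : HasDerivAt (profU a)
    (Real.Gamma (1 / 3) / Real.Gamma (a + 1 / 3) * deriv (profE a) t +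
    -(Real.Gamma (-(1 / 3)) / Real.Gamma a / 9 ^ (1 / 3 : ℝ)) * deriv (profO a) t) t :=
  (((isProfileOn_profE a).1 t trivial).const_mul _).add
    (((isProfileOn_profO a).1 t trivial).const_mul _)

theorem deriv_profU_zero (a : ℝ) :
    deriv (profU a) 0 = -(Real.Gamma (-(1 / 3)) / Real.Gamma a / 9 ^ (1 / 3 : ℝ)) := by
  simp [(hasDerivAt_profU a 0).deriv, deriv_profE_zero, deriv_profO_zero]

/-- The functional equation of `1 / Γ`. It holds for all `a`, poles of `Γ` included, since there the
value `Γ = 0` makes both sides vanish. -/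
theorem inv_Gamma_eq (a : ℝ) : (Real.Gamma a)⁻¹ = a * (Real.Gamma (a + 1))⁻¹ := by
  rcases eq_or_ne a 0 with rfl | ha
  · simp [Real.Gamma_zero]
  · rw [Real.Gamma_add_one ha]
    field_simp

/-- The three-term relation for Tricomi's function. -/
theorem profU_contiguous (a t : ℝ) : profU a t =
    (2 * (a + 1) - 2 / 3 + -t ^ 3 / 9) * profU (a + 1) t -
      (a + 1) * (a + 4 / 3) * profU (a + 2) t := by
  have h1 := kummerM_contiguous a (b := 2 / 3) (by norm_num) (-t ^ 3 / 9)
  have h2 := kummerM_contiguous (a + 1 / 3) (b := 4 / 3) (by norm_num) (-t ^ 3 / 9)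
  unfold profU profE profO
  simp only [div_eq_mul_inv (Real.Gamma _)]
  rw [inv_Gamma_eq (a + 1 / 3), inv_Gamma_eq (a + 1 / 3 + 1), inv_Gamma_eq a, inv_Gamma_eq (a + 1)]
  rw [show a + 1 / 3 + 1 + 1 = a + 2 + 1 / 3 by ring, show a + 1 / 3 + 1 = a + 1 + 1 / 3 by ring]
    at h2
  rw [show a + 1 + 1 = a + 2 by ring] at h1
  rw [show a + 1 / 3 + 1 + 1 = a + 2 + 1 / 3 by ring, show a + 1 + 1 = a + 2 by ring,
    inv_Gamma_eq (a + 1 + 1 / 3), show a + 1 + 1 / 3 + 1 = a + 2 + 1 / 3 by ring]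
  generalize Real.Gamma (a + 2) = G2
  generalize Real.Gamma (a + 2 + 1 / 3) = G3
  linear_combination (-(Real.Gamma (1 / 3) * ((a + 1 + 1 / 3) * G3⁻¹))) * h1 +
    (Real.Gamma (-(1 / 3)) * ((a + 1) * G2⁻¹) / 9 ^ (1 / 3 : ℝ) * t) * h2

/-- The relation between `U'(a)`, `U(a)` and `U(a + 1)`. It turns bounds for `U` into bounds for its
derivative. -/
theorem mul_deriv_profU (a t : ℝ) : t * deriv (profU a) t =
    3 * (-a * profU a t + a * (a + 1 / 3) * profU (a + 1) t) := by
  have h1 := mul_deriv_kummerM a (b := 2 / 3) (by norm_num) (-t ^ 3 / 9)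
  have h2 := mul_deriv_kummerM (a + 1 / 3) (b := 4 / 3) (by norm_num) (-t ^ 3 / 9)
  rw [(hasDerivAt_profU a t).deriv, (hasDerivAt_profE a t).deriv, (hasDerivAt_profO a t).deriv]
  unfold profU profE profO
  simp only [div_eq_mul_inv (Real.Gamma _)]
  rw [inv_Gamma_eq (a + 1 / 3), inv_Gamma_eq a]
  rw [show a + 1 / 3 + 1 = a + 1 + 1 / 3 by ring] at h2 ⊢
  linear_combination 3 * (Real.Gamma (1 / 3) * ((a + 1 / 3) * (Real.Gamma (a + 1 + 1 / 3))⁻¹)) * h1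
    - 3 * (Real.Gamma (-(1 / 3)) * (a * (Real.Gamma (a + 1))⁻¹) / 9 ^ (1 / 3 : ℝ) * t) * h2

theorem rpow_neg_cube_div {t : ℝ} (ht : t ≤ 0) :
    (-t ^ 3 / 9) ^ (1 / 3 : ℝ) = -t / 9 ^ (1 / 3 : ℝ) := by
  have h : -t ^ 3 = (-t) ^ 3 := by ring
  rw [h, Real.div_rpow (by have : 0 ≤ -t := by linarith
                           positivity) (by norm_num), ← Real.rpow_natCast,
    ← Real.rpow_mul (by linarith)]
  norm_num

theorem tricomiU_eq_profU (a : ℝ) {t : ℝ} (ht : t ≤ 0) :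
    tricomiU a (2 / 3) (-t ^ 3 / 9) = profU a t := by
  unfold tricomiU profU profE profO
  rw [show (1 : ℝ) - 2 / 3 = 1 / 3 by norm_num, rpow_neg_cube_div ht,
    show a - 2 / 3 + 1 = a + 1 / 3 by ring, show (2 : ℝ) - 2 / 3 = 4 / 3 by norm_num,
    show (2 / 3 : ℝ) - 1 = -(1 / 3) by norm_num]
  ring

/-! ### The Laplace integral of Tricomi's function -/

theorem integral_Ioo_rpow_mul_one_sub_rpow {a c : ℝ} (ha : 0 < a) (hc : 0 < c) :
    ∫ u in Set.Ioo (0 : ℝ) 1, u ^ (a - 1) * (1 - u) ^ (c - 1) =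
      Real.Gamma a * Real.Gamma c / Real.Gamma (a + c) := by
  have h := ProbabilityTheory.beta_eq_betaIntegralReal a c ha hc
  rw [ProbabilityTheory.beta] at h
  rw [h, Complex.betaIntegral, intervalIntegral.integral_of_le zero_le_one,
    ← integral_Ioc_eq_integral_Ioo]
  have h2 : ∫ x in Set.Ioc (0 : ℝ) 1, (x : ℂ) ^ ((a : ℂ) - 1) * (1 - (x : ℂ)) ^ ((c : ℂ) - 1) =
      ∫ x in Set.Ioc (0 : ℝ) 1, ((x ^ (a - 1) * (1 - x) ^ (c - 1) : ℝ) : ℂ) := by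
    refine setIntegral_congr_fun measurableSet_Ioc fun x hx => ?_
    have h1 : 0 ≤ 1 - x := by linarith [hx.2]
    rw [Complex.ofReal_mul, Complex.ofReal_cpow hx.1.le, Complex.ofReal_cpow h1]
    push_cast
    rfl
  rw [h2, integral_complex_ofReal, Complex.ofReal_re]

/-- The Beta integral on the half-line, with exponents as they occur in the integral for
`U(a, 1 - c, 0)`. -/
theorem integral_Ioi_rpow_mul_one_add_rpow {a c : ℝ} (ha : 0 < a) (hc : 0 < c) :
    ∫ t in Set.Ioi (0 : ℝ), t ^ (a - 1) * (1 + t) ^ (-a - c) =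
      Real.Gamma a * Real.Gamma c / Real.Gamma (a + c) := by
  have him : (fun t : ℝ => t / (1 + t)) '' Set.Ioi 0 = Set.Ioo 0 1 := by
    ext u
    constructor
    · rintro ⟨t, ht, rfl⟩
      have ht : 0 < t := ht
      exact ⟨by positivity, by rw [div_lt_one (by positivity)]; linarith⟩
    · rintro ⟨h0, h1⟩
      have h2 : 0 < 1 - u := by linarith
      refine ⟨u / (1 - u), div_pos h0 h2, ?_⟩
      field_simp
      ring
  have hd : ∀ t ∈ Set.Ioi (0 : ℝ), HasDerivWithinAt (fun t : ℝ => t / (1 + t))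
      (((1 + t) ^ 2)⁻¹) (Set.Ioi 0) t := fun t ht => by
    have ht : 0 < t := ht
    have h1 : 1 + t ≠ 0 := by positivity
    refine (((hasDerivAt_id t).div ((hasDerivAt_id t).const_add 1) h1).congr_deriv
      ?_).hasDerivWithinAt
    simp only [id]
    field_simp
    ring
  have hinj : Set.InjOn (fun t : ℝ => t / (1 + t)) (Set.Ioi 0) := fun s hs t ht h => by
    have hs : 0 < s := hs
    have ht : 0 < t := ht
    simp only at h
    rw [div_eq_div_iff (by positivity) (by positivity)] at h
    linarith
  rw [← integral_Ioo_rpow_mul_one_sub_rpow ha hc, ← him,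
    integral_image_eq_integral_abs_deriv_smul measurableSet_Ioi hd hinj]
  refine setIntegral_congr_fun measurableSet_Ioi fun t ht => ?_
  have ht : 0 < t := ht
  have h1 : 0 < 1 + t := by positivity
  have h2 : 1 - t / (1 + t) = (1 + t)⁻¹ := by
    field_simp
    ring
  simp only [smul_eq_mul]
  rw [abs_of_pos (by positivity), h2, Real.div_rpow ht.le h1.le, Real.inv_rpow h1.le,
    ← Real.rpow_neg h1.le, div_eq_mul_inv, ← Real.rpow_neg h1.le, ← Real.rpow_natCast,
    ← Real.rpow_neg h1.le, mul_assoc, mul_left_comm, ← Real.rpow_add h1, ← Real.rpow_add h1]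
  congr 2
  push_cast
  ring

/-- The integral `∫ exp(-zt) t ^ p (1 + t) ^ q` over `t > 0`; for `p = a - 1`, `q = b - a - 1`
it is `Γ(a) U(a, b, z)`. -/
noncomputable def laplaceInt (p q z : ℝ) : ℝ :=
  ∫ t in Set.Ioi (0 : ℝ), Real.exp (-(z * t)) * t ^ p * (1 + t) ^ q

theorem integrableOn_exp_mul_rpow {p z : ℝ} (hp : -1 < p) (hz : 0 < z) :
    IntegrableOn (fun t : ℝ => Real.exp (-(z * t)) * t ^ p) (Set.Ioi 0) := by
  have h := integrableOn_rpow_mul_exp_neg_mul_rpow hp one_pos hz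
  refine h.congr_fun (fun t _ => ?_) measurableSet_Ioi
  simp [mul_comm]

theorem continuousOn_laplace_integrand (p q z : ℝ) :
    ContinuousOn (fun t : ℝ => Real.exp (-(z * t)) * t ^ p * (1 + t) ^ q) (Set.Ioi 0) := by
  have h1 : ContinuousOn (fun t : ℝ => t ^ p) (Set.Ioi 0) :=
    continuousOn_id.rpow_const fun t ht => Or.inl (ne_of_gt ht)
  have h2 : ContinuousOn (fun t : ℝ => (1 + t) ^ q) (Set.Ioi 0) := by
    refine (continuousOn_const.add continuousOn_id).rpow_const fun t ht => Or.inl ?_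
    have ht : 0 < t := ht
    exact (by positivity : 1 + t ≠ 0)
  exact ((by fun_prop : Continuous fun t : ℝ => Real.exp (-(z * t))).continuousOn.mul h1).mul h2

theorem measurable_laplace_integrand (p q z : ℝ) :
    AEStronglyMeasurable (fun t : ℝ => Real.exp (-(z * t)) * t ^ p * (1 + t) ^ q)
      (volume.restrict (Set.Ioi 0)) :=
  (continuousOn_laplace_integrand p q z).aestronglyMeasurable measurableSet_Ioi

theorem one_add_rpow_le_one {q t : ℝ} (hq : q ≤ 0) (ht : 0 < t) : (1 + t) ^ q ≤ 1 :=
  Real.rpow_le_one_of_one_le_of_nonpos (by linarith) hq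

theorem norm_laplace_integrand_le {p q z t : ℝ} (hq : q ≤ 0) (ht : 0 < t) :
    ‖Real.exp (-(z * t)) * t ^ p * (1 + t) ^ q‖ ≤ Real.exp (-(z * t)) * t ^ p := by
  have h := one_add_rpow_le_one hq ht
  rw [Real.norm_of_nonneg (by positivity)]
  exact mul_le_of_le_one_right (by positivity) h

theorem integrableOn_laplace_integrand {p q z : ℝ} (hp : -1 < p) (hq : q ≤ 0) (hz : 0 < z) :
    IntegrableOn (fun t : ℝ => Real.exp (-(z * t)) * t ^ p * (1 + t) ^ q) (Set.Ioi 0) :=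
  (integrableOn_exp_mul_rpow hp hz).mono' (measurable_laplace_integrand p q z)
    ((ae_restrict_iff' measurableSet_Ioi).2 (ae_of_all _ fun _ ht =>
      norm_laplace_integrand_le hq ht))

theorem hasDerivAt_laplaceInt {p q z : ℝ} (hp : -1 < p) (hq : q ≤ 0) (hz : 0 < z) :
    HasDerivAt (laplaceInt p q) (-laplaceInt (p + 1) q z) z := by
  have h := (hasDerivAt_integral_of_dominated_loc_of_deriv_le (𝕜 := ℝ)
    (μ := volume.restrict (Set.Ioi (0 : ℝ)))
    (F := fun z t => Real.exp (-(z * t)) * t ^ p * (1 + t) ^ q)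
    (F' := fun z t => -(Real.exp (-(z * t)) * t ^ (p + 1) * (1 + t) ^ q))
    (bound := fun t => Real.exp (-(z / 2 * t)) * t ^ (p + 1)) (x₀ := z)
    (Ioi_mem_nhds (by linarith : z / 2 < z))
    (Eventually.of_forall fun y => measurable_laplace_integrand p q y)
    (integrableOn_laplace_integrand hp hq hz)
    (measurable_laplace_integrand (p + 1) q z).neg ?_
    (integrableOn_exp_mul_rpow (by linarith) (by linarith)) ?_).2
  · rw [integral_neg] at h
    exact h
  · refine (ae_restrict_iff' measurableSet_Ioi).2 (ae_of_all _ fun t ht y hy => ?_)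
    have ht : 0 < t := ht
    have hy : z / 2 < y := hy
    rw [norm_neg]
    refine (norm_laplace_integrand_le hq ht).trans ?_
    gcongr
  · refine (ae_restrict_iff' measurableSet_Ioi).2 (ae_of_all _ fun t ht y _ => ?_)
    have ht : 0 < t := ht
    have h1 : HasDerivAt (fun y : ℝ => Real.exp (-(y * t))) (Real.exp (-(y * t)) * -t) y := by
      simpa using (((hasDerivAt_id y).mul_const t).neg).exp
    refine ((h1.mul_const (t ^ p)).mul_const ((1 + t) ^ q)).congr_deriv ?_
    rw [Real.rpow_add_one ht.ne']
    ring

/-- Kummer's equation for the Laplace integral, from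
`∫ (d/dt) (exp(-zt) t ^ a (1 + t) ^ (q + 1)) = 0`. -/
theorem laplaceInt_ode {a q z : ℝ} (ha : 0 < a) (hq : q ≤ 0) (hz : 0 < z) :
    z * laplaceInt (a + 1) q z - (a + q + 1 - z) * laplaceInt a q z -
      a * laplaceInt (a - 1) q z = 0 := by
  have i1 := integrableOn_laplace_integrand (p := a - 1) (by linarith) hq hz
  have i2 := integrableOn_laplace_integrand (p := a) (by linarith) hq hz
  have i3 := integrableOn_laplace_integrand (p := a + 1) (by linarith) hq hz
  set G : ℝ → ℝ := fun t => Real.exp (-(z * t)) * t ^ a * (1 + t) ^ (q + 1) with hG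
  have hGeq : ∀ t ∈ Set.Ioi (0 : ℝ), Real.exp (-(z * t)) * t ^ a * (1 + t) ^ q +
      Real.exp (-(z * t)) * t ^ (a + 1) * (1 + t) ^ q = G t := fun t ht => by
    have ht : 0 < t := ht
    rw [hG]
    simp only
    rw [Real.rpow_add_one ht.ne', Real.rpow_add_one (by positivity)]
    ring
  have iG : IntegrableOn G (Set.Ioi 0) := (i2.add i3).congr_fun hGeq measurableSet_Ioi
  have hder : ∀ t ∈ Set.Ioi (0 : ℝ), HasDerivAt G
      (a * (Real.exp (-(z * t)) * t ^ (a - 1) * (1 + t) ^ q) +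
        (a + q + 1 - z) * (Real.exp (-(z * t)) * t ^ a * (1 + t) ^ q) -
        z * (Real.exp (-(z * t)) * t ^ (a + 1) * (1 + t) ^ q)) t := fun t ht => by
    have ht : 0 < t := ht
    have h1 : HasDerivAt (fun t : ℝ => Real.exp (-(z * t))) (Real.exp (-(z * t)) * -z) t := by
      simpa using (((hasDerivAt_id t).const_mul z).neg).exp
    have h2 : HasDerivAt (fun t : ℝ => t ^ a) (a * t ^ (a - 1)) t :=
      Real.hasDerivAt_rpow_const (Or.inl ht.ne')
    have h3 : HasDerivAt (fun t : ℝ => (1 + t) ^ (q + 1)) ((q + 1) * (1 + t) ^ q) t := by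
      refine ((Real.hasDerivAt_rpow_const (x := 1 + t) (p := q + 1)
        (Or.inl (by positivity))).comp t ((hasDerivAt_id t).const_add 1)).congr_deriv ?_
      simp
    refine ((h1.mul h2).mul h3).congr_deriv ?_
    simp only [Pi.mul_apply]
    have e : t ^ a = t ^ (a - 1) * t := by
      rw [← Real.rpow_add_one ht.ne']
      ring_nf
    rw [Real.rpow_add_one ht.ne', Real.rpow_add_one (by positivity), e]
    ring
  have iG' := ((i1.const_mul a).add (i2.const_mul (a + q + 1 - z))).sub (i3.const_mul z)
  have hc : ContinuousWithinAt G (Set.Ici 0) 0 := by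
    refine ContinuousAt.continuousWithinAt ?_
    refine ((by fun_prop : Continuous fun t : ℝ => Real.exp (-(z * t))).continuousAt.mul
      (Real.continuousAt_rpow_const _ _ (Or.inr ha.le))).mul ?_
    exact (continuousAt_const.add continuousAt_id).rpow_const (Or.inl (by simp))
  have hlim := tendsto_zero_of_hasDerivAt_of_integrableOn_Ioi hder iG' iG
  have key := integral_Ioi_of_hasDerivAt_of_tendsto hc hder iG' hlim
  have h0 : G 0 = 0 := by simp [hG, Real.zero_rpow ha.ne']
  have hsum := integral_sub ((i1.const_mul a).add (i2.const_mul (a + q + 1 - z)))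
    (i3.const_mul z)
  rw [integral_add' (i1.const_mul a) (i2.const_mul _), integral_const_mul, integral_const_mul,
    integral_const_mul] at hsum
  replace key := hsum.symm.trans key
  rw [h0] at key
  unfold laplaceInt
  linear_combination -key

theorem laplaceInt_nonneg (p q z : ℝ) : 0 ≤ laplaceInt p q z :=
  setIntegral_nonneg measurableSet_Ioi fun t ht => by
    have ht : 0 < t := ht
    positivity

theorem laplaceInt_le {a q z : ℝ} (ha : 0 < a) (hq : q ≤ 0) (hz : 0 < z) :
    laplaceInt (a - 1) q z ≤ z ^ (-a) * Real.Gamma a := by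
  have h : ∫ t in Set.Ioi (0 : ℝ), Real.exp (-(z * t)) * t ^ (a - 1) = z ^ (-a) * Real.Gamma a := by
    rw [Real.rpow_neg hz.le, ← Real.inv_rpow hz.le, ← one_div,
      ← Real.integral_rpow_mul_exp_neg_mul_Ioi ha hz]
    simp_rw [mul_comm]
  rw [← h]
  refine setIntegral_mono_on (integrableOn_laplace_integrand (by linarith) hq hz)
    (integrableOn_exp_mul_rpow (by linarith) hz) measurableSet_Ioi fun t ht => ?_
  exact (le_abs_self _).trans (norm_laplace_integrand_le hq ht)

theorem tendsto_laplaceInt_zero {a c : ℝ} (ha : 0 < a) (hc : 0 < c) :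
    Tendsto (laplaceInt (a - 1) (-a - c)) (𝓝[>] 0)
      (𝓝 (Real.Gamma a * Real.Gamma c / Real.Gamma (a + c))) := by
  rw [← integral_Ioi_rpow_mul_one_add_rpow ha hc]
  have hpos : 0 < Real.Gamma a * Real.Gamma c / Real.Gamma (a + c) :=
    div_pos (mul_pos (Real.Gamma_pos_of_pos ha) (Real.Gamma_pos_of_pos hc))
      (Real.Gamma_pos_of_pos (by linarith))
  refine tendsto_integral_filter_of_dominated_convergence
    (fun t : ℝ => t ^ (a - 1) * (1 + t) ^ (-a - c))
    (Eventually.of_forall fun z => measurable_laplace_integrand _ _ z) ?_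
    (Integrable.of_integral_ne_zero
      (by rw [integral_Ioi_rpow_mul_one_add_rpow ha hc]; exact hpos.ne')) ?_
  · filter_upwards [self_mem_nhdsWithin] with z hz
    have hz : 0 < z := hz
    refine (ae_restrict_iff' measurableSet_Ioi).2 (ae_of_all _ fun t ht => ?_)
    have ht : 0 < t := ht
    rw [Real.norm_of_nonneg (by positivity), mul_assoc]
    refine mul_le_of_le_one_left (by positivity) (Real.exp_le_one_iff.2 ?_)
    have := mul_pos hz ht
    linarith
  · refine (ae_restrict_iff' measurableSet_Ioi).2 (ae_of_all _ fun t ht => ?_)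
    have h : Continuous fun z : ℝ => Real.exp (-(z * t)) * t ^ (a - 1) * (1 + t) ^ (-a - c) := by
      fun_prop
    simpa using (h.tendsto 0).mono_left nhdsWithin_le_nhds

theorem rpow_mul_laplaceInt {p q z : ℝ} (hz : 0 < z) :
    z ^ (p + q + 1) * laplaceInt p q z =
      ∫ y in Set.Ioi (0 : ℝ), Real.exp (-y) * y ^ p * (z + y) ^ q := by
  have h := integral_comp_mul_left_Ioi
    (fun y : ℝ => Real.exp (-y) * y ^ p * (z + y) ^ q) 0 hz
  rw [mul_zero, smul_eq_mul] at h
  have h2 : ∫ y in Set.Ioi (0 : ℝ), Real.exp (-y) * y ^ p * (z + y) ^ q = z *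
      ∫ t in Set.Ioi (0 : ℝ), Real.exp (-(z * t)) * (z * t) ^ p * (z + z * t) ^ q := by
    rw [h]
    field_simp
  rw [h2, laplaceInt, ← integral_const_mul, ← integral_const_mul]
  refine setIntegral_congr_fun measurableSet_Ioi fun t ht => ?_
  have ht : 0 < t := ht
  rw [show z + z * t = z * (1 + t) by ring, Real.mul_rpow hz.le ht.le,
    Real.mul_rpow hz.le (by positivity), Real.rpow_add_one hz.ne', Real.rpow_add hz]
  ring

/-- Behaviour of the integral at the origin when it diverges there. It is applied to the derivative of
`Γ(a) U(a, 2 / 3, z)`, which has a singularity `z ^ (-2 / 3)`. -/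
theorem tendsto_rpow_mul_laplaceInt {p q : ℝ} (hq : q ≤ 0) (hpq : -1 < p + q) :
    Tendsto (fun z => z ^ (p + q + 1) * laplaceInt p q z) (𝓝[>] 0)
      (𝓝 (Real.Gamma (p + q + 1))) := by
  have hG : Real.Gamma (p + q + 1) = ∫ y in Set.Ioi (0 : ℝ), Real.exp (-y) * y ^ (p + q) := by
    rw [Real.Gamma_eq_integral (by linarith)]
    simp
  have hI : IntegrableOn (fun y : ℝ => Real.exp (-y) * y ^ (p + q)) (Set.Ioi 0) := by
    simpa using integrableOn_exp_mul_rpow hpq one_pos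
  have key : Tendsto (fun z : ℝ => ∫ y in Set.Ioi (0 : ℝ), Real.exp (-y) * y ^ p * (z + y) ^ q)
      (𝓝[>] 0) (𝓝 (∫ y in Set.Ioi (0 : ℝ), Real.exp (-y) * y ^ (p + q))) := by
    refine tendsto_integral_filter_of_dominated_convergence
      (fun y : ℝ => Real.exp (-y) * y ^ (p + q)) ?_ ?_ hI ?_
    · filter_upwards [self_mem_nhdsWithin] with z hz
      have hz : 0 < z := hz
      refine ContinuousOn.aestronglyMeasurable ?_ measurableSet_Ioi
      refine ((by fun_prop : Continuous fun y : ℝ => Real.exp (-y)).continuousOn.mul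
        (continuousOn_id.rpow_const fun t ht => Or.inl (ne_of_gt ht))).mul
        ((continuousOn_const.add continuousOn_id).rpow_const fun t ht => Or.inl ?_)
      have ht : 0 < t := ht
      exact (by positivity : z + t ≠ 0)
    · filter_upwards [self_mem_nhdsWithin] with z hz
      have hz : 0 < z := hz
      refine (ae_restrict_iff' measurableSet_Ioi).2 (ae_of_all _ fun y hy => ?_)
      have hy : 0 < y := hy
      rw [Real.norm_of_nonneg (by positivity), Real.rpow_add hy, mul_assoc]
      have : (z + y) ^ q ≤ y ^ q := Real.rpow_le_rpow_of_nonpos hy (by linarith) hq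
      gcongr
    · refine (ae_restrict_iff' measurableSet_Ioi).2 (ae_of_all _ fun y hy => ?_)
      have hy : 0 < y := hy
      have h : ContinuousAt (fun z : ℝ => Real.exp (-y) * y ^ p * (z + y) ^ q) 0 :=
        continuousAt_const.mul
          ((continuousAt_id.add continuousAt_const).rpow_const (Or.inl (by simpa using hy.ne')))
      have h2 := h.tendsto.mono_left (nhdsWithin_le_nhds (s := Set.Ioi 0))
      simp only [zero_add] at h2
      rwa [mul_assoc, ← Real.rpow_add hy] at h2
  rw [hG]
  refine key.congr' ?_
  filter_upwards [self_mem_nhdsWithin] with z hz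
  exact (rpow_mul_laplaceInt hz).symm

theorem neg_cube_div_pos {t : ℝ} (ht : t < 0) : 0 < -t ^ 3 / 9 := by
  have : 0 < (-t) ^ 3 := by
    have : 0 < -t := by linarith
    positivity
  nlinarith

/-- The integral representation of Tricomi's function for `a > 0`. -/
theorem laplaceInt_eq_profU {a : ℝ} (ha : 0 < a) {t : ℝ} (ht : t < 0) :
    laplaceInt (a - 1) (-a - 1 / 3) (-t ^ 3 / 9) = Real.Gamma a * profU a t := by
  have hq : -a - 1 / 3 ≤ 0 := by linarith
  have hd0 : ∀ t ∈ Set.Iio (0 : ℝ), HasDerivAt (laplaceInt (a - 1) (-a - 1 / 3))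
      (-laplaceInt a (-a - 1 / 3) (-t ^ 3 / 9)) (-t ^ 3 / 9) := fun t ht => by
    have h := hasDerivAt_laplaceInt (p := a - 1) (by linarith) hq (neg_cube_div_pos ht)
    rwa [sub_add_cancel] at h
  have hd1 : ∀ t ∈ Set.Iio (0 : ℝ), HasDerivAt (fun z => -laplaceInt a (-a - 1 / 3) z)
      (laplaceInt (a + 1) (-a - 1 / 3) (-t ^ 3 / 9)) (-t ^ 3 / 9) := fun t ht => by
    exact (hasDerivAt_laplaceInt (p := a) (by linarith) hq (neg_cube_div_pos ht)).neg.congr_deriv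
      (neg_neg _)
  have hprof : IsProfileOn (Set.Iio 0) a
      (fun t => laplaceInt (a - 1) (-a - 1 / 3) (-t ^ 3 / 9)) := by
    refine .of_kummer isOpen_Iio (y₁ := fun z => -laplaceInt a (-a - 1 / 3) z)
      (y₂ := laplaceInt (a + 1) (-a - 1 / 3)) hd0 hd1 fun t ht => ?_
    linear_combination laplaceInt_ode ha hq (neg_cube_div_pos ht)
  obtain ⟨c, d, hcd⟩ := hprof.exists_eq isOpen_Iio (convex_Iio 0)
  have hz : Tendsto (fun t : ℝ => -t ^ 3 / 9) (𝓝[<] 0) (𝓝[>] 0) := by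
    refine tendsto_nhdsWithin_iff.2 ⟨?_, ?_⟩
    · have : Continuous fun t : ℝ => -t ^ 3 / 9 := by fun_prop
      simpa using (this.tendsto 0).mono_left (nhdsWithin_le_nhds (s := Set.Iio 0))
    · filter_upwards [self_mem_nhdsWithin] with t ht using neg_cube_div_pos ht
  -- the values at `0-` of the integral and of its derivative determine the two coefficients
  have hc : c = Real.Gamma a * (Real.Gamma (1 / 3) / Real.Gamma (a + 1 / 3)) := by
    have h1 : Tendsto (fun t => c * profE a t + d * profO a t) (𝓝[<] 0) (𝓝 c) := by
      have := ((isProfileOn_profE a).linear_comb isOpen_univ (isProfileOn_profO a) c d).continuous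
      simpa [profE_zero, profO_zero] using
        (this.tendsto 0).mono_left (nhdsWithin_le_nhds (s := Set.Iio 0))
    have h2 := (tendsto_laplaceInt_zero ha (c := 1 / 3) (by norm_num)).comp hz
    rw [mul_div_assoc] at h2
    refine tendsto_nhds_unique (h1.congr' ?_) h2
    filter_upwards [self_mem_nhdsWithin] with t ht using (hcd t ht).1.symm
  have hd : d = Real.Gamma a * -(Real.Gamma (-(1 / 3)) / Real.Gamma a / 9 ^ (1 / 3 : ℝ)) := by
    have h1 : Tendsto (fun t => c * deriv (profE a) t + d * deriv (profO a) t) (𝓝[<] 0)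
        (𝓝 d) := by
      have : Continuous fun t => c * deriv (profE a) t + d * deriv (profO a) t :=
        (continuous_const.mul (isProfileOn_profE a).continuous_deriv).add
          (continuous_const.mul (isProfileOn_profO a).continuous_deriv)
      simpa [deriv_profE_zero, deriv_profO_zero] using
        (this.tendsto 0).mono_left (nhdsWithin_le_nhds (s := Set.Iio 0))
    have h2 := ((tendsto_rpow_mul_laplaceInt (p := a) hq (by linarith)).comp hz).const_mul
      (3 / 9 ^ (1 / 3 : ℝ))
    have h3 : d = 3 / 9 ^ (1 / 3 : ℝ) * Real.Gamma (a + (-a - 1 / 3) + 1) := by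
      refine tendsto_nhds_unique (h1.congr' ?_) h2
      filter_upwards [self_mem_nhdsWithin] with t ht
      have ht' : t ≤ 0 := le_of_lt ht
      have e := (hd0 t ht).comp t (hasDerivAt_neg_cube_div t)
      have e2 : deriv (fun t => laplaceInt (a - 1) (-a - 1 / 3) (-t ^ 3 / 9)) t =
        -laplaceInt a (-a - 1 / 3) (-t ^ 3 / 9) * -(t ^ 2 / 3) := e.deriv
      have e3 : (-t ^ 3 / 9) ^ (2 / 3 : ℝ) = (-t / 9 ^ (1 / 3 : ℝ)) ^ 2 := by
        rw [← rpow_neg_cube_div ht', ← Real.rpow_natCast _ 2, ← Real.rpow_mul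
          (neg_cube_div_pos ht).le]
        norm_num
      have e4 : ((9 : ℝ) ^ (1 / 3 : ℝ)) ^ 3 = 9 := by
        rw [← Real.rpow_natCast, ← Real.rpow_mul (by norm_num)]
        norm_num
      have e5 : (0 : ℝ) < 9 ^ (1 / 3 : ℝ) := by positivity
      rw [← (hcd t ht).2, e2]
      simp only [Function.comp]
      rw [show a + (-a - 1 / 3) + 1 = (2 / 3 : ℝ) by ring, e3]
      generalize (9 : ℝ) ^ (1 / 3 : ℝ) = r at *
      generalize laplaceInt a (-a - 1 / 3) (-t ^ 3 / 9) = K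
      field_simp
      linear_combination K * t ^ 2 * e4
    have h4 : Real.Gamma (-(1 / 3) + 1) = -(1 / 3) * Real.Gamma (-(1 / 3)) :=
      Real.Gamma_add_one (by norm_num)
    have h5 := (Real.Gamma_pos_of_pos ha).ne'
    rw [h3, show a + (-a - 1 / 3) + 1 = -(1 / 3 : ℝ) + 1 by ring, h4]
    field_simp
  rw [(hcd t ht).1, hc, hd, profU]
  ring

/-! ### Growth of Tricomi's profile -/

theorem abs_rpow_le_mul_one_add {t : ℝ} (ht : 1 ≤ |t|) (p : ℝ) :
    |t| ^ p ≤ 2 ^ |p| * (1 + |t|) ^ p := by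
  have h0 : 0 < |t| := by linarith
  rcases le_total 0 p with hp | hp
  · have h1 : |t| ^ p ≤ (1 + |t|) ^ p := by gcongr; linarith
    have h2 : (1 : ℝ) ≤ 2 ^ |p| := Real.one_le_rpow (by norm_num) (abs_nonneg p)
    have h3 : 0 ≤ (1 + |t|) ^ p := by positivity
    nlinarith
  · have h1 : |t| ^ p ≤ ((1 + |t|) / 2) ^ p :=
      Real.rpow_le_rpow_of_nonpos (by positivity) (by linarith) hp
    rw [Real.div_rpow (by positivity) (by norm_num), div_eq_mul_inv,
      ← Real.rpow_neg (by norm_num), mul_comm] at h1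
    rwa [abs_of_nonpos hp]

/-- A power bound at distance at least `1` from the origin extends to the whole set. -/
theorem Continuous.exists_bound_one_add {f : ℝ → ℝ} (hf : Continuous f) {s : Set ℝ} {p C : ℝ}
    (h : ∀ t ∈ s, 1 ≤ |t| → |f t| ≤ C * (1 + |t|) ^ p) :
    ∃ C', 0 ≤ C' ∧ ∀ t ∈ s, |f t| ≤ C' * (1 + |t|) ^ p := by
  obtain ⟨B, hB⟩ := (isCompact_Icc (a := (-1 : ℝ)) (b := 1)).exists_bound_of_continuousOn
    hf.continuousOn
  refine ⟨|B| * 2 ^ |p| + |C|, by positivity, fun t ht => ?_⟩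
  have hr : 0 < (1 + |t|) ^ p := by positivity
  have h2 : 0 < (2 : ℝ) ^ |p| := by positivity
  rcases le_total 1 |t| with h1 | h1
  · refine (h t ht h1).trans ?_
    gcongr
    have := le_abs_self C
    have : 0 ≤ |B| * 2 ^ |p| := by positivity
    linarith
  · have h3 : |f t| ≤ |B| := (hB t (abs_le.1 h1)).trans (le_abs_self B)
    have h4 : 1 ≤ 2 ^ |p| * (1 + |t|) ^ p := by
      rcases le_total 0 p with hp | hp
      · have e1 : (1 : ℝ) ≤ 2 ^ |p| := Real.one_le_rpow (by norm_num) (abs_nonneg p)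
        have e2 : 1 ≤ (1 + |t|) ^ p := Real.one_le_rpow (by linarith [abs_nonneg t]) hp
        nlinarith
      · rw [abs_of_nonpos hp, Real.rpow_neg (by norm_num), ← div_eq_inv_mul,
          le_div_iff₀ (by positivity), one_mul]
        exact Real.rpow_le_rpow_of_nonpos (by positivity) (by linarith) hp
    have h5 : 0 ≤ |C| * (1 + |t|) ^ p := by positivity
    nlinarith [mul_le_mul_of_nonneg_left h4 (abs_nonneg B)]

theorem exists_abs_profU_le_of_pos {a : ℝ} (ha : 0 < a) :
    ∃ C, 0 ≤ C ∧ ∀ t ∈ Set.Iic (0 : ℝ), |profU a t| ≤ C * (1 + |t|) ^ (-(3 * a)) := by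
  refine (isProfileOn_profU a).continuous.exists_bound_one_add
    (C := 9 ^ a * 2 ^ |-(3 * a)|) fun t ht h1 => ?_
  have ht0 : t < 0 := by
    rcases eq_or_lt_of_le (show t ≤ 0 from ht) with h | h
    · rw [h] at h1
      norm_num at h1
    · exact h
  have hG := Real.Gamma_pos_of_pos ha
  have h2 := laplaceInt_eq_profU ha ht0
  have h3 := laplaceInt_le (q := -a - 1 / 3) ha (by linarith) (neg_cube_div_pos ht0)
  have h4 := laplaceInt_nonneg (a - 1) (-a - 1 / 3) (-t ^ 3 / 9)
  rw [h2] at h3 h4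
  have h5 : 0 ≤ profU a t := nonneg_of_mul_nonneg_right h4 hG
  have h6 : profU a t ≤ (-t ^ 3 / 9) ^ (-a) :=
    le_of_mul_le_mul_left (h3.trans_eq (mul_comm _ _)) hG
  have h7 : (-t ^ 3 / 9) ^ (-a) = 9 ^ a * |t| ^ (-(3 * a)) := by
    rw [abs_of_neg ht0, show -t ^ 3 = (-t) ^ 3 by ring,
      Real.div_rpow (by have : 0 ≤ -t := by linarith
                        positivity) (by norm_num), ← Real.rpow_natCast (-t) 3,
      ← Real.rpow_mul (by linarith), Real.rpow_neg (by norm_num) a, div_inv_eq_mul, mul_comm]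
    congr 2
    push_cast
    ring
  rw [abs_of_nonneg h5]
  refine h6.trans ?_
  rw [h7, mul_assoc]
  gcongr
  exact abs_rpow_le_mul_one_add h1 _

/-- Tricomi's function `U(a, 2 / 3, z)` is `O(z ^ (-a))`; for `a ≤ 0` this follows from the
three-term relation. -/
theorem exists_abs_profU_le (a : ℝ) :
    ∃ C, 0 ≤ C ∧ ∀ t ∈ Set.Iic (0 : ℝ), |profU a t| ≤ C * (1 + |t|) ^ (-(3 * a)) := by
  suffices H : ∀ n : ℕ, ∀ a : ℝ, -(n : ℝ) < a →
      ∃ C, 0 ≤ C ∧ ∀ t ∈ Set.Iic (0 : ℝ), |profU a t| ≤ C * (1 + |t|) ^ (-(3 * a)) by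
    obtain ⟨n, hn⟩ := exists_nat_gt (-a)
    exact H n a (by linarith)
  intro n
  induction n with
  | zero => intro a ha; exact exists_abs_profU_le_of_pos (by simpa using ha)
  | succ n ih =>
    intro a ha
    push_cast at ha
    obtain ⟨C₁, hC₁, h₁⟩ := ih (a + 1) (by linarith)
    obtain ⟨C₂, hC₂, h₂⟩ := ih (a + 2) (by linarith)
    refine ⟨(|2 * (a + 1) - 2 / 3| + 1) * C₁ + |(a + 1) * (a + 4 / 3)| * C₂, by positivity,
      fun t ht => ?_⟩
    have k₁ := h₁ t ht
    have k₂ := h₂ t ht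
    set r := 1 + |t| with hr
    have hr1 : 1 ≤ r := by linarith [abs_nonneg t]
    have hr0 : 0 < r := by linarith
    set X := r ^ (-(3 * (a + 1))) with hX
    have hXpos : 0 < X := by positivity
    have e0 : r ^ (-(3 * a)) = X * r ^ 3 := by
      rw [hX, ← Real.rpow_natCast r 3, ← Real.rpow_add hr0]
      congr 1
      push_cast
      ring
    have e2 : r ^ (-(3 * (a + 2))) ≤ X := Real.rpow_le_rpow_of_exponent_le hr1 (by linarith)
    have hr3 : 1 ≤ r ^ 3 := one_le_pow₀ hr1
    have ht3 : |-t ^ 3 / 9| ≤ r ^ 3 := by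
      rw [abs_div, abs_neg, abs_pow]
      have : |t| ^ 3 ≤ r ^ 3 := by gcongr; linarith
      have h9 : |(9 : ℝ)| = 9 := by norm_num
      rw [h9]
      have : 0 ≤ |t| ^ 3 := by positivity
      linarith
    rw [profU_contiguous, e0]
    have s1 : |(2 * (a + 1) - 2 / 3 + -t ^ 3 / 9) * profU (a + 1) t| ≤
        (|2 * (a + 1) - 2 / 3| + 1) * r ^ 3 * (C₁ * X) := by
      rw [abs_mul]
      have : |2 * (a + 1) - 2 / 3 + -t ^ 3 / 9| ≤ (|2 * (a + 1) - 2 / 3| + 1) * r ^ 3 := by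
        refine (abs_add_le _ _).trans ?_
        nlinarith [abs_nonneg (2 * (a + 1) - 2 / 3)]
      gcongr
    have s2 : |(a + 1) * (a + 4 / 3) * profU (a + 2) t| ≤
        |(a + 1) * (a + 4 / 3)| * (C₂ * (X * r ^ 3)) := by
      rw [abs_mul]
      have : C₂ * r ^ (-(3 * (a + 2))) ≤ C₂ * (X * r ^ 3) := by
        gcongr
        exact e2.trans (le_mul_of_one_le_right hXpos.le hr3)
      gcongr
      exact k₂.trans this
    refine (abs_sub _ _).trans ((add_le_add s1 s2).trans_eq ?_)
    ring

/-- A bound for `U(a)` and for `U(a + 1)` gives one for the derivative of `U(a)`. -/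
theorem exists_abs_deriv_profU_le {a p C₁ C₂ : ℝ} {s : Set ℝ}
    (h₁ : ∀ t ∈ s, |profU a t| ≤ C₁ * (1 + |t|) ^ p)
    (h₂ : ∀ t ∈ s, |profU (a + 1) t| ≤ C₂ * (1 + |t|) ^ p) :
    ∃ C, 0 ≤ C ∧ ∀ t ∈ s, |deriv (profU a) t| ≤ C * (1 + |t|) ^ (p - 1) := by
  refine (isProfileOn_profU a).continuous_deriv.exists_bound_one_add
    (C := 6 * (|a| * C₁ + |a * (a + 1 / 3)| * C₂)) fun t ht h1 => ?_
  have hr0 : 0 < 1 + |t| := by positivity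
  have ht0 : 0 < |t| := by linarith
  have e := congrArg abs (mul_deriv_profU a t)
  rw [abs_mul] at e
  have e2 : |3 * (-a * profU a t + a * (a + 1 / 3) * profU (a + 1) t)| ≤
      3 * (|a| * C₁ + |a * (a + 1 / 3)| * C₂) * (1 + |t|) ^ p := by
    rw [abs_mul, abs_of_pos (by norm_num : (0 : ℝ) < 3), mul_assoc 3]
    refine mul_le_mul_of_nonneg_left ?_ (by norm_num)
    refine (abs_add_le _ _).trans ?_
    rw [abs_mul, abs_mul (a * (a + 1 / 3)), abs_neg, add_mul, mul_assoc, mul_assoc]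
    gcongr
    · exact h₁ t ht
    · exact h₂ t ht
  rw [← e] at e2
  rw [Real.rpow_sub_one hr0.ne', ← mul_div_assoc, le_div_iff₀ hr0]
  calc |deriv (profU a) t| * (1 + |t|) ≤ 2 * (|t| * |deriv (profU a) t|) := by
        nlinarith [abs_nonneg (deriv (profU a) t)]
    _ ≤ _ := by linarith

theorem exists_abs_deriv_profU_le_Iic (a : ℝ) :
    ∃ C, 0 ≤ C ∧ ∀ t ∈ Set.Iic (0 : ℝ),
      |deriv (profU a) t| ≤ C * (1 + |t|) ^ (-(3 * a) - 1) := by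
  obtain ⟨C₁, _, h₁⟩ := exists_abs_profU_le a
  obtain ⟨C₂, hC₂, h₂⟩ := exists_abs_profU_le (a + 1)
  refine exists_abs_deriv_profU_le (C₂ := C₂) h₁ fun t ht => (h₂ t ht).trans ?_
  gcongr
  · linarith [abs_nonneg t]
  · linarith

/-- The derivative of `t ^ (3 * a) * U(a)` involves `U(a + 1)` only, so that control of `U(a + 1)` at
`+∞` yields control of `U(a)`. -/
theorem hasDerivAt_rpow_mul_profU (a : ℝ) {t : ℝ} (ht : 0 < t) :
    HasDerivAt (fun t => profU a t * t ^ (3 * a))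
      (3 * (a * (a + 1 / 3)) * (profU (a + 1) t * t ^ (3 * a - 1))) t := by
  refine (((isProfileOn_profU a).1 t trivial).mul
    (Real.hasDerivAt_rpow_const (p := 3 * a) (Or.inl ht.ne'))).congr_deriv ?_
  have h := mul_deriv_profU a t
  have e : t ^ (3 * a) = t ^ (3 * a - 1) * t := by
    rw [← Real.rpow_add_one ht.ne', sub_add_cancel]
  rw [e]
  linear_combination t ^ (3 * a - 1) * h

theorem exists_tendsto_profU {a C : ℝ}
    (h : ∀ t ∈ Set.Ici (0 : ℝ), |profU (a + 1) t| ≤ C * (1 + |t|) ^ (-(3 * a) - 1)) :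
    ∃ L, Tendsto (fun t => profU a t * t ^ (3 * a)) atTop (𝓝 L) := by
  refine ⟨_, tendsto_limUnder_of_hasDerivAt_of_integrableOn_Ioi (a := 1)
    (fun t ht => hasDerivAt_rpow_mul_profU a (zero_lt_one.trans ht)) ?_⟩
  -- by `h` the derivative of `t ^ (3 * a) * U(a)` is `O(t ^ (-2))`
  have hint := (integrableOn_Ioi_rpow_of_lt (by norm_num : (-2 : ℝ) < -1) one_pos).const_mul
    (|3 * (a * (a + 1 / 3))| * (|C| * 2 ^ |-(3 * a) - 1|))
  refine hint.mono' ?_ ((ae_restrict_iff' measurableSet_Ioi).2 (ae_of_all _ fun t ht => ?_))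
  · refine ContinuousOn.aestronglyMeasurable ?_ measurableSet_Ioi
    exact continuousOn_const.mul ((isProfileOn_profU (a + 1)).continuous.continuousOn.mul
      (continuousOn_id.rpow_const fun t ht => Or.inl (zero_lt_one.trans ht).ne'))
  · have ht1 : (1 : ℝ) < t := ht
    have ht0 : 0 < t := by linarith
    have h1 := h t ht0.le
    rw [abs_of_pos ht0] at h1
    have h2 : (1 + t) ^ (-(3 * a) - 1) ≤ 2 ^ |-(3 * a) - 1| * t ^ (-(3 * a) - 1) := by
      have e1 : (1 + t) ≤ 2 * t := by linarith
      rcases le_total 0 (-(3 * a) - 1) with hp | hp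
      · rw [abs_of_nonneg hp, ← Real.mul_rpow (by norm_num) ht0.le]
        gcongr
      · have e2 : (1 + t) ^ (-(3 * a) - 1) ≤ t ^ (-(3 * a) - 1) :=
          Real.rpow_le_rpow_of_nonpos ht0 (by linarith) hp
        exact e2.trans (le_mul_of_one_le_left (by positivity)
          (Real.one_le_rpow (by norm_num) (abs_nonneg _)))
    have h3 : t ^ (-2 : ℝ) = t ^ (-(3 * a) - 1) * t ^ (3 * a - 1) := by
      rw [← Real.rpow_add ht0]
      congr 1
      ring
    rw [Real.norm_eq_abs, abs_mul _ (profU (a + 1) t * _), abs_mul (profU (a + 1) t), h3,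
      mul_assoc, abs_of_pos (by positivity : 0 < t ^ (3 * a - 1))]
    refine mul_le_mul_of_nonneg_left ?_ (abs_nonneg _)
    rw [← mul_assoc]
    refine mul_le_mul_of_nonneg_right ?_ (by positivity)
    rw [mul_assoc]
    refine h1.trans ?_
    have := le_abs_self C
    gcongr

theorem exists_abs_le_of_tendsto {f : ℝ → ℝ} (hf : Continuous f) {p L : ℝ}
    (h : Tendsto (fun t => f t * t ^ (-p)) atTop (𝓝 L)) :
    ∃ C, 0 ≤ C ∧ ∀ t ∈ Set.Ici (0 : ℝ), |f t| ≤ C * (1 + |t|) ^ p := by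
  obtain ⟨R, hR⟩ := eventually_atTop.1
    (h.abs.eventually (eventually_lt_nhds (show |L| < |L| + 1 by linarith)))
  obtain ⟨B, hB⟩ := (isCompact_Icc (a := (0 : ℝ)) (b := max R 1)).exists_bound_of_continuousOn
    (f := fun t => f t * (1 + |t|) ^ (-p))
    (hf.mul ((by fun_prop : Continuous fun t : ℝ => 1 + |t|).rpow_const
      fun t => Or.inl (by positivity))).continuousOn
  refine ⟨|B| + (|L| + 1) * 2 ^ |p|, by positivity, fun t ht => ?_⟩
  have ht0 : 0 ≤ t := ht
  have hr : 0 < (1 + |t|) ^ p := by positivity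
  rcases le_total t (max R 1) with h1 | h1
  · have h2 := hB t ⟨ht0, h1⟩
    rw [Real.norm_eq_abs, abs_mul, Real.rpow_neg (by positivity), abs_of_pos (inv_pos.2 hr),
      ← div_eq_mul_inv, div_le_iff₀ hr] at h2
    refine h2.trans ?_
    gcongr
    have := le_abs_self B
    have : 0 ≤ (|L| + 1) * 2 ^ |p| := by positivity
    linarith
  · have hR1 := hR t ((le_max_left _ _).trans h1)
    have ht1 : 1 ≤ t := (le_max_right _ _).trans h1
    have htp : 0 < t := by linarith
    have htp' : 0 < t ^ p := by positivity
    rw [abs_mul, Real.rpow_neg ht0, abs_of_pos (inv_pos.2 htp'), ← div_eq_mul_inv,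
      div_lt_iff₀ htp'] at hR1
    have h3 := abs_rpow_le_mul_one_add (t := t) (by rwa [abs_of_pos htp]) p
    rw [abs_of_pos htp] at *
    have h4 : (|L| + 1) * t ^ p ≤ (|L| + 1) * (2 ^ |p| * (1 + t) ^ p) := by gcongr
    have h5 : 0 ≤ |B| * (1 + t) ^ p := by positivity
    linarith

/-- Profiles with parameter `1 / 3` grow at most linearly on `t ≥ 0`. This parameter is fixed under
the reflection `a ↦ 2 / 3 - a`, so that up to sign `profE` and `profO` at `t` are their values at
`-t` times `exp (-t ^ 3 / 9)`, and the series bounds these by `exp (t ^ 3 / 9)` and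
`t * exp (t ^ 3 / 9)`. -/
theorem exists_abs_profU_one_third_le :
    ∃ C, 0 ≤ C ∧ ∀ t ∈ Set.Ici (0 : ℝ), |profU (1 / 3) t| ≤ C * (1 + |t|) ^ (1 : ℝ) := by
  -- `profE` is invariant under the reflection and `profO` changes its sign
  have hE : ∀ t : ℝ, 0 ≤ t → |profE (1 / 3) t| ≤ 1 := fun t ht => by
    have h := (isProfileOn_profE (1 / 3)).reflect
    rw [show (2 / 3 : ℝ) - 1 / 3 = 1 / 3 by norm_num] at h
    have h0 : deriv (fun t => Real.exp (-t ^ 3 / 9) * profE (1 / 3) (-t)) 0 = 0 := by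
      have := (hasDerivAt_neg_cube_div 0).exp.mul
        (((isProfileOn_profE (1 / 3)).1 (-0) trivial).comp 0 (hasDerivAt_neg 0))
      refine (this.congr_deriv ?_).deriv
      simp [deriv_profE_zero]
    have e := h.ext (isProfileOn_profE (1 / 3)) (by simp [profE_zero])
      (by rw [h0, deriv_profE_zero])
    have e1 := congrFun e t
    have h3 : 0 ≤ t ^ 3 := by positivity
    rw [← e1, abs_mul, abs_of_pos (Real.exp_pos _)]
    have h2 := abs_kummerM_le_exp (1 / 3) (b := 2 / 3) (by norm_num)
      (fun n => by rw [abs_of_nonneg (by positivity)]; linarith) (t ^ 3 / 9)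
    have h4 : profE (1 / 3) (-t) = kummerM (1 / 3) (2 / 3) (t ^ 3 / 9) := by
      rw [profE]
      congr 1
      ring
    rw [abs_of_nonneg (by positivity : 0 ≤ t ^ 3 / 9)] at h2
    rw [h4]
    refine (mul_le_mul_of_nonneg_left h2 (Real.exp_pos _).le).trans_eq ?_
    rw [← Real.exp_add, show -t ^ 3 / 9 + t ^ 3 / 9 = 0 by ring, Real.exp_zero]
  have hO : ∀ t : ℝ, 0 ≤ t → |profO (1 / 3) t| ≤ t := fun t ht => by
    have h := (isProfileOn_profO (1 / 3)).reflect
    rw [show (2 / 3 : ℝ) - 1 / 3 = 1 / 3 by norm_num] at h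
    have h0 : deriv (fun t => Real.exp (-t ^ 3 / 9) * profO (1 / 3) (-t)) 0 = -1 := by
      have := (hasDerivAt_neg_cube_div 0).exp.mul
        (((isProfileOn_profO (1 / 3)).1 (-0) trivial).comp 0 (hasDerivAt_neg 0))
      refine (this.congr_deriv ?_).deriv
      simp [deriv_profO_zero]
    have e := h.eq_univ t
    rw [h0] at e
    simp only [neg_zero, profO_zero, mul_zero, zero_mul, zero_add, neg_one_mul] at e
    have h3 : 0 ≤ t ^ 3 := by positivity
    rw [← abs_neg, ← e, abs_mul, abs_of_pos (Real.exp_pos _)]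
    have h2 := abs_kummerM_le_exp (1 / 3 + 1 / 3) (b := 4 / 3) (by norm_num)
      (fun n => by rw [abs_of_nonneg (by positivity)]; linarith) (t ^ 3 / 9)
    have h4 : profO (1 / 3) (-t) = -t * kummerM (1 / 3 + 1 / 3) (4 / 3) (t ^ 3 / 9) := by
      rw [profO]
      congr 2
      ring
    rw [abs_of_nonneg (by positivity : 0 ≤ t ^ 3 / 9)] at h2
    rw [h4, abs_mul, abs_neg, abs_of_nonneg ht]
    calc Real.exp (-t ^ 3 / 9) * (t * |kummerM (1 / 3 + 1 / 3) (4 / 3) (t ^ 3 / 9)|)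
        ≤ Real.exp (-t ^ 3 / 9) * (t * Real.exp (t ^ 3 / 9)) := by gcongr
      _ = t * Real.exp (-t ^ 3 / 9 + t ^ 3 / 9) := by rw [Real.exp_add]; ring
      _ = t := by rw [show -t ^ 3 / 9 + t ^ 3 / 9 = 0 by ring, Real.exp_zero, mul_one]
  refine ⟨|Real.Gamma (1 / 3) / Real.Gamma (1 / 3 + 1 / 3)| +
    |-(Real.Gamma (-(1 / 3)) / Real.Gamma (1 / 3) / 9 ^ (1 / 3 : ℝ))|, by positivity,
    fun t ht => ?_⟩
  have ht : 0 ≤ t := ht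
  rw [profU, Real.rpow_one, abs_of_nonneg ht]
  refine (abs_add_le _ _).trans ?_
  rw [abs_mul, abs_mul, add_mul]
  gcongr
  · exact (hE t ht).trans (by linarith)
  · exact (hO t ht).trans (by linarith)

/-- `U(-l - 2 / 3, 2 / 3, ·)` continues to a function of polynomial growth on the other half-line,
by descent from `U(1 / 3, 2 / 3, ·)`. -/
theorem exists_tendsto_profU_neg (l : ℕ) :
    (∃ C, 0 ≤ C ∧ ∀ t ∈ Set.Ici (0 : ℝ), |profU (-l - 2 / 3 + 1) t| ≤
      C * (1 + |t|) ^ (-(3 * (-l - 2 / 3 : ℝ)) - 1)) ∧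
    ∃ L, Tendsto (fun t => profU (-l - 2 / 3) t * t ^ (3 * (-l - 2 / 3 : ℝ))) atTop (𝓝 L) := by
  induction l with
  | zero =>
    have h : ∃ C, 0 ≤ C ∧ ∀ t ∈ Set.Ici (0 : ℝ), |profU (-(0 : ℕ) - 2 / 3 + 1) t| ≤
        C * (1 + |t|) ^ (-(3 * (-(0 : ℕ) - 2 / 3 : ℝ)) - 1) := by
      have := exists_abs_profU_one_third_le
      norm_num at this ⊢
      exact this
    obtain ⟨C, hC, h'⟩ := h
    exact ⟨⟨C, hC, h'⟩, exists_tendsto_profU h'⟩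
  | succ l ih =>
    obtain ⟨L, hL⟩ := ih.2
    obtain ⟨C, hC, h⟩ := exists_abs_le_of_tendsto (isProfileOn_profU (-l - 2 / 3)).continuous
      (p := -(3 * (-l - 2 / 3))) (by simpa only [neg_neg] using hL)
    have h' : ∀ t ∈ Set.Ici (0 : ℝ), |profU (-(l + 1 : ℕ) - 2 / 3 + 1) t| ≤
        C * (1 + |t|) ^ (-(3 * (-(l + 1 : ℕ) - 2 / 3 : ℝ)) - 1) := fun t ht => by
      rw [show (-(l + 1 : ℕ) - 2 / 3 + 1 : ℝ) = -l - 2 / 3 by push_cast; ring]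
      refine (h t ht).trans ?_
      gcongr
      · linarith [abs_nonneg t]
      · push_cast
        linarith
    exact ⟨⟨C, hC, h'⟩, exists_tendsto_profU h'⟩

theorem exp_neg_cube_mul_rpow_le (p : ℝ) :
    ∃ C, 0 ≤ C ∧ ∀ t : ℝ, 0 ≤ t → Real.exp (-t ^ 3 / 9) * (1 + |t|) ^ p ≤ C := by
  obtain ⟨n, hn⟩ := exists_nat_ge p
  refine ⟨n.factorial * Real.exp 3, by positivity, fun t ht => ?_⟩
  rw [abs_of_nonneg ht]
  -- on `t ≥ 0` the cubic exponent is at most `2 - t`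
  have h1 : -t ^ 3 / 9 ≤ 3 + -(1 + t) := by nlinarith [mul_nonneg (sq_nonneg (t - 2)) ht]
  have h2 : (1 + t) ^ p ≤ (1 + t) ^ n := by
    rw [← Real.rpow_natCast]
    exact Real.rpow_le_rpow_of_exponent_le (by linarith) hn
  have h3 := Real.pow_div_factorial_le_exp (1 + t) (by linarith) n
  rw [div_le_iff₀ (by positivity)] at h3
  calc Real.exp (-t ^ 3 / 9) * (1 + t) ^ p
      ≤ Real.exp (3 + -(1 + t)) * (Real.exp (1 + t) * n.factorial) := by
        gcongr
        exact h2.trans h3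
    _ = n.factorial * Real.exp 3 * Real.exp (-(1 + t) + (1 + t)) := by
        rw [Real.exp_add 3, Real.exp_add (-(1 + t))]; ring
    _ = _ := by rw [neg_add_cancel, Real.exp_zero, mul_one]

/-- A profile of the form `exp (-t ^ 3 / 9) * U(a, 2 / 3, t ^ 3 / 9)` decays faster than any
power on `t ≥ 0`, together with its derivative. -/
theorem exists_abs_exp_mul_profU_le (a q : ℝ) :
    ∃ C, 0 ≤ C ∧ ∀ t ∈ Set.Ici (0 : ℝ),
      |Real.exp (-t ^ 3 / 9) * profU a (-t)| ≤ C * (1 + |t|) ^ q ∧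
      |deriv (fun t => Real.exp (-t ^ 3 / 9) * profU a (-t)) t| ≤ C * (1 + |t|) ^ q := by
  obtain ⟨C₁, hC₁, h₁⟩ := exists_abs_profU_le a
  obtain ⟨C₂, hC₂, h₂⟩ := exists_abs_deriv_profU_le_Iic a
  obtain ⟨K₁, hK₁, k₁⟩ := exp_neg_cube_mul_rpow_le (-(3 * a) + 2 - q)
  have hpow : ∀ t : ℝ, 0 ≤ t → Real.exp (-t ^ 3 / 9) * (1 + |t|) ^ (-(3 * a) + 2) ≤
      K₁ * (1 + |t|) ^ q := fun t ht => by
    have := k₁ t ht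
    rw [Real.rpow_sub (by positivity), ← mul_div_assoc, div_le_iff₀ (by positivity)] at this
    exact this
  have hp1 : ∀ t : ℝ, (1 + |t|) ^ (-(3 * a)) ≤ (1 + |t|) ^ (-(3 * a) + 2) := fun t =>
    Real.rpow_le_rpow_of_exponent_le (by linarith [abs_nonneg t]) (by linarith)
  have hp2 : ∀ t : ℝ, (1 + |t|) ^ (-(3 * a) - 1) ≤ (1 + |t|) ^ (-(3 * a) + 2) := fun t =>
    Real.rpow_le_rpow_of_exponent_le (by linarith [abs_nonneg t]) (by linarith)
  have hp3 : ∀ t : ℝ, t ^ 2 / 3 * (1 + |t|) ^ (-(3 * a)) ≤ (1 + |t|) ^ (-(3 * a) + 2) :=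
      fun t => by
    rw [Real.rpow_add (by positivity), Real.rpow_two, mul_comm]
    gcongr
    nlinarith [sq_abs t, abs_nonneg t]
  refine ⟨(C₁ + C₂) * K₁, by positivity, fun t ht => ⟨?_, ?_⟩⟩
  · have ht0 : 0 ≤ t := ht
    have b1 := h₁ (-t) (show -t ≤ 0 by linarith)
    rw [abs_neg] at b1
    rw [abs_mul, abs_of_pos (Real.exp_pos _)]
    calc Real.exp (-t ^ 3 / 9) * |profU a (-t)|
        ≤ Real.exp (-t ^ 3 / 9) * ((C₁ + C₂) * (1 + |t|) ^ (-(3 * a) + 2)) := by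
          refine mul_le_mul_of_nonneg_left (b1.trans ?_) (Real.exp_pos _).le
          exact mul_le_mul (by linarith) (hp1 t) (by positivity) (by positivity)
      _ = (C₁ + C₂) * (Real.exp (-t ^ 3 / 9) * (1 + |t|) ^ (-(3 * a) + 2)) := by ring
      _ ≤ (C₁ + C₂) * (K₁ * (1 + |t|) ^ q) := by
          exact mul_le_mul_of_nonneg_left (hpow t ht0) (by positivity)
      _ = _ := by ring
  · have ht0 : 0 ≤ t := ht
    have b1 := h₁ (-t) (show -t ≤ 0 by linarith)
    have b2 := h₂ (-t) (show -t ≤ 0 by linarith)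
    rw [abs_neg] at b1 b2
    have hd : HasDerivAt (fun t => Real.exp (-t ^ 3 / 9) * profU a (-t))
        (Real.exp (-t ^ 3 / 9) * (-(t ^ 2 / 3) * profU a (-t) - deriv (profU a) (-t))) t := by
      refine ((hasDerivAt_neg_cube_div t).exp.mul
        (((isProfileOn_profU a).1 (-t) trivial).comp t (hasDerivAt_neg t))).congr_deriv ?_
      simp only [Function.comp]
      ring
    rw [hd.deriv, abs_mul, abs_of_pos (Real.exp_pos _)]
    have s1 : |-(t ^ 2 / 3) * profU a (-t) - deriv (profU a) (-t)| ≤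
        (C₁ + C₂) * (1 + |t|) ^ (-(3 * a) + 2) := by
      refine (abs_sub _ _).trans ?_
      rw [abs_mul, abs_neg, abs_of_nonneg (by positivity : 0 ≤ t ^ 2 / 3), add_mul]
      refine add_le_add ?_ ?_
      · calc t ^ 2 / 3 * |profU a (-t)| ≤ t ^ 2 / 3 * (C₁ * (1 + |t|) ^ (-(3 * a))) := by gcongr
          _ = C₁ * (t ^ 2 / 3 * (1 + |t|) ^ (-(3 * a))) := by ring
          _ ≤ _ := mul_le_mul_of_nonneg_left (hp3 t) hC₁
      · exact b2.trans (mul_le_mul_of_nonneg_left (hp2 t) hC₂)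
    calc Real.exp (-t ^ 3 / 9) * |-(t ^ 2 / 3) * profU a (-t) - deriv (profU a) (-t)|
        ≤ Real.exp (-t ^ 3 / 9) * ((C₁ + C₂) * (1 + |t|) ^ (-(3 * a) + 2)) := by gcongr
      _ = (C₁ + C₂) * (Real.exp (-t ^ 3 / 9) * (1 + |t|) ^ (-(3 * a) + 2)) := by ring
      _ ≤ (C₁ + C₂) * (K₁ * (1 + |t|) ^ q) := by
          exact mul_le_mul_of_nonneg_left (hpow t ht0) (by positivity)
      _ = _ := by ring

/-! ### Self-similar functions -/

/-- A profile on the whole line for which `x ^ lam * f (v / x ^ (1 / 3))` is of polynomial growth,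
together with its derivative in `v`, and has the boundary values `L * v ^ (3 * lam)` at
`x = 0 < v`. -/
structure IsAdmissibleProfile (lam L : ℝ) (f : ℝ → ℝ) : Prop where
  isProfile : IsProfileOn Set.univ (-lam) f
  bound : ∃ C, 0 ≤ C ∧ ∀ t, |f t| ≤ C * (1 + |t|) ^ (3 * lam)
  bound_deriv : ∃ C, 0 ≤ C ∧ ∀ t, |deriv f t| ≤ C * (1 + |t|) ^ (3 * lam - 1)
  tendsto : Tendsto (fun t => f t * t ^ (-(3 * lam))) atTop (𝓝 L)

theorem exists_bound_of_Iic_of_Ici {f : ℝ → ℝ} {p : ℝ}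
    (h₁ : ∃ C, 0 ≤ C ∧ ∀ t ∈ Set.Iic (0 : ℝ), |f t| ≤ C * (1 + |t|) ^ p)
    (h₂ : ∃ C, 0 ≤ C ∧ ∀ t ∈ Set.Ici (0 : ℝ), |f t| ≤ C * (1 + |t|) ^ p) :
    ∃ C, 0 ≤ C ∧ ∀ t, |f t| ≤ C * (1 + |t|) ^ p := by
  obtain ⟨C₁, hC₁, h₁⟩ := h₁
  obtain ⟨C₂, hC₂, h₂⟩ := h₂
  refine ⟨C₁ + C₂, by positivity, fun t => ?_⟩
  rcases le_total t 0 with ht | ht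
  · refine (h₁ t ht).trans ?_
    gcongr
    linarith
  · refine (h₂ t ht).trans ?_
    gcongr
    linarith

theorem IsAdmissibleProfile.const_mul {lam L : ℝ} {f : ℝ → ℝ} (hf : IsAdmissibleProfile lam L f)
    (c : ℝ) : IsAdmissibleProfile lam (c * L) (fun t => c * f t) := by
  obtain ⟨C₁, hC₁, h₁⟩ := hf.bound
  obtain ⟨C₂, hC₂, h₂⟩ := hf.bound_deriv
  refine ⟨hf.isProfile.const_mul isOpen_univ c, ⟨|c| * C₁, by positivity, fun t => ?_⟩,
    ⟨|c| * C₂, by positivity, fun t => ?_⟩, ?_⟩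
  · rw [abs_mul, mul_assoc]
    exact mul_le_mul_of_nonneg_left (h₁ t) (abs_nonneg c)
  · rw [((hf.isProfile.1 t trivial).const_mul c).deriv, abs_mul, mul_assoc]
    exact mul_le_mul_of_nonneg_left (h₂ t) (abs_nonneg c)
  · simpa only [mul_assoc] using hf.tendsto.const_mul c

theorem isAdmissibleProfile_profU_neg (l : ℕ) :
    ∃ L, IsAdmissibleProfile (l + 2 / 3) L (profU (-(l + 2 / 3))) := by
  obtain ⟨⟨C₀, _, h₀⟩, L, hL⟩ := exists_tendsto_profU_neg l
  rw [show (-l - 2 / 3 : ℝ) = -(l + 2 / 3) by ring] at h₀ hL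
  rw [show 3 * -(l + 2 / 3 : ℝ) = -(3 * (l + 2 / 3)) by ring] at h₀ hL
  have hp := isProfileOn_profU (-(l + 2 / 3))
  have b := exists_abs_le_of_tendsto hp.continuous hL
  refine ⟨L, hp, exists_bound_of_Iic_of_Ici ?_ b, exists_bound_of_Iic_of_Ici ?_ ?_, hL⟩
  · simpa only [mul_neg, neg_neg] using exists_abs_profU_le (-(l + 2 / 3))
  · simpa only [mul_neg, neg_neg] using exists_abs_deriv_profU_le_Iic (-(l + 2 / 3))
  · obtain ⟨C₁, _, h₁⟩ := b
    refine exists_abs_deriv_profU_le (C₂ := |C₀|) h₁ fun t ht => (h₀ t ht).trans ?_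
    gcongr
    · exact le_abs_self C₀
    · linarith [abs_nonneg t]
    · linarith

theorem Gamma_ne_zero_of_six_mul {s : ℝ} {k : ℤ} (hs : 6 * s = k) (hk : k % 6 ≠ 0) :
    Real.Gamma s ≠ 0 := by
  refine Real.Gamma_ne_zero fun n hn => hk ?_
  have h : (k : ℝ) = ((-6 * n : ℤ) : ℝ) := by
    rw [← hs, hn]
    push_cast
    ring
  have h2 : k = -6 * n := by exact_mod_cast h
  omega

/-- The connection formula behind `φ_m`: the two branches of `φ_m` are one profile. -/
theorem profU_eq_mConst_mul (m : ℤ) (t : ℝ) : profU (-lamExp m) t =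
    mConst m * (Real.exp (-t ^ 3 / 9) * profU (5 / 6 + m) (-t)) := by
  have hp := ((isProfileOn_profU (5 / 6 + m)).reflect).const_mul isOpen_univ (mConst m)
  rw [show (2 / 3 - (5 / 6 + m) : ℝ) = -lamExp m by rw [lamExp]; ring] at hp
  have h0 := deriv_profU_zero (5 / 6 + (m : ℝ))
  have hd : HasDerivAt (fun t => mConst m * (Real.exp (-t ^ 3 / 9) * profU (5 / 6 + m) (-t)))
      (mConst m * (Real.Gamma (-(1 / 3)) / Real.Gamma (5 / 6 + m) / 9 ^ (1 / 3 : ℝ))) 0 := by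
    refine (((hasDerivAt_neg_cube_div 0).exp.mul
      (((isProfileOn_profU (5 / 6 + m)).1 (-0) trivial).comp 0
        (hasDerivAt_neg 0))).const_mul _).congr_deriv ?_
    simp only [neg_zero, h0]
    simp
  -- none of the arguments is an integer, so that `Γ` has no poles here
  have g1 : Real.Gamma (7 / 6 + m) ≠ 0 :=
    Gamma_ne_zero_of_six_mul (k := 7 + 6 * m) (by push_cast; ring) (by omega)
  have g2 : Real.Gamma (1 / 6 - m) ≠ 0 :=
    Gamma_ne_zero_of_six_mul (k := 1 - 6 * m) (by push_cast; ring) (by omega)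
  have g3 : Real.Gamma (5 / 6 + m) ≠ 0 :=
    Gamma_ne_zero_of_six_mul (k := 5 + 6 * m) (by push_cast; ring) (by omega)
  have g4 : Real.Gamma (-lamExp m) ≠ 0 :=
    Gamma_ne_zero_of_six_mul (k := -1 - 6 * m) (by rw [lamExp]; push_cast; ring) (by omega)
  refine congrFun ((isProfileOn_profU (-lamExp m)).ext hp ?_ ?_) t
  · simp only [neg_zero, profU_zero]
    rw [show -lamExp m + 1 / 3 = 1 / 6 - m by rw [lamExp]; ring,
      show (5 / 6 + m + 1 / 3 : ℝ) = 7 / 6 + m by ring, mConst]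
    generalize Real.Gamma (7 / 6 + m) = G₁ at *
    generalize Real.Gamma (1 / 6 - m) = G₂ at *
    simp
    field_simp
  · rw [hd.deriv, deriv_profU_zero, mConst]
    -- equality of the slopes at the origin is the reflection formula for `Γ`
    have r1 := Real.Gamma_mul_Gamma_one_sub (7 / 6 + m)
    have r2 := Real.Gamma_mul_Gamma_one_sub (5 / 6 + m)
    rw [show (1 - (7 / 6 + m) : ℝ) = -lamExp m by rw [lamExp]; ring] at r1
    rw [show (1 - (5 / 6 + m) : ℝ) = 1 / 6 - m by ring] at r2
    have hs : Real.sin (Real.pi * (7 / 6 + m)) = -Real.sin (Real.pi * (5 / 6 + m)) := by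
      have h1 : Real.pi * (7 / 6 + m) = Real.pi / 6 + (Real.pi + m * Real.pi) := by ring
      have h2 : Real.pi * (5 / 6 + m) = -(Real.pi / 6) + (Real.pi + m * Real.pi) := by ring
      have h3 : Real.sin (Real.pi + m * Real.pi) = 0 := by
        rw [show Real.pi + m * Real.pi = ((m + 1 : ℤ) : ℝ) * Real.pi by push_cast; ring]
        exact Real.sin_int_mul_pi _
      rw [h1, h2, Real.sin_add (Real.pi / 6), Real.sin_add (-(Real.pi / 6)), h3]
      simp
    rw [hs, div_neg, ← r2] at r1
    have e : (Real.Gamma (-lamExp m))⁻¹ =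
        -(Real.Gamma (7 / 6 + m) / Real.Gamma (1 / 6 - m) / Real.Gamma (5 / 6 + m)) := by
      clear h0 hd hp
      generalize Real.Gamma (7 / 6 + m) = G₁ at *
      generalize Real.Gamma (1 / 6 - m) = G₂ at *
      generalize Real.Gamma (5 / 6 + m) = G₃ at *
      field_simp
      linear_combination r1
    rw [div_eq_mul_inv (Real.Gamma (-(1 / 3))) (Real.Gamma (-lamExp m)), e]
    ring

theorem isAdmissibleProfile_profU_lamExp (m : ℤ) :
    IsAdmissibleProfile (lamExp m) 0 (profU (-lamExp m)) := by
  have hp := isProfileOn_profU (-lamExp m)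
  have hfun : profU (-lamExp m) =
      fun t => mConst m * (Real.exp (-t ^ 3 / 9) * profU (5 / 6 + m) (-t)) :=
    funext (profU_eq_mConst_mul m)
  obtain ⟨C, hC, h⟩ := exists_abs_exp_mul_profU_le (5 / 6 + m) (3 * lamExp m - 1)
  have b1 : ∀ t ∈ Set.Ici (0 : ℝ), |profU (-lamExp m) t| ≤
      |mConst m| * C * (1 + |t|) ^ (3 * lamExp m - 1) := fun t ht => by
    rw [profU_eq_mConst_mul, abs_mul, mul_assoc]
    exact mul_le_mul_of_nonneg_left (h t ht).1 (abs_nonneg _)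
  refine ⟨hp, exists_bound_of_Iic_of_Ici ?_ ⟨|mConst m| * C, by positivity, fun t ht =>
    (b1 t ht).trans ?_⟩, exists_bound_of_Iic_of_Ici ?_
      ⟨|mConst m| * C, by positivity, fun t ht => ?_⟩, ?_⟩
  · simpa only [mul_neg, neg_neg] using exists_abs_profU_le (-lamExp m)
  · gcongr
    · linarith [abs_nonneg t]
    · linarith
  · simpa only [mul_neg, neg_neg] using exists_abs_deriv_profU_le_Iic (-lamExp m)
  · have hd : DifferentiableAt ℝ (fun t => Real.exp (-t ^ 3 / 9) * profU (5 / 6 + m) (-t)) t :=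
      ((isProfileOn_profU (5 / 6 + m)).reflect.1 t trivial).differentiableAt
    rw [hfun, deriv_const_mul _ hd, abs_mul, mul_assoc]
    exact mul_le_mul_of_nonneg_left (h t ht).2 (abs_nonneg _)
  · have hlim : Tendsto (fun t : ℝ => |mConst m| * C * (2 ^ |-(3 * lamExp m)| * t⁻¹))
        atTop (𝓝 0) := by
      simpa using (tendsto_inv_atTop_zero.const_mul (2 ^ |-(3 * lamExp m)|)).const_mul
        (|mConst m| * C)
    refine squeeze_zero_norm' ?_ hlim
    filter_upwards [eventually_ge_atTop 1] with t ht
    have ht0 : 0 < t := by linarith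
    have h1 := b1 t ht0.le
    have h2 := abs_rpow_le_mul_one_add (t := t) (by rwa [abs_of_pos ht0]) (-(3 * lamExp m))
    rw [abs_of_pos ht0] at h1 h2
    rw [norm_mul, Real.norm_eq_abs, Real.norm_of_nonneg (by positivity)]
    calc |profU (-lamExp m) t| * t ^ (-(3 * lamExp m))
        ≤ (|mConst m| * C * (1 + t) ^ (3 * lamExp m - 1)) *
          (2 ^ |-(3 * lamExp m)| * (1 + t) ^ (-(3 * lamExp m))) := by gcongr
      _ = |mConst m| * C * (2 ^ |-(3 * lamExp m)| *
          ((1 + t) ^ (3 * lamExp m - 1) * (1 + t) ^ (-(3 * lamExp m)))) := by ring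
      _ = |mConst m| * C * (2 ^ |-(3 * lamExp m)| * (1 + t)⁻¹) := by
          rw [← Real.rpow_add (by positivity), ← Real.rpow_neg_one (1 + t)]
          congr 3
          ring
      _ ≤ _ := by
          gcongr
          linarith

/-- The self-similar function `x ^ lam * f (v / x ^ (1 / 3))`. -/
noncomputable def selfSim (lam : ℝ) (f : ℝ → ℝ) (z : ℝ × ℝ) : ℝ :=
  z.1 ^ lam * f (z.2 / z.1 ^ (1 / 3 : ℝ))

theorem rpow_one_third_pow {x : ℝ} (hx : 0 ≤ x) : (x ^ (1 / 3 : ℝ)) ^ 3 = x := by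
  rw [← Real.rpow_natCast, ← Real.rpow_mul hx]
  norm_num

theorem neg_cube_selfSim_var {x : ℝ} (hx : 0 < x) (v : ℝ) :
    -(v / x ^ (1 / 3 : ℝ)) ^ 3 / 9 = -v ^ 3 / (9 * x) := by
  rw [div_pow, rpow_one_third_pow hx.le]
  field_simp

theorem phi_eq_selfSim (m : ℤ) {z : ℝ × ℝ} (hz : z ∈ halfPlane) :
    phi m z = selfSim (lamExp m) (fun t => cSign m * profU (-lamExp m) t) z := by
  have hx : 0 < z.1 := hz
  have hx3 : 0 < z.1 ^ (1 / 3 : ℝ) := by positivity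
  have e := neg_cube_selfSim_var hx z.2
  have ea : -(1 / 6) - (m : ℝ) = -lamExp m := by rw [lamExp]; ring
  unfold phi selfSim
  split_ifs with h
  · simp only
    rw [← tricomiU_eq_profU _ (div_nonpos_of_nonpos_of_nonneg h.le hx3.le), e, ea]
    ring
  · have ht : 0 ≤ z.2 / z.1 ^ (1 / 3 : ℝ) := div_nonneg (not_lt.1 h) hx3.le
    have e2 : -(-(z.2 / z.1 ^ (1 / 3 : ℝ))) ^ 3 / 9 = z.2 ^ 3 / (9 * z.1) := by
      rw [neg_pow, show (-1 : ℝ) ^ 3 = -1 by norm_num, neg_one_mul]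
      linear_combination -e
    simp only
    rw [profU_eq_mConst_mul, ← tricomiU_eq_profU _ (neg_nonpos.2 ht), e, e2]
    ring

/-- The factor by which `ψ_l` differs from the corresponding Tricomi function. -/
noncomputable def psiConst (l : ℕ) : ℝ := Real.Gamma (-(l + 1 / 3)) / Real.Gamma (1 / 3)

theorem psiConst_ne_zero (l : ℕ) : psiConst l ≠ 0 := by
  refine div_ne_zero (Gamma_ne_zero_of_six_mul (k := -6 * l - 2) (by push_cast; ring) (by omega)) ?_
  exact (Real.Gamma_pos_of_pos (by norm_num)).ne'

theorem psi_eq_selfSim (l : ℕ) {z : ℝ × ℝ} (hz : z ∈ halfPlane) :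
    psi l z = selfSim (l + 2 / 3) (fun t => psiConst l * profU (-(l + 2 / 3)) t) z := by
  have hx : 0 < z.1 := hz
  have hx3 : 0 < z.1 ^ (1 / 3 : ℝ) := by positivity
  have e := neg_cube_selfSim_var hx z.2
  have h1 : Real.Gamma (2 / 3) = -(1 / 3) * Real.Gamma (-(1 / 3)) := by
    rw [← Real.Gamma_add_one (by norm_num)]
    norm_num
  have h2 : Real.Gamma (4 / 3) = 1 / 3 * Real.Gamma (1 / 3) := by
    rw [← Real.Gamma_add_one (by norm_num)]
    norm_num
  have h3 : Real.Gamma (1 / 3) ≠ 0 := (Real.Gamma_pos_of_pos (by norm_num)).ne'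
  have h4 : Real.Gamma (-(l + 1 / 3)) ≠ 0 :=
    Gamma_ne_zero_of_six_mul (k := -6 * l - 2) (by push_cast; ring) (by omega)
  have h9 : (9 : ℝ) ^ (1 / 3 : ℝ) ≠ 0 := by positivity
  unfold psi selfSim psiConst
  simp only
  unfold profU profE profO
  rw [show ((3 * l + 2 : ℝ) / 3) = l + 2 / 3 by ring, show ((3 * l + 1 : ℝ) / 3) = l + 1 / 3 by ring,
    show (-(l + 2 / 3) + 1 / 3 : ℝ) = -(l + 1 / 3) by ring, e,
    Real.mul_rpow (by norm_num) hx.le, h1, h2]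
  generalize Real.Gamma (-(l + 1 / 3)) = G₁ at *
  generalize Real.Gamma (-(l + 2 / 3)) = G₂ at *
  generalize kummerM (-(l + 2 / 3)) (2 / 3) (-z.2 ^ 3 / (9 * z.1)) = K₁
  generalize kummerM (-(l + 1 / 3)) (4 / 3) (-z.2 ^ 3 / (9 * z.1)) = K₂
  field_simp

section SelfSim

variable {lam : ℝ} {f : ℝ → ℝ}

theorem selfSim_homogeneous (lam : ℝ) (f : ℝ → ℝ) :
    IsKinHomogeneous (3 * lam) (selfSim lam f) := by
  intro r hr z hz
  have hx : 0 < z.1 := hz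
  unfold selfSim
  simp only
  have h1 : (r ^ 3) ^ (1 / 3 : ℝ) = r := by
    rw [← Real.rpow_natCast, ← Real.rpow_mul hr.le]
    norm_num
  have h2 : (r ^ 3) ^ lam = r ^ (3 * lam) := by
    rw [← Real.rpow_natCast, ← Real.rpow_mul hr.le]
    norm_num
  rw [Real.mul_rpow (by positivity) hx.le, Real.mul_rpow (by positivity) hx.le, h1, h2,
    mul_div_mul_left _ _ hr.ne', mul_assoc]

/-- The derivatives of `h` that occur in the equation, jointly continuous in the half-plane. -/
structure HasKinDerivs (h hx hv hvv : ℝ × ℝ → ℝ) : Prop where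
  deriv_x : ∀ x v : ℝ, 0 < x → HasDerivAt (fun y => h (y, v)) (hx (x, v)) x
  deriv_v : ∀ x v : ℝ, 0 < x → HasDerivAt (fun w => h (x, w)) (hv (x, v)) v
  deriv_vv : ∀ x v : ℝ, 0 < x → HasDerivAt (fun w => hv (x, w)) (hvv (x, v)) v
  cont : ContinuousOn h halfPlane
  cont_x : ContinuousOn hx halfPlane
  cont_v : ContinuousOn hv halfPlane
  cont_vv : ContinuousOn hvv halfPlane

theorem HasKinDerivs.linear_comb {h hx hv hvv k kx kv kvv : ℝ × ℝ → ℝ}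
    (H : HasKinDerivs h hx hv hvv) (K : HasKinDerivs k kx kv kvv) (c : ℝ) :
    HasKinDerivs (fun z => h z + c * k z) (fun z => hx z + c * kx z) (fun z => hv z + c * kv z)
      (fun z => hvv z + c * kvv z) where
  deriv_x x v h0 := (H.deriv_x x v h0).add ((K.deriv_x x v h0).const_mul c)
  deriv_v x v h0 := (H.deriv_v x v h0).add ((K.deriv_v x v h0).const_mul c)
  deriv_vv x v h0 := (H.deriv_vv x v h0).add ((K.deriv_vv x v h0).const_mul c)
  cont := H.cont.add (K.cont.const_mul c)
  cont_x := H.cont_x.add (K.cont_x.const_mul c)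
  cont_v := H.cont_v.add (K.cont_v.const_mul c)
  cont_vv := H.cont_vv.add (K.cont_vv.const_mul c)

theorem HasKinDerivs.congr {h k hx hv hvv : ℝ × ℝ → ℝ} (H : HasKinDerivs h hx hv hvv)
    (hk : ∀ z ∈ halfPlane, k z = h z) : HasKinDerivs k hx hv hvv where
  deriv_x x v h0 := (H.deriv_x x v h0).congr_of_eventuallyEq
    (by filter_upwards [lt_mem_nhds h0] with y hy using hk (y, v) hy)
  deriv_v x v h0 := (H.deriv_v x v h0).congr_of_eventuallyEq (Eventually.of_forall fun w => hk (x, w) h0)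
  deriv_vv := H.deriv_vv
  cont := H.cont.congr hk
  cont_x := H.cont_x
  cont_v := H.cont_v
  cont_vv := H.cont_vv

theorem HasKinDerivs.isClassicalSolution {h hx hv hvv F : ℝ × ℝ → ℝ} {g : ℝ → ℝ}
    (H : HasKinDerivs h hx hv hvv) (he : ∀ z ∈ halfPlane, z.2 * hx z - hvv z = F z)
    (hb : ∀ v : ℝ, 0 < v → Tendsto h (𝓝[halfPlane] (0, v)) (𝓝 (g v))) :
    IsClassicalSolution F g h := by
  have e1 : ∀ x v : ℝ, 0 < x → deriv (fun y => h (y, v)) x = hx (x, v) :=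
    fun x v h0 => (H.deriv_x x v h0).deriv
  have e2 : ∀ x : ℝ, 0 < x → deriv (fun w => h (x, w)) = fun w => hv (x, w) :=
    fun x h0 => funext fun v => (H.deriv_v x v h0).deriv
  have e3 : ∀ x v : ℝ, 0 < x → deriv (deriv fun w => h (x, w)) v = hvv (x, v) :=
    fun x v h0 => by rw [e2 x h0]; exact (H.deriv_vv x v h0).deriv
  refine ⟨fun x v h0 => (H.deriv_x x v h0).differentiableAt, fun x v h0 => (H.deriv_v x v h0).differentiableAt,
    fun x v h0 => ?_, H.cont_x.congr fun z hz => e1 z.1 z.2 hz,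
    H.cont_v.congr fun z hz => congrFun (e2 z.1 hz) z.2,
    H.cont_vv.congr fun z hz => e3 z.1 z.2 hz, fun x v h0 => ?_, hb⟩
  · rw [e2 x h0]
    exact (H.deriv_vv x v h0).differentiableAt
  · rw [e1 x v h0, e3 x v h0]
    exact he (x, v) h0

theorem hasDerivAt_selfSim_var {x : ℝ} (hx : 0 < x) (v : ℝ) :
    HasDerivAt (fun y : ℝ => v / y ^ (1 / 3 : ℝ)) (-(v / x ^ (1 / 3 : ℝ)) / 3 * x⁻¹) x := by
  have h := (Real.hasDerivAt_rpow_const (x := x) (p := 1 / 3) (Or.inl hx.ne'))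
  have h2 := (h.inv (by positivity)).const_mul v
  refine (h2.congr_deriv ?_).congr_of_eventuallyEq
    (Eventually.of_forall fun y => div_eq_mul_inv v (y ^ (1 / 3 : ℝ)))
  rw [Real.rpow_sub_one hx.ne']
  field_simp

theorem hasDerivAt_selfSim_x {x : ℝ} (hx : 0 < x) (v : ℝ)
    (hf : HasDerivAt f (deriv f (v / x ^ (1 / 3 : ℝ))) (v / x ^ (1 / 3 : ℝ))) :
    HasDerivAt (fun y => selfSim lam f (y, v)) (x ^ (lam - 1) * (lam * f (v / x ^ (1 / 3 : ℝ)) -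
      v / x ^ (1 / 3 : ℝ) / 3 * deriv f (v / x ^ (1 / 3 : ℝ)))) x := by
  refine ((Real.hasDerivAt_rpow_const (p := lam) (Or.inl hx.ne')).mul
    (hf.comp x (hasDerivAt_selfSim_var hx v))).congr_deriv ?_
  simp only [Function.comp]
  rw [Real.rpow_sub_one hx.ne']
  field_simp
  ring

theorem hasDerivAt_selfSim_v {x : ℝ} (hx : 0 < x) (v : ℝ) {f' : ℝ}
    (hf : HasDerivAt f f' (v / x ^ (1 / 3 : ℝ))) :
    HasDerivAt (fun w => selfSim lam f (x, w)) (x ^ (lam - 1 / 3) * f') v := by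
  refine ((hf.comp v ((hasDerivAt_id v).div_const (x ^ (1 / 3 : ℝ)))).const_mul
    (x ^ lam)).congr_deriv ?_
  rw [Real.rpow_sub hx]
  ring

theorem continuousOn_selfSim (lam : ℝ) (hf : Continuous f) :
    ContinuousOn (selfSim lam f) halfPlane := by
  have hfst : ∀ p : ℝ, ContinuousOn (fun z : ℝ × ℝ => z.1 ^ p) halfPlane := fun p =>
    continuous_fst.continuousOn.rpow_const fun z hz => Or.inl (ne_of_gt hz)
  have hx : ∀ z ∈ halfPlane, z.1 ^ (1 / 3 : ℝ) ≠ 0 := fun z hz => (Real.rpow_pos_of_pos hz _).ne'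
  exact (hfst lam).mul (hf.comp_continuousOn (continuous_snd.continuousOn.div (hfst _) hx))

/-- The derivatives of a self-similar function are again self-similar; the equation of profiles
expresses the second derivative in `v` without `f''`. -/
theorem IsProfileOn.hasKinDerivs (hf : IsProfileOn Set.univ (-lam) f) :
    HasKinDerivs (selfSim lam f)
      (selfSim (lam - 1) fun t => lam * f t - t / 3 * deriv f t)
      (selfSim (lam - 1 / 3) (deriv f))
      (selfSim (lam - 2 / 3) fun t => lam * t * f t - t ^ 2 / 3 * deriv f t) where
  deriv_x x v h0 := hasDerivAt_selfSim_x h0 v (hf.1 _ trivial)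
  deriv_v x v h0 := hasDerivAt_selfSim_v h0 v (hf.1 _ trivial)
  deriv_vv x v h0 := by
    refine (hasDerivAt_selfSim_v h0 v (hf.2 _ trivial)).congr_deriv ?_
    rw [show lam - 1 / 3 - 1 / 3 = lam - 2 / 3 by ring]
    unfold selfSim
    simp only
    ring
  cont := continuousOn_selfSim _ hf.continuous
  cont_x := continuousOn_selfSim _ ((continuous_const.mul hf.continuous).sub
    ((by fun_prop : Continuous fun t : ℝ => t / 3).mul hf.continuous_deriv))
  cont_v := continuousOn_selfSim _ hf.continuous_deriv
  cont_vv := continuousOn_selfSim _ (((by fun_prop : Continuous fun t : ℝ => lam * t).mul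
    hf.continuous).sub ((by fun_prop : Continuous fun t : ℝ => t ^ 2 / 3).mul hf.continuous_deriv))

theorem selfSim_equation (lam : ℝ) (f : ℝ → ℝ) {z : ℝ × ℝ} (hz : z ∈ halfPlane) :
    z.2 * selfSim (lam - 1) (fun t => lam * f t - t / 3 * deriv f t) z -
      selfSim (lam - 2 / 3) (fun t => lam * t * f t - t ^ 2 / 3 * deriv f t) z = 0 := by
  have hx : 0 < z.1 := hz
  have hx3 : 0 < z.1 ^ (1 / 3 : ℝ) := by positivity
  unfold selfSim
  simp only
  have e : z.1 ^ (lam - 2 / 3) = z.1 ^ (lam - 1) * z.1 ^ (1 / 3 : ℝ) := by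
    rw [← Real.rpow_add hx]
    congr 1
    ring
  rw [e]
  field_simp
  ring

/-- The boundary values at `x = 0 < v` are governed by the behaviour of the profile at `+∞`. -/
theorem tendsto_selfSim_boundary {L : ℝ}
    (hlim : Tendsto (fun t => f t * t ^ (-(3 * lam))) atTop (𝓝 L)) {v : ℝ} (hv : 0 < v) :
    Tendsto (selfSim lam f) (𝓝[halfPlane] (0, v)) (𝓝 (L * v ^ (3 * lam))) := by
  have h1 : Tendsto (fun z : ℝ × ℝ => z.1 ^ (1 / 3 : ℝ)) (𝓝[halfPlane] (0, v)) (𝓝[>] 0) := by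
    refine tendsto_nhdsWithin_iff.2 ⟨?_, ?_⟩
    · have : Continuous fun z : ℝ × ℝ => z.1 ^ (1 / 3 : ℝ) :=
        continuous_fst.rpow_const fun _ => Or.inr (by norm_num)
      simpa using (this.tendsto (0, v)).mono_left (nhdsWithin_le_nhds (s := halfPlane))
    · filter_upwards [self_mem_nhdsWithin] with z hz using Real.rpow_pos_of_pos hz _
  have h2 : Tendsto (fun z : ℝ × ℝ => z.2) (𝓝[halfPlane] (0, v)) (𝓝 v) :=
    (continuous_snd.tendsto (0, v)).mono_left nhdsWithin_le_nhds
  have h3 : Tendsto (fun z : ℝ × ℝ => z.2 / z.1 ^ (1 / 3 : ℝ)) (𝓝[halfPlane] (0, v)) atTop := by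
    simp_rw [div_eq_mul_inv]
    exact h2.pos_mul_atTop hv (tendsto_inv_nhdsGT_zero.comp h1)
  have h4 := (hlim.comp h3).mul (h2.rpow_const (p := 3 * lam) (Or.inl hv.ne'))
  refine h4.congr' ?_
  filter_upwards [self_mem_nhdsWithin, h2.eventually (lt_mem_nhds hv)] with z hz hz2
  have hx : 0 < z.1 := hz
  have e : (z.1 ^ (1 / 3 : ℝ)) ^ (3 * lam) = z.1 ^ lam := by
    rw [← Real.rpow_mul hx.le]
    congr 1
    ring
  simp only [Function.comp, selfSim]
  rw [Real.rpow_neg (by positivity), Real.div_rpow hz2.le (by positivity), e]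
  field_simp

theorem one_add_abs_selfSim_var {x : ℝ} (hx : 0 < x) (v p : ℝ) :
    x ^ (p / 3) * (1 + |v / x ^ (1 / 3 : ℝ)|) ^ p = (x ^ (1 / 3 : ℝ) + |v|) ^ p := by
  have hx3 : 0 < x ^ (1 / 3 : ℝ) := by positivity
  have e : x ^ (p / 3) = (x ^ (1 / 3 : ℝ)) ^ p := by
    rw [← Real.rpow_mul hx.le]
    congr 1
    ring
  rw [e, ← Real.mul_rpow hx3.le (by positivity), abs_div, abs_of_pos hx3]
  congr 1
  field_simp

theorem abs_selfSim_le {p C : ℝ} (h : ∀ t, |f t| ≤ C * (1 + |t|) ^ p) {z : ℝ × ℝ}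
    (hz : z ∈ halfPlane) : |selfSim (p / 3) f z| ≤ C * (z.1 ^ (1 / 3 : ℝ) + |z.2|) ^ p := by
  have hx : 0 < z.1 := hz
  rw [← one_add_abs_selfSim_var hx, selfSim, abs_mul, abs_of_pos (by positivity), mul_left_comm]
  exact mul_le_mul_of_nonneg_left (h _) (by positivity)

theorem IsAdmissibleProfile.abs_selfSim_le {L : ℝ} (hf : IsAdmissibleProfile lam L f) :
    ∃ C, 0 ≤ C ∧ ∀ z ∈ halfPlane,
      |selfSim lam f z| ≤ C * (z.1 ^ (1 / 3 : ℝ) + |z.2|) ^ (3 * lam) := by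
  obtain ⟨C, hC, h⟩ := hf.bound
  refine ⟨C, hC, fun z hz => ?_⟩
  simpa using _root_.abs_selfSim_le h hz

theorem IsAdmissibleProfile.abs_selfSim_deriv_le {L : ℝ} (hf : IsAdmissibleProfile lam L f) :
    ∃ C, 0 ≤ C ∧ ∀ z ∈ halfPlane,
      |selfSim (lam - 1 / 3) (deriv f) z| ≤ C * (z.1 ^ (1 / 3 : ℝ) + |z.2|) ^ (3 * lam - 1) := by
  obtain ⟨C, hC, h⟩ := hf.bound_deriv
  refine ⟨C, hC, fun z hz => ?_⟩
  rw [show lam - 1 / 3 = (3 * lam - 1) / 3 by ring]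
  exact _root_.abs_selfSim_le h hz

end SelfSim

/-! ### From classical to weak solutions -/

/-- The half-plane to the right of the line `x = ε`. -/
def rightOf (ε : ℝ) : Set (ℝ × ℝ) := Set.Ioi ε ×ˢ Set.univ

theorem measurableSet_rightOf (ε : ℝ) : MeasurableSet (rightOf ε) :=
  measurableSet_Ioi.prod MeasurableSet.univ

theorem halfPlane_eq : halfPlane = rightOf 0 := by
  ext z
  simp [halfPlane, rightOf]

theorem isOpen_halfPlane : IsOpen halfPlane := isOpen_lt continuous_const continuous_fst

theorem measurableSet_halfPlane : MeasurableSet halfPlane := isOpen_halfPlane.measurableSet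

theorem rightOf_subset_halfPlane {ε : ℝ} (hε : 0 < ε) : rightOf ε ⊆ halfPlane :=
  fun _ hz => hε.trans hz.1

section TestFunctions

variable {ψ : ℝ × ℝ → ℝ}

theorem hasDerivAt_dx (h : ContDiff ℝ ∞ ψ) (x v : ℝ) :
    HasDerivAt (fun y => ψ (y, v)) (dx ψ (x, v)) x :=
  (h.differentiable (by simp) (x, v)).hasFDerivAt.comp_hasDerivAt x
    ((hasDerivAt_id x).prodMk (hasDerivAt_const x v))

theorem hasDerivAt_dv (h : ContDiff ℝ ∞ ψ) (x v : ℝ) :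
    HasDerivAt (fun w => ψ (x, w)) (dv ψ (x, v)) v :=
  (h.differentiable (by simp) (x, v)).hasFDerivAt.comp_hasDerivAt v
    ((hasDerivAt_const v x).prodMk (hasDerivAt_id v))

theorem continuous_dx (h : ContDiff ℝ ∞ ψ) : Continuous (dx ψ) :=
  (h.continuous_fderiv (by simp)).clm_apply continuous_const

theorem continuous_dv (h : ContDiff ℝ ∞ ψ) : Continuous (dv ψ) :=
  (h.continuous_fderiv (by simp)).clm_apply continuous_const

theorem hasCompactSupport_dx (h : HasCompactSupport ψ) : HasCompactSupport (dx ψ) :=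
  h.fderiv_apply ℝ _

theorem hasCompactSupport_dv (h : HasCompactSupport ψ) : HasCompactSupport (dv ψ) :=
  h.fderiv_apply ℝ _

theorem dx_eq_zero {z : ℝ × ℝ} (hz : z ∉ tsupport ψ) : dx ψ z = 0 := by
  rw [dx, fderiv_of_notMem_tsupport ℝ hz]
  rfl

theorem dv_eq_zero {z : ℝ × ℝ} (hz : z ∉ tsupport ψ) : dv ψ z = 0 := by
  rw [dv, fderiv_of_notMem_tsupport ℝ hz]
  rfl

theorem hasCompactSupport_snd_slice (h : HasCompactSupport ψ) (x : ℝ) :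
    HasCompactSupport fun v => ψ (x, v) :=
  HasCompactSupport.intro (IsCompact.image h continuous_snd) fun v hv => by
    by_contra h0
    exact hv ⟨(x, v), subset_tsupport _ h0, rfl⟩

theorem hasCompactSupport_fst_slice (h : HasCompactSupport ψ) (v : ℝ) :
    HasCompactSupport fun x => ψ (x, v) :=
  HasCompactSupport.intro (IsCompact.image h continuous_fst) fun x hx => by
    by_contra h0
    exact hx ⟨(x, v), subset_tsupport _ h0, rfl⟩

theorem integrableOn_rightOf {k θ : ℝ × ℝ → ℝ} (hk : ContinuousOn k halfPlane)
    (hθ : Continuous θ) (hc : HasCompactSupport θ) {ε : ℝ} (hε : 0 < ε) :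
    IntegrableOn (fun z => k z * θ z) (rightOf ε) := by
  have hK : IsCompact (tsupport θ ∩ {z : ℝ × ℝ | ε ≤ z.1}) :=
    IsCompact.inter_right hc (isClosed_le continuous_const continuous_fst)
  have h : IntegrableOn (fun z => k z * θ z) (tsupport θ ∩ {z : ℝ × ℝ | ε ≤ z.1}) :=
    ((hk.mono fun z hz => hε.trans_le hz.2).mul hθ.continuousOn).integrableOn_compact hK
  refine h.of_forall_sdiff_eq_zero (measurableSet_rightOf ε) fun z hz => ?_
  have : z ∉ tsupport θ := fun h0 =>
    hz.2 ⟨h0, show ε ≤ z.1 from le_of_lt hz.1.1⟩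
  rw [image_eq_zero_of_notMem_tsupport this, mul_zero]

theorem setIntegral_rightOf {G : ℝ × ℝ → ℝ} {ε : ℝ} (hG : IntegrableOn G (rightOf ε)) :
    ∫ z in rightOf ε, G z = ∫ x in Set.Ioi ε, ∫ v, G (x, v) := by
  rw [rightOf, Measure.volume_eq_prod] at *
  rw [setIntegral_prod _ hG]
  simp

theorem setIntegral_rightOf_symm {G : ℝ × ℝ → ℝ} {ε : ℝ} (hG : IntegrableOn G (rightOf ε)) :
    ∫ z in rightOf ε, G z = ∫ v, ∫ x in Set.Ioi ε, G (x, v) := by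
  rw [rightOf, IntegrableOn, Measure.volume_eq_prod, ← Measure.prod_restrict] at *
  rw [integral_prod_symm _ hG]
  simp

/-- Integration by parts in `v` on `{x > ε}`. -/
theorem integral_mul_dv_eq {k kv : ℝ × ℝ → ℝ} (hk : ContinuousOn k halfPlane)
    (hkv : ContinuousOn kv halfPlane)
    (hd : ∀ x v : ℝ, 0 < x → HasDerivAt (fun w => k (x, w)) (kv (x, v)) v)
    (h : ContDiff ℝ ∞ ψ) (hc : HasCompactSupport ψ) {ε : ℝ} (hε : 0 < ε) :
    ∫ z in rightOf ε, k z * dv ψ z = -∫ z in rightOf ε, kv z * ψ z := by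
  have i1 := integrableOn_rightOf hk (continuous_dv h) (hasCompactSupport_dv hc) hε
  have i2 := integrableOn_rightOf hkv h.continuous hc hε
  have i12 : IntegrableOn (fun z => k z * dv ψ z + kv z * ψ z) (rightOf ε) := i1.add i2
  have h0 : ∫ z in rightOf ε, (k z * dv ψ z + kv z * ψ z) = 0 := by
    rw [setIntegral_rightOf i12]
    refine setIntegral_eq_zero_of_forall_eq_zero fun x hx => ?_
    have hx0 : 0 < x := hε.trans hx
    have ck : Continuous fun v => k (x, v) :=
      continuous_iff_continuousAt.2 fun v => (hd x v hx0).continuousAt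
    have ckv : Continuous fun v => kv (x, v) :=
      hkv.comp_continuous (by fun_prop) fun _ => hx0
    have cψ : Continuous fun v => ψ (x, v) := h.continuous.comp (by fun_prop)
    have cdv : Continuous fun v => dv ψ (x, v) := (continuous_dv h).comp (by fun_prop)
    refine integral_eq_zero_of_hasDerivAt_of_integrable (f := fun v => k (x, v) * ψ (x, v))
      (fun v => ?_) ?_ ?_
    · refine ((hd x v hx0).mul (hasDerivAt_dv h x v)).congr_deriv ?_
      ring
    · exact ((ck.mul cdv).integrable_of_hasCompactSupport
        (hasCompactSupport_snd_slice (hasCompactSupport_dv hc) x).mul_left).add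
        ((ckv.mul cψ).integrable_of_hasCompactSupport
        (hasCompactSupport_snd_slice hc x).mul_left)
    · exact (ck.mul cψ).integrable_of_hasCompactSupport (hasCompactSupport_snd_slice hc x).mul_left
  rw [integral_add i1 i2] at h0
  linarith

/-- Integration by parts in `x` on `{x > ε}`, with the weight `v`. -/
theorem integral_mul_dx_eq {k kx : ℝ × ℝ → ℝ} (hk : ContinuousOn k halfPlane)
    (hkx : ContinuousOn kx halfPlane)
    (hd : ∀ x v : ℝ, 0 < x → HasDerivAt (fun y => k (y, v)) (kx (x, v)) x)
    (h : ContDiff ℝ ∞ ψ) (hc : HasCompactSupport ψ) {ε : ℝ} (hε : 0 < ε) :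
    ∫ z in rightOf ε, k z * (z.2 * dx ψ z) =
      -(∫ z in rightOf ε, kx z * (z.2 * ψ z)) - ∫ v, k (ε, v) * ψ (ε, v) * v := by
  have i1 : IntegrableOn (fun z => k z * (z.2 * dx ψ z)) (rightOf ε) :=
    integrableOn_rightOf hk (continuous_snd.mul (continuous_dx h))
      (hasCompactSupport_dx hc).mul_left hε
  have i2 : IntegrableOn (fun z => kx z * (z.2 * ψ z)) (rightOf ε) :=
    integrableOn_rightOf hkx (continuous_snd.mul h.continuous) hc.mul_left hε
  have i12 : IntegrableOn (fun z => k z * (z.2 * dx ψ z) + kx z * (z.2 * ψ z)) (rightOf ε) :=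
    i1.add i2
  have h0 : ∫ z in rightOf ε, (k z * (z.2 * dx ψ z) + kx z * (z.2 * ψ z)) =
      -∫ v, k (ε, v) * ψ (ε, v) * v := by
    rw [setIntegral_rightOf_symm i12, ← integral_neg]
    congr 1
    funext v
    have ck : ContinuousOn (fun x => k (x, v)) (Set.Ici ε) :=
      hk.comp (by fun_prop) fun x hx => hε.trans_le hx
    have ckx : ContinuousOn (fun x => kx (x, v)) (Set.Ici ε) :=
      hkx.comp (by fun_prop) fun x hx => hε.trans_le hx
    have cψ : Continuous fun x => ψ (x, v) := h.continuous.comp (by fun_prop)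
    have cdx : Continuous fun x => dx ψ (x, v) := (continuous_dx h).comp (by fun_prop)
    have hint : ∀ {p q : ℝ → ℝ}, ContinuousOn p (Set.Ici ε) → Continuous q →
        HasCompactSupport q → IntegrableOn (fun x => p x * (v * q x)) (Set.Ioi ε) := by
      intro p q hp hq hqc
      have hK : IsCompact (tsupport q ∩ Set.Ici ε) := IsCompact.inter_right hqc isClosed_Ici
      have h1 : IntegrableOn (fun x => p x * (v * q x)) (tsupport q ∩ Set.Ici ε) :=
        ((hp.mono Set.inter_subset_right).mul
          (continuous_const.mul hq).continuousOn).integrableOn_compact hK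
      refine h1.of_forall_sdiff_eq_zero measurableSet_Ioi fun x hx => ?_
      have : x ∉ tsupport q := fun h0 =>
        hx.2 ⟨h0, show ε ≤ x from le_of_lt hx.1⟩
      rw [image_eq_zero_of_notMem_tsupport this, mul_zero, mul_zero]
    have hder : ∀ x ∈ Set.Ici ε, HasDerivAt (fun x => k (x, v) * ψ (x, v) * v)
        (k (x, v) * (v * dx ψ (x, v)) + kx (x, v) * (v * ψ (x, v))) x := fun x hx => by
      refine (((hd x v (hε.trans_le hx)).mul (hasDerivAt_dx h x v)).mul_const v).congr_deriv ?_
      ring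
    have hlim : Tendsto (fun x => k (x, v) * ψ (x, v) * v) atTop (𝓝 0) := by
      have hev : ∀ᶠ x in atTop, ψ (x, v) = 0 := by
        have := (hasCompactSupport_fst_slice hc v).compl_mem_cocompact
        filter_upwards [atTop_le_cocompact (α := ℝ) this] with x hx
          using image_eq_zero_of_notMem_tsupport (f := fun x => ψ (x, v)) hx
      refine tendsto_const_nhds.congr' ?_
      filter_upwards [hev] with x hx
      rw [hx, mul_zero, zero_mul]
    have := integral_Ioi_of_hasDerivAt_of_tendsto' hder
      ((hint ck cdx (hasCompactSupport_fst_slice (hasCompactSupport_dx hc) v)).add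
        (hint ckx cψ (hasCompactSupport_fst_slice hc v))) hlim
    simpa using this
  rw [integral_add i1 i2] at h0
  linarith

/-- The weak form of the equation on `{x > ε}`, with a boundary term on the line `x = ε`. -/
theorem HasKinDerivs.weak_rightOf {u ux uv uvv F : ℝ × ℝ → ℝ} (H : HasKinDerivs u ux uv uvv)
    (he : ∀ z ∈ halfPlane, z.2 * ux z - uvv z = F z)
    (h : ContDiff ℝ ∞ ψ) (hc : HasCompactSupport ψ) {ε : ℝ} (hε : 0 < ε) :
    -(∫ z in rightOf ε, u z * (z.2 * dx ψ z)) + ∫ z in rightOf ε, uv z * dv ψ z =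
      (∫ v, u (ε, v) * ψ (ε, v) * v) + ∫ z in rightOf ε, F z * ψ z := by
  have i2 : IntegrableOn (fun z => ux z * (z.2 * ψ z)) (rightOf ε) :=
    integrableOn_rightOf H.cont_x (continuous_snd.mul h.continuous) hc.mul_left hε
  have i3 := integrableOn_rightOf H.cont_vv h.continuous hc hε
  have hF : ∫ z in rightOf ε, F z * ψ z =
      ∫ z in rightOf ε, (ux z * (z.2 * ψ z) - uvv z * ψ z) := by
    refine setIntegral_congr_fun (measurableSet_rightOf ε) fun z hz => ?_
    rw [← he z (rightOf_subset_halfPlane hε hz)]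
    ring
  have e3 := integral_mul_dv_eq H.cont_v H.cont_vv H.deriv_vv h hc hε
  rw [integral_mul_dx_eq H.cont H.cont_x H.deriv_x h hc hε, e3, hF, integral_sub i2 i3]
  ring

theorem exists_tsupport_subset_rightOf (hc : HasCompactSupport ψ) (hs : tsupport ψ ⊆ halfPlane) :
    ∃ ε, 0 < ε ∧ tsupport ψ ⊆ rightOf ε := by
  rcases (tsupport ψ).eq_empty_or_nonempty with he | hne
  · exact ⟨1, one_pos, by simp [he]⟩
  · obtain ⟨z, hz, hmin⟩ := IsCompact.exists_isMinOn hc hne continuous_fst.continuousOn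
    have h0 : 0 < z.1 := hs hz
    refine ⟨z.1 / 2, by positivity, fun y hy => ⟨?_, trivial⟩⟩
    have h1 : z.1 ≤ y.1 := hmin hy
    exact lt_of_lt_of_le (by linarith) h1

theorem setIntegral_eq_rightOf {Q : Set (ℝ × ℝ)} {ε : ℝ} (hQ : tsupport ψ ⊆ Q)
    (hε : tsupport ψ ⊆ rightOf ε) {G : ℝ × ℝ → ℝ} (hG : ∀ z ∉ tsupport ψ, G z = 0) :
    ∫ z in Q, G z = ∫ z in rightOf ε, G z := by
  rw [setIntegral_eq_integral_of_forall_compl_eq_zero fun z hz => hG z fun h => hz (hQ h),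
    setIntegral_eq_integral_of_forall_compl_eq_zero fun z hz => hG z fun h => hz (hε h)]

theorem HasKinDerivs.isWeakDerivV {u ux uv uvv : ℝ × ℝ → ℝ} (H : HasKinDerivs u ux uv uvv)
    {Q : Set (ℝ × ℝ)} (hQ : Q ⊆ halfPlane) : IsWeakDerivV Q u uv := by
  intro ψ h hc hs
  obtain ⟨ε, hε, hsε⟩ := exists_tsupport_subset_rightOf hc (hs.trans hQ)
  rw [setIntegral_eq_rightOf hs hsε fun z hz => by rw [dv_eq_zero hz, mul_zero],
    setIntegral_eq_rightOf hs hsε fun z hz => by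
      rw [image_eq_zero_of_notMem_tsupport hz, mul_zero],
    integral_mul_dv_eq H.cont H.cont_v H.deriv_v h hc hε]

theorem HasKinDerivs.weak_interior {u ux uv uvv F : ℝ × ℝ → ℝ} (H : HasKinDerivs u ux uv uvv)
    (he : ∀ z ∈ halfPlane, z.2 * ux z - uvv z = F z) {Q : Set (ℝ × ℝ)} (hQ : Q ⊆ halfPlane)
    (h : ContDiff ℝ ∞ ψ) (hc : HasCompactSupport ψ) (hs : tsupport ψ ⊆ Q) :
    -(∫ z in Q, u z * (z.2 * dx ψ z)) + ∫ z in Q, uv z * dv ψ z = ∫ z in Q, F z * ψ z := by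
  obtain ⟨ε, hε, hsε⟩ := exists_tsupport_subset_rightOf hc (hs.trans hQ)
  rw [setIntegral_eq_rightOf hs hsε fun z hz => by rw [dx_eq_zero hz, mul_zero, mul_zero],
    setIntegral_eq_rightOf hs hsε fun z hz => by rw [dv_eq_zero hz, mul_zero],
    setIntegral_eq_rightOf hs hsε fun z hz => by
      rw [image_eq_zero_of_notMem_tsupport hz, mul_zero],
    H.weak_rightOf he h hc hε, add_eq_right]
  refine integral_eq_zero_of_ae (ae_of_all _ fun v => ?_)
  have : ((ε, v) : ℝ × ℝ) ∉ tsupport ψ := fun h0 => lt_irrefl ε (hsε h0).1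
  simp [image_eq_zero_of_notMem_tsupport this]

theorem HasKinDerivs.isWeakSolutionIn {u ux uv uvv : ℝ × ℝ → ℝ} (H : HasKinDerivs u ux uv uvv)
    (he : ∀ z ∈ halfPlane, z.2 * ux z - uvv z = 0) {Q : Set (ℝ × ℝ)} (hQ : Q ⊆ halfPlane)
    (hu : IsLocL2 Q u) (huv : IsLocL2 Q uv) : IsWeakSolutionIn Q (fun _ => 0) u :=
  ⟨uv, hu, huv, H.isWeakDerivV hQ, fun _ h hc hs => H.weak_interior he hQ h hc hs⟩

theorem integrableOn_mul_of_isLocL2 {Q : Set (ℝ × ℝ)} (hQ : MeasurableSet Q)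
    {k θ : ℝ × ℝ → ℝ} (hk : IsLocL2 Q k) (hθ : Continuous θ) (hc : HasCompactSupport θ) :
    IntegrableOn (fun z => k z * θ z) Q := by
  obtain ⟨R, hR⟩ := (IsCompact.isBounded hc).subset_closedBall 0
  have : IsFiniteMeasure (volume.restrict (Q ∩ Metric.closedBall (0 : ℝ × ℝ) R)) :=
    ⟨by
      rw [Measure.restrict_apply_univ]
      exact (measure_mono Set.inter_subset_right).trans_lt measure_closedBall_lt_top⟩
  obtain ⟨C, hC⟩ := hc.exists_bound_of_continuous hθ
  have h1 : Integrable (fun z => k z * θ z)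
      (volume.restrict (Q ∩ Metric.closedBall (0 : ℝ × ℝ) R)) :=
    (hk R).integrable_mul (MemLp.of_bound (p := 2) hθ.aestronglyMeasurable C (ae_of_all _ hC))
  refine IntegrableOn.of_forall_sdiff_eq_zero h1 hQ fun z hz => ?_
  have : z ∉ tsupport θ := fun h0 => hz.2 ⟨hz.1, hR h0⟩
  rw [image_eq_zero_of_notMem_tsupport this, mul_zero]

theorem tendsto_setIntegral_rightOf {G : ℝ × ℝ → ℝ} (hG : IntegrableOn G halfPlane) :
    Tendsto (fun n : ℕ => ∫ z in rightOf (1 / ((n : ℝ) + 1)), G z) atTop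
      (𝓝 (∫ z in halfPlane, G z)) := by
  have hU : (⋃ n : ℕ, rightOf (1 / ((n : ℝ) + 1))) = halfPlane := by
    ext z
    simp only [Set.mem_iUnion]
    constructor
    · rintro ⟨n, hn⟩
      exact rightOf_subset_halfPlane (by positivity) hn
    · intro hz
      obtain ⟨n, hn⟩ := exists_nat_one_div_lt (show 0 < z.1 from hz)
      exact ⟨n, hn, trivial⟩
  rw [← hU] at hG ⊢
  refine tendsto_setIntegral_of_monotone (fun n => measurableSet_rightOf _) ?_ hG
  intro m n hmn z hz
  exact ⟨show 1 / ((n : ℝ) + 1) < z.1 from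
    lt_of_le_of_lt (Nat.one_div_le_one_div hmn) hz.1, trivial⟩

/-- The boundary terms converge by dominated convergence; on `v < 0` they vanish in the limit
because the test function does. -/
theorem tendsto_boundary_integral {u : ℝ × ℝ → ℝ} {g : ℝ → ℝ} (hu : ContinuousOn u halfPlane)
    (hbd : ∀ R : ℝ, ∃ C, ∀ z ∈ halfPlane, ‖z‖ ≤ R → |u z| ≤ C)
    (hb : ∀ v : ℝ, 0 < v → Tendsto u (𝓝[halfPlane] (0, v)) (𝓝 (g v)))
    (h : Continuous ψ) (hc : HasCompactSupport ψ) (hs : ∀ z ∈ tsupport ψ, z.1 = 0 → 0 ≤ z.2) :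
    Tendsto (fun n : ℕ => ∫ v, u (1 / ((n : ℝ) + 1), v) * ψ (1 / ((n : ℝ) + 1), v) * v) atTop
      (𝓝 (∫ v in Set.Ioi (0 : ℝ), g v * ψ (0, v) * v)) := by
  obtain ⟨R, hR⟩ := (IsCompact.isBounded hc).subset_closedBall 0
  obtain ⟨C, hC⟩ := hbd (max R 1)
  obtain ⟨B, hB⟩ := hc.exists_bound_of_continuous h
  have hpos : ∀ n : ℕ, (0 : ℝ) < 1 / ((n : ℝ) + 1) := fun n => by positivity
  have hlim : ∀ v : ℝ, Tendsto (fun n : ℕ => ((1 / ((n : ℝ) + 1), v) : ℝ × ℝ)) atTop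
      (𝓝[halfPlane] (0, v)) := fun v =>
    tendsto_nhdsWithin_iff.2 ⟨tendsto_one_div_add_atTop_nhds_zero_nat.prodMk_nhds
      tendsto_const_nhds, Eventually.of_forall hpos⟩
  rw [← integral_indicator measurableSet_Ioi]
  refine tendsto_integral_of_dominated_convergence
    ((Set.Icc (-R) R).indicator fun _ => |C| * |B| * |R|) (fun n => ?_) ?_ (fun n => ?_) ?_
  · have c1 : Continuous fun v => u (1 / ((n : ℝ) + 1), v) :=
      hu.comp_continuous (by fun_prop) fun _ => hpos n
    have c2 : Continuous fun v => ψ (1 / ((n : ℝ) + 1), v) := h.comp (by fun_prop)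
    exact ((c1.mul c2).mul continuous_id).aestronglyMeasurable
  · exact (integrable_indicator_iff measurableSet_Icc).2
      (integrableOn_const (by simp))
  · refine ae_of_all _ fun v => ?_
    by_cases hz : ((1 / ((n : ℝ) + 1), v) : ℝ × ℝ) ∈ tsupport ψ
    · have hn := mem_closedBall_zero_iff.1 (hR hz)
      have hv : |v| ≤ R := (le_max_right _ _).trans hn
      have hu1 := hC _ (hpos n) (hn.trans (le_max_left R 1))
      rw [Set.indicator_of_mem (show v ∈ Set.Icc (-R) R from abs_le.1 hv), norm_mul, norm_mul]
      have h1 := hB (1 / ((n : ℝ) + 1), v)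
      gcongr
      · exact hu1.trans (le_abs_self C)
      · exact h1.trans (le_abs_self B)
      · exact hv.trans (le_abs_self R)
    · rw [image_eq_zero_of_notMem_tsupport hz]
      simp only [mul_zero, zero_mul, norm_zero]
      exact Set.indicator_nonneg (fun _ _ => by positivity) v
  · refine ae_of_all _ fun v => ?_
    have hψ : Tendsto (fun n : ℕ => ψ (1 / ((n : ℝ) + 1), v)) atTop (𝓝 (ψ (0, v))) :=
      (h.tendsto (0, v)).comp ((hlim v).mono_right nhdsWithin_le_nhds)
    rcases lt_trichotomy v 0 with hv | hv | hv
    · have h0 : ψ (0, v) = 0 :=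
        image_eq_zero_of_notMem_tsupport fun hz => absurd (hs _ hz rfl) (not_le.2 hv)
      rw [Set.indicator_of_notMem (by simpa using hv.le)]
      obtain ⟨D, hD⟩ := hbd (max 1 |v|)
      rw [h0] at hψ
      have hz : Tendsto (fun n : ℕ => u (1 / ((n : ℝ) + 1), v) * ψ (1 / ((n : ℝ) + 1), v))
          atTop (𝓝 0) := by
        have h1 := hψ.norm.const_mul |D|
        rw [norm_zero, mul_zero] at h1
        refine squeeze_zero_norm (fun n => ?_) h1
        rw [norm_mul]
        gcongr
        refine (hD _ (hpos n) ?_).trans (le_abs_self D)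
        refine max_le_max ?_ le_rfl
        simp only
        rw [Real.norm_of_nonneg (hpos n).le, div_le_one (by positivity)]
        linarith [(Nat.cast_nonneg n : (0 : ℝ) ≤ n)]
      have h2 := hz.mul_const v
      rwa [zero_mul] at h2
    · subst hv
      simp
    · rw [Set.indicator_of_mem (show v ∈ Set.Ioi 0 from hv)]
      exact (((hb v hv).comp (hlim v)).mul hψ).mul_const v

/-- A classical solution which is bounded near the boundary and whose `v`-derivative is locally
square integrable up to the boundary is a weak solution. -/
theorem HasKinDerivs.isWeakSolution {u ux uv uvv F : ℝ × ℝ → ℝ} {g : ℝ → ℝ}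
    (H : HasKinDerivs u ux uv uvv) (hF : Continuous F)
    (he : ∀ z ∈ halfPlane, z.2 * ux z - uvv z = F z)
    (hbd : ∀ R : ℝ, ∃ C, ∀ z ∈ halfPlane, ‖z‖ ≤ R → |u z| ≤ C)
    (hb : ∀ v : ℝ, 0 < v → Tendsto u (𝓝[halfPlane] (0, v)) (𝓝 (g v)))
    (hu : IsLocL2 halfPlane u) (huv : IsLocL2 halfPlane uv) : IsWeakSolution F g u := by
  refine ⟨uv, hu, huv, H.isWeakDerivV subset_rfl, fun ψ h hc hs => ?_⟩
  have i1 : IntegrableOn (fun z => u z * (z.2 * dx ψ z)) halfPlane :=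
    integrableOn_mul_of_isLocL2 measurableSet_halfPlane hu
    (continuous_snd.mul (continuous_dx h)) (hasCompactSupport_dx hc).mul_left
  have i2 := integrableOn_mul_of_isLocL2 measurableSet_halfPlane huv (continuous_dv h)
    (hasCompactSupport_dv hc)
  have i3 : IntegrableOn (fun z => F z * ψ z) halfPlane :=
    ((hF.mul h.continuous).integrable_of_hasCompactSupport hc.mul_left).integrableOn
  have l1 := ((tendsto_setIntegral_rightOf i1).neg).add (tendsto_setIntegral_rightOf i2)
  have l2 := (tendsto_boundary_integral H.cont hbd hb h.continuous hc hs).add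
    (tendsto_setIntegral_rightOf i3)
  exact tendsto_nhds_unique (l1.congr fun n => H.weak_rightOf he h hc (by positivity)) l2

end TestFunctions

theorem isLocL2_of_bound {Q : Set (ℝ × ℝ)} (hQ : MeasurableSet Q) {k : ℝ × ℝ → ℝ}
    (hk : ContinuousOn k Q) (hbd : ∀ R : ℝ, ∃ C, ∀ z ∈ Q, ‖z‖ ≤ R → |k z| ≤ C) : IsLocL2 Q k := by
  intro R
  obtain ⟨C, hC⟩ := hbd R
  have hm : MeasurableSet (Q ∩ Metric.closedBall (0 : ℝ × ℝ) R) :=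
    hQ.inter Metric.isClosed_closedBall.measurableSet
  have : IsFiniteMeasure (volume.restrict (Q ∩ Metric.closedBall (0 : ℝ × ℝ) R)) :=
    ⟨by
      rw [Measure.restrict_apply_univ]
      exact (measure_mono Set.inter_subset_right).trans_lt measure_closedBall_lt_top⟩
  refine MemLp.of_bound ((hk.mono Set.inter_subset_left).aestronglyMeasurable hm) C
    ((ae_restrict_iff' hm).2 (ae_of_all _ fun z hz => hC z hz.1 (mem_closedBall_zero_iff.1 hz.2)))

theorem memLp_two_rpow (R : ℝ) :
    MemLp (fun x : ℝ => x ^ (-(1 / 6) : ℝ)) 2 (volume.restrict (Set.Ioc 0 |R|)) := by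
  have hint : ∀ r : ℝ, -1 < r → IntegrableOn (fun x : ℝ => x ^ r) (Set.Ioc 0 |R|) := fun r hr =>
    (intervalIntegrable_iff_integrableOn_Ioc_of_le (abs_nonneg R)).1
      (intervalIntegral.intervalIntegrable_rpow' hr)
  have hm1 : AEStronglyMeasurable (fun x : ℝ => x ^ (-(1 / 6) : ℝ))
      (volume.restrict (Set.Ioc 0 |R|)) := (hint _ (by norm_num)).aestronglyMeasurable
  rw [memLp_two_iff_integrable_sq hm1]
  refine (hint (-(1 / 3)) (by norm_num)).congr_fun (fun x hx => ?_) measurableSet_Ioc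
  have hx0 : 0 ≤ x := hx.1.le
  have e : (x ^ (-(1 / 6) : ℝ)) ^ 2 = x ^ (-(1 / 3) : ℝ) := by
    rw [← Real.rpow_natCast, ← Real.rpow_mul hx0]
    norm_num
  exact e.symm

theorem memLp_two_fst (C R : ℝ) :
    MemLp (fun z : ℝ × ℝ => C * (1 + z.1 ^ (-(1 / 6) : ℝ))) 2
      (volume.restrict (Set.Ioc 0 |R| ×ˢ Set.Icc (-|R|) |R|)) := by
  have h2 : MemLp (fun x : ℝ => C * (1 + x ^ (-(1 / 6) : ℝ))) 2
      (volume.restrict (Set.Ioc 0 |R|)) := by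
    have h0 : MemLp (fun _ : ℝ => (1 : ℝ)) 2 (volume.restrict (Set.Ioc 0 |R|)) := memLp_const 1
    have h1 := (h0.add (memLp_two_rpow R)).const_mul C
    exact h1
  rw [Measure.volume_eq_prod, ← Measure.prod_restrict]
  exact h2.comp_fst _

/-- A function bounded by `C (1 + x ^ (-1 / 6))` on bounded parts of the half-plane is locally
square integrable up to the boundary. -/
theorem isLocL2_of_bound_rpow {k : ℝ × ℝ → ℝ} (hk : ContinuousOn k halfPlane)
    (hbd : ∀ R : ℝ, ∃ C, ∀ z ∈ halfPlane, ‖z‖ ≤ R → |k z| ≤ C * (1 + z.1 ^ (-(1 / 6) : ℝ))) :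
    IsLocL2 halfPlane k := by
  intro R
  obtain ⟨C, hC⟩ := hbd R
  have hm : MeasurableSet (halfPlane ∩ Metric.closedBall (0 : ℝ × ℝ) R) :=
    measurableSet_halfPlane.inter Metric.isClosed_closedBall.measurableSet
  have hsub : halfPlane ∩ Metric.closedBall (0 : ℝ × ℝ) R ⊆
      Set.Ioc 0 |R| ×ˢ Set.Icc (-|R|) |R| := by
    intro z hz
    have hn := mem_closedBall_zero_iff.1 hz.2
    have h1 : |z.1| ≤ |R| := ((le_max_left _ _).trans hn).trans (le_abs_self R)
    have h2 : |z.2| ≤ |R| := ((le_max_right _ _).trans hn).trans (le_abs_self R)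
    exact ⟨⟨hz.1, (le_abs_self _).trans h1⟩, abs_le.1 h2⟩
  have h4 : AEStronglyMeasurable k
      (volume.restrict (halfPlane ∩ Metric.closedBall (0 : ℝ × ℝ) R)) :=
    (hk.mono Set.inter_subset_left).aestronglyMeasurable hm
  refine MemLp.mono' ((memLp_two_fst C R).mono_measure (Measure.restrict_mono hsub le_rfl)) h4 ?_
  rw [ae_restrict_iff' hm]
  exact ae_of_all _ fun z hz => hC z hz.1 (mem_closedBall_zero_iff.1 hz.2)

section AdmissibleProfiles

variable {lam L : ℝ} {f : ℝ → ℝ}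

theorem rpow_one_third_add_abs_le {z : ℝ × ℝ} (hz : z ∈ halfPlane) {R : ℝ} (hR : ‖z‖ ≤ R) :
    z.1 ^ (1 / 3 : ℝ) + |z.2| ≤ R ^ (1 / 3 : ℝ) + R := by
  have hx : 0 < z.1 := hz
  have h1 : z.1 ≤ R := (le_abs_self _).trans ((le_max_left _ _).trans hR)
  have h2 : |z.2| ≤ R := (le_max_right _ _).trans hR
  gcongr

theorem IsAdmissibleProfile.exists_bound (hf : IsAdmissibleProfile lam L f) (hl : 0 ≤ lam) (R : ℝ) :
    ∃ C, ∀ z ∈ halfPlane, ‖z‖ ≤ R → |selfSim lam f z| ≤ C := by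
  obtain ⟨C, hC, h⟩ := hf.abs_selfSim_le
  refine ⟨C * (R ^ (1 / 3 : ℝ) + R) ^ (3 * lam), fun z hz hR => (h z hz).trans ?_⟩
  have hx : 0 < z.1 := hz
  have := rpow_one_third_add_abs_le hz hR
  gcongr

/-- The `v`-derivative has degree `3 * lam - 1 ≥ -1 / 2`, so that near the origin it is at most of order
`x ^ (-1 / 6)`, which is locally square integrable. -/
theorem IsAdmissibleProfile.exists_bound_deriv (hf : IsAdmissibleProfile lam L f)
    (hl : 1 / 6 ≤ lam) (R : ℝ) :
    ∃ C, ∀ z ∈ halfPlane, ‖z‖ ≤ R →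
      |selfSim (lam - 1 / 3) (deriv f) z| ≤ C * (1 + z.1 ^ (-(1 / 6) : ℝ)) := by
  obtain ⟨C, hC, h⟩ := hf.abs_selfSim_deriv_le
  refine ⟨C * (1 + (R ^ (1 / 3 : ℝ) + R)) ^ (3 * lam - 1 / 2), fun z hz hR => (h z hz).trans ?_⟩
  have hx : 0 < z.1 := hz
  have hx3 : 0 < z.1 ^ (1 / 3 : ℝ) := by positivity
  have h1 := rpow_one_third_add_abs_le hz hR
  have h2 : (z.1 ^ (1 / 3 : ℝ) + |z.2|) ^ (-(1 / 2) : ℝ) ≤ z.1 ^ (-(1 / 6) : ℝ) := by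
    have e : z.1 ^ (-(1 / 6) : ℝ) = (z.1 ^ (1 / 3 : ℝ)) ^ (-(1 / 2) : ℝ) := by
      rw [← Real.rpow_mul hx.le]
      norm_num
    rw [e]
    exact Real.rpow_le_rpow_of_nonpos hx3 (le_add_of_nonneg_right (abs_nonneg _)) (by norm_num)
  have h3 : (z.1 ^ (1 / 3 : ℝ) + |z.2|) ^ (3 * lam - 1 / 2) ≤
      (1 + (R ^ (1 / 3 : ℝ) + R)) ^ (3 * lam - 1 / 2) :=
    Real.rpow_le_rpow (by positivity) (by linarith) (by linarith)
  have hρ : 0 < z.1 ^ (1 / 3 : ℝ) + |z.2| := by positivity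
  rw [show 3 * lam - 1 = (3 * lam - 1 / 2) + -(1 / 2) by ring, Real.rpow_add hρ, mul_assoc]
  have hB : 0 ≤ (1 + (R ^ (1 / 3 : ℝ) + R)) ^ (3 * lam - 1 / 2) :=
    le_trans (by positivity) h3
  gcongr
  linarith

theorem IsAdmissibleProfile.isLocL2 (hf : IsAdmissibleProfile lam L f) (hl : 0 ≤ lam) :
    IsLocL2 halfPlane (selfSim lam f) :=
  isLocL2_of_bound measurableSet_halfPlane hf.isProfile.hasKinDerivs.cont (hf.exists_bound hl)

theorem IsAdmissibleProfile.isLocL2_deriv (hf : IsAdmissibleProfile lam L f) (hl : 1 / 6 ≤ lam) :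
    IsLocL2 halfPlane (selfSim (lam - 1 / 3) (deriv f)) :=
  isLocL2_of_bound_rpow hf.isProfile.hasKinDerivs.cont_v (hf.exists_bound_deriv hl)

theorem IsAdmissibleProfile.isWeakSolution_of_eq (hf : IsAdmissibleProfile lam L f)
    (hl : 1 / 6 ≤ lam) {h : ℝ × ℝ → ℝ} (he : ∀ z ∈ halfPlane, h z = selfSim lam f z) :
    IsWeakSolution (fun _ => 0) (fun v => L * v ^ (3 * lam)) h := by
  have hl0 : 0 ≤ lam := by linarith
  refine (hf.isProfile.hasKinDerivs.congr he).isWeakSolution continuous_const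
    (fun z hz => selfSim_equation lam f hz) (fun R => ?_) (fun v hv => ?_) ?_ (hf.isLocL2_deriv hl)
  · obtain ⟨C, hC⟩ := hf.exists_bound hl0 R
    exact ⟨C, fun z hz hR => by rw [he z hz]; exact hC z hz hR⟩
  · refine (tendsto_selfSim_boundary hf.tendsto hv).congr' ?_
    filter_upwards [self_mem_nhdsWithin] with z hz using (he z hz).symm
  · intro R
    refine (hf.isLocL2 hl0 R).ae_eq ?_
    refine (ae_restrict_iff' (measurableSet_halfPlane.inter
      Metric.isClosed_closedBall.measurableSet)).2 (ae_of_all _ fun z hz => (he z hz.1).symm)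

/-- Away from the origin the self-similar solutions are bounded whatever the sign of the degree. -/
theorem IsAdmissibleProfile.isWeakSolutionIn_of_eq (hf : IsAdmissibleProfile lam L f)
    {h : ℝ × ℝ → ℝ} (he : ∀ z ∈ halfPlane, h z = selfSim lam f z) {Q : Set (ℝ × ℝ)}
    (hQ : MeasurableSet Q) (hQ2 : Q ⊆ halfPlane) {δ : ℝ} (hδ : 0 < δ)
    (hQ3 : ∀ z ∈ Q, δ ≤ z.1 ^ (1 / 3 : ℝ) + |z.2|) : IsWeakSolutionIn Q (fun _ => 0) h := by
  have key : ∀ (p C : ℝ) (k : ℝ × ℝ → ℝ), ContinuousOn k halfPlane → 0 ≤ C →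
      (∀ z ∈ halfPlane, |k z| ≤ C * (z.1 ^ (1 / 3 : ℝ) + |z.2|) ^ p) → IsLocL2 Q k := by
    intro p C k hk hC hb
    refine isLocL2_of_bound hQ (hk.mono hQ2) fun R => ?_
    refine ⟨C * ((R ^ (1 / 3 : ℝ) + R) ^ p + δ ^ p), fun z hz hR => (hb z (hQ2 hz)).trans ?_⟩
    have h1 := rpow_one_third_add_abs_le (hQ2 hz) hR
    have h2 := hQ3 z hz
    gcongr
    rcases le_total 0 p with hp | hp
    · have := Real.rpow_le_rpow (hδ.le.trans h2) h1 hp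
      have := Real.rpow_nonneg hδ.le p
      linarith
    · have := Real.rpow_le_rpow_of_nonpos hδ h2 hp
      have := Real.rpow_nonneg (hδ.le.trans (h2.trans h1)) p
      linarith
  have H := hf.isProfile.hasKinDerivs.congr he
  obtain ⟨C, hC, hb⟩ := hf.abs_selfSim_le
  obtain ⟨D, hD, hb'⟩ := hf.abs_selfSim_deriv_le
  exact H.isWeakSolutionIn (fun z hz => selfSim_equation lam f hz) hQ2
    (key _ C h H.cont hC fun z hz => by rw [he z hz]; exact hb z hz)
    (key _ D _ H.cont_v hD hb')

end AdmissibleProfiles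

theorem isAdmissibleProfile_phi (m : ℤ) :
    IsAdmissibleProfile (lamExp m) 0 (fun t => cSign m * profU (-lamExp m) t) := by
  have := (isAdmissibleProfile_profU_lamExp m).const_mul (cSign m)
  rwa [mul_zero] at this

theorem isKinHomogeneous_of_eq_selfSim {lam : ℝ} {f : ℝ → ℝ} {h : ℝ × ℝ → ℝ}
    (he : ∀ z ∈ halfPlane, h z = selfSim lam f z) : IsKinHomogeneous (3 * lam) h := by
  intro r hr z hz
  have hx : 0 < z.1 := hz
  have hz2 : (r ^ 3 * z.1, r * z.2) ∈ halfPlane := show 0 < r ^ 3 * z.1 by positivity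
  rw [he _ hz2, he _ hz]
  exact selfSim_homogeneous lam f r hr z hz

theorem phi_isKinHomogeneous (m : ℤ) : IsKinHomogeneous (3 * lamExp m) (phi m) :=
  isKinHomogeneous_of_eq_selfSim fun _ hz => phi_eq_selfSim m hz

theorem phi_isClassicalSolution (m : ℤ) :
    IsClassicalSolution (fun _ => 0) (fun _ => 0) (phi m) := by
  have hf := isAdmissibleProfile_phi m
  refine (hf.isProfile.hasKinDerivs.congr fun z hz => phi_eq_selfSim m hz).isClassicalSolution
    (fun z hz => selfSim_equation _ _ hz) fun v hv => ?_
  have h1 := tendsto_selfSim_boundary hf.tendsto hv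
  rw [zero_mul] at h1
  refine h1.congr' ?_
  filter_upwards [self_mem_nhdsWithin] with z hz using (phi_eq_selfSim m hz).symm

theorem phi_isWeakSolution {m : ℤ} (hm : 0 ≤ m) :
    IsWeakSolution (fun _ => 0) (fun _ => 0) (phi m) := by
  have hl : 1 / 6 ≤ lamExp m := by
    have : (0 : ℝ) ≤ m := by exact_mod_cast hm
    rw [lamExp]
    linarith
  have := (isAdmissibleProfile_phi m).isWeakSolution_of_eq hl fun z hz => phi_eq_selfSim m hz
  simpa using this

theorem phi_isWeakSolutionIn (m : ℤ) {R : ℝ} (hR : 0 < R) :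
    IsWeakSolutionIn {z | 1 / R ^ 3 < z.1 ∨ (0 < z.1 ∧ z.2 < -(1 / R))} (fun _ => 0) (phi m) := by
  have hpos : ∀ z ∈ {z : ℝ × ℝ | 1 / R ^ 3 < z.1 ∨ (0 < z.1 ∧ z.2 < -(1 / R))}, 0 < z.1 := by
    rintro z (h | h)
    · exact lt_trans (by positivity) h
    · exact h.1
  refine (isAdmissibleProfile_phi m).isWeakSolutionIn_of_eq (fun z hz => phi_eq_selfSim m hz)
    ?_ hpos (δ := 1 / R) (by positivity) fun z hz => ?_
  · exact (measurableSet_lt measurable_const measurable_fst).union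
      ((measurableSet_lt measurable_const measurable_fst).inter
        (measurableSet_lt measurable_snd measurable_const))
  · have hx : 0 < z.1 := hpos z hz
    have hx3 : 0 < z.1 ^ (1 / 3 : ℝ) := by positivity
    rcases hz with h | h
    · have h1 : 1 / R ≤ z.1 ^ (1 / 3 : ℝ) := by
        have e : 1 / R = (1 / R ^ 3) ^ (1 / 3 : ℝ) := by
          rw [← one_div_pow, ← Real.rpow_natCast, ← Real.rpow_mul (by positivity)]
          norm_num
        rw [e]
        exact Real.rpow_le_rpow (by positivity) h.le (by norm_num)
      linarith [abs_nonneg z.2]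
    · linarith [neg_le_abs z.2, h.2]

/-! ### Polynomial solutions -/

section Polynomials

open MvPolynomial

variable {P p : MvPolynomial (Fin 2) ℝ}

theorem hasDerivAt_polyFun_fst (P : MvPolynomial (Fin 2) ℝ) (x v : ℝ) :
    HasDerivAt (fun y => polyFun P (y, v)) (polyFun (pderiv 0 P) (x, v)) x := by
  unfold polyFun
  induction P using MvPolynomial.induction_on with
  | C a => simpa using hasDerivAt_const x a
  | add p q hp hq =>
    simp only [map_add]
    exact hp.add hq
  | mul_X p i hp =>
    have hX : HasDerivAt (fun y => MvPolynomial.eval ![y, v] (X i : MvPolynomial (Fin 2) ℝ))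
        (MvPolynomial.eval ![x, v] (pderiv 0 (X i : MvPolynomial (Fin 2) ℝ))) x := by
      fin_cases i
      · simpa using hasDerivAt_id' x
      · simpa [pderiv_X] using hasDerivAt_const x v
    simp only [map_mul, Derivation.leibniz, map_add, smul_eq_mul]
    exact (hp.mul hX).congr_deriv (by ring)

theorem hasDerivAt_polyFun_snd (P : MvPolynomial (Fin 2) ℝ) (x v : ℝ) :
    HasDerivAt (fun w => polyFun P (x, w)) (polyFun (pderiv 1 P) (x, v)) v := by
  unfold polyFun
  induction P using MvPolynomial.induction_on with
  | C a => simpa using hasDerivAt_const v a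
  | add p q hp hq =>
    simp only [map_add]
    exact hp.add hq
  | mul_X p i hp =>
    have hX : HasDerivAt (fun w => MvPolynomial.eval ![x, w] (X i : MvPolynomial (Fin 2) ℝ))
        (MvPolynomial.eval ![x, v] (pderiv 1 (X i : MvPolynomial (Fin 2) ℝ))) v := by
      fin_cases i
      · simpa [pderiv_X] using hasDerivAt_const v x
      · simpa using hasDerivAt_id' v
    simp only [map_mul, Derivation.leibniz, map_add, smul_eq_mul]
    exact (hp.mul hX).congr_deriv (by ring)

theorem continuous_polyFun (P : MvPolynomial (Fin 2) ℝ) : Continuous (polyFun P) :=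
  (MvPolynomial.continuous_eval P).comp (by fun_prop)

theorem hasKinDerivs_polyFun (P : MvPolynomial (Fin 2) ℝ) :
    HasKinDerivs (polyFun P) (polyFun (pderiv 0 P)) (polyFun (pderiv 1 P))
      (polyFun (pderiv 1 (pderiv 1 P))) where
  deriv_x x v _ := hasDerivAt_polyFun_fst P x v
  deriv_v x v _ := hasDerivAt_polyFun_snd P x v
  deriv_vv x v _ := hasDerivAt_polyFun_snd _ x v
  cont := (continuous_polyFun _).continuousOn
  cont_x := (continuous_polyFun _).continuousOn
  cont_v := (continuous_polyFun _).continuousOn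
  cont_vv := (continuous_polyFun _).continuousOn

/-- The operator `v ∂ₓ - ∂ᵥᵥ` on polynomials. -/
noncomputable def kinOp : MvPolynomial (Fin 2) ℝ →ₗ[ℝ] MvPolynomial (Fin 2) ℝ :=
  LinearMap.mulLeft ℝ (X 1) ∘ₗ (pderiv (R := ℝ) (0 : Fin 2)).toLinearMap -
    (pderiv (R := ℝ) (1 : Fin 2)).toLinearMap ∘ₗ (pderiv (R := ℝ) (1 : Fin 2)).toLinearMap

theorem kinOp_apply (P : MvPolynomial (Fin 2) ℝ) :
    kinOp P = X 1 * pderiv 0 P - pderiv 1 (pderiv 1 P) := rfl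

theorem polyFun_kinOp (P : MvPolynomial (Fin 2) ℝ) (z : ℝ × ℝ) :
    z.2 * polyFun (pderiv 0 P) z - polyFun (pderiv 1 (pderiv 1 P)) z = polyFun (kinOp P) z := by
  simp [polyFun, kinOp_apply]

theorem isKinHomogPoly_kinOp {k : ℤ} (h : IsKinHomogPoly P k) :
    IsKinHomogPoly (kinOp P) (k - 2) := by
  have h0 : IsKinHomogPoly (pderiv 0 P) (k - 3) :=
    MvPolynomial.IsWeightedHomogeneous.pderiv h (by simp)
  have h1 : IsKinHomogPoly (pderiv 1 P) (k - 1) :=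
    MvPolynomial.IsWeightedHomogeneous.pderiv h (by simp)
  have h2 : IsKinHomogPoly (pderiv 1 (pderiv 1 P)) (k - 2) :=
    MvPolynomial.IsWeightedHomogeneous.pderiv h1 (by simp; ring)
  have hX := isWeightedHomogeneous_X ℝ (![3, 1] : Fin 2 → ℤ) 1
  have h3 := hX.mul h0
  rw [show (![3, 1] : Fin 2 → ℤ) 1 + (k - 3) = k - 2 by simp; ring] at h3
  exact h3.sub h2

theorem isKinHomogPoly_X_pow_mul_X_pow (i j : ℕ) :
    IsKinHomogPoly (X 0 ^ i * X 1 ^ j) (3 * i + j) := by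
  have h := ((isWeightedHomogeneous_X ℝ (![3, 1] : Fin 2 → ℤ) 0).pow i).mul
    ((isWeightedHomogeneous_X ℝ (![3, 1] : Fin 2 → ℤ) 1).pow j)
  rw [show i • (![3, 1] : Fin 2 → ℤ) 0 + j • (![3, 1] : Fin 2 → ℤ) 1 = 3 * i + j by
    simp; ring] at h
  exact h

theorem kinOp_X_pow_mul_X_pow (i j : ℕ) :
    kinOp (X 0 ^ i * X 1 ^ (j + 2)) =
      C (i : ℝ) * (X 0 ^ (i - 1) * X 1 ^ (j + 3)) -
        C (((j : ℝ) + 1) * (j + 2)) * (X 0 ^ i * X 1 ^ j) := by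
  simp only [kinOp_apply, Derivation.leibniz, Derivation.leibniz_pow, pderiv_X_self, map_add,
    pderiv_X_of_ne (show (1 : Fin 2) ≠ 0 by decide), Nat.add_sub_cancel,
    pderiv_X_of_ne (show (0 : Fin 2) ≠ 1 by decide), smul_eq_mul, nsmul_eq_mul, mul_zero, zero_add,
    add_zero, mul_one, map_natCast, Derivation.map_natCast, map_mul, map_one,
    show j + 2 - 1 = j + 1 by omega, map_ofNat]
  push_cast
  ring

/-- Monomials are in the range of `v ∂ₓ - ∂ᵥᵥ`: applied to `x ^ i * v ^ (j + 2)` the operator gives a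
multiple of `x ^ i * v ^ j` and a multiple of `x ^ (i - 1) * v ^ (j + 3)`, of lower degree in `x`. -/
theorem exists_kinOp_eq_X_pow_mul_X_pow (i j : ℕ) :
    ∃ Q, IsKinHomogPoly Q (3 * i + j + 2) ∧ kinOp Q = X 0 ^ i * X 1 ^ j := by
  have hc : ∀ j : ℕ, ((j : ℝ) + 1) * (j + 2) ≠ 0 := fun j => by positivity
  have hhom : ∀ i j : ℕ, IsKinHomogPoly (X 0 ^ i * X 1 ^ (j + 2)) (3 * i + j + 2) := fun i j => by
    have := isKinHomogPoly_X_pow_mul_X_pow i (j + 2)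
    rwa [Nat.cast_add, ← add_assoc] at this
  induction i generalizing j with
  | zero =>
    set c : ℝ := (((j : ℝ) + 1) * (j + 2))⁻¹ with hcdef
    have hc1 : c * (((j : ℝ) + 1) * (j + 2)) = 1 := inv_mul_cancel₀ (hc j)
    refine ⟨C (-c) * (X 0 ^ 0 * X 1 ^ (j + 2)), (hhom 0 j).C_mul _, ?_⟩
    rw [← smul_eq_C_mul, map_smul, kinOp_X_pow_mul_X_pow, smul_eq_C_mul]
    have h1 := congrArg (C : ℝ → MvPolynomial (Fin 2) ℝ) hc1
    simp only [map_mul, map_add, map_one, map_neg, map_natCast, map_ofNat, Nat.cast_zero,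
      map_zero] at h1 ⊢
    linear_combination (X 0 ^ 0 * X 1 ^ j) * h1
  | succ i ih =>
    obtain ⟨Q', hQ', hk⟩ := ih (j + 3)
    set c : ℝ := (((j : ℝ) + 1) * (j + 2))⁻¹ with hcdef
    have hc1 : c * (((j : ℝ) + 1) * (j + 2)) = 1 := inv_mul_cancel₀ (hc j)
    refine ⟨C (-c) * (X 0 ^ (i + 1) * X 1 ^ (j + 2)) + C (c * (i + 1)) * Q',
      ((hhom (i + 1) j).C_mul _).add ?_, ?_⟩
    · have := hQ'.C_mul (c * (i + 1))
      rwa [show (3 * i + (j + 3 : ℕ) + 2 : ℤ) = 3 * (i + 1 : ℕ) + j + 2 by push_cast; ring] at this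
    · rw [← smul_eq_C_mul, ← smul_eq_C_mul, map_add, map_smul, map_smul, kinOp_X_pow_mul_X_pow, hk,
        smul_eq_C_mul, smul_eq_C_mul, Nat.add_sub_cancel]
      have h1 := congrArg (C : ℝ → MvPolynomial (Fin 2) ℝ) hc1
      simp only [map_mul, map_add, map_one, map_neg, map_natCast, map_ofNat, Nat.cast_add,
        Nat.cast_one] at h1 ⊢
      linear_combination (X 0 ^ (i + 1) * X 1 ^ j) * h1

/-- On homogeneous polynomials the operator `v ∂ₓ - ∂ᵥᵥ` is onto. -/
theorem exists_kinOp_eq {k : ℤ} (h : IsKinHomogPoly p (k - 2)) :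
    ∃ Q, IsKinHomogPoly Q k ∧ kinOp Q = p := by
  refine MvPolynomial.IsWeightedHomogeneous.induction_on
    (motive := fun p _ => ∃ Q, IsKinHomogPoly Q k ∧ kinOp Q = p)
    ⟨0, isWeightedHomogeneous_zero _ _ _, map_zero _⟩ ?_ ?_ h
  · rintro p q - - ⟨Q, hQ, rfl⟩ ⟨Q', hQ', rfl⟩
    exact ⟨Q + Q', hQ.add hQ', map_add _ _ _⟩
  · intro d r hd
    obtain ⟨Q, hQ, hk⟩ := exists_kinOp_eq_X_pow_mul_X_pow (d 0) (d 1)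
    rw [Finsupp.weight_apply, Finsupp.sum_fintype _ _ (by simp)] at hd
    simp only [Fin.sum_univ_two, Matrix.cons_val_zero, Matrix.cons_val_one, nsmul_eq_mul,
      mul_one] at hd
    rw [show (3 * d 0 + d 1 + 2 : ℤ) = k by linarith] at hQ
    refine ⟨C r * Q, hQ.C_mul r, ?_⟩
    rw [← smul_eq_C_mul, map_smul, hk, monomial_eq, smul_eq_C_mul,
      Finsupp.prod_fintype _ _ (by simp), Fin.prod_univ_two]

theorem polyFun_mul_pow {k : ℕ} (h : IsKinHomogPoly P k) (r : ℝ) (z : ℝ × ℝ) :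
    polyFun P (r ^ 3 * z.1, r * z.2) = r ^ k * polyFun P z := by
  refine MvPolynomial.IsWeightedHomogeneous.induction_on
    (motive := fun P _ => polyFun P (r ^ 3 * z.1, r * z.2) = r ^ k * polyFun P z) ?_ ?_ ?_ h
  · simp [polyFun]
  · intro p q _ _ hp hq
    simp only [polyFun, map_add] at hp hq ⊢
    rw [hp, hq, mul_add]
  · intro d c hd
    rw [Finsupp.weight_apply, Finsupp.sum_fintype _ _ (by simp)] at hd
    simp only [Fin.sum_univ_two, Matrix.cons_val_zero, Matrix.cons_val_one, nsmul_eq_mul,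
      mul_one] at hd
    have hd2 : k = 3 * d 0 + d 1 := by
      zify
      linarith
    simp only [polyFun, eval_monomial]
    rw [Finsupp.prod_fintype _ _ (by simp), Finsupp.prod_fintype _ _ (by simp)]
    simp only [Fin.prod_univ_two, Matrix.cons_val_zero, Matrix.cons_val_one, hd2, mul_pow, pow_add,
      pow_mul]
    ring

theorem isKinHomogeneous_polyFun {k : ℕ} (h : IsKinHomogPoly P k) :
    IsKinHomogeneous k (polyFun P) := fun r _ z _ => by
  rw [Real.rpow_natCast]
  exact polyFun_mul_pow h r z

theorem polyFun_zero_left {k : ℕ} (h : IsKinHomogPoly P k) (v : ℝ) :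
    polyFun P (0, v) = polyFun P (0, 1) * v ^ k := by
  have := polyFun_mul_pow h v (0, 1)
  simp only [mul_zero, mul_one] at this
  rw [this, mul_comm]

theorem exists_abs_polyFun_le (P : MvPolynomial (Fin 2) ℝ) :
    ∃ (C : ℝ) (N : ℕ), ∀ z, |polyFun P z| ≤ C * (1 + ‖z‖) ^ N := by
  unfold polyFun
  induction P using MvPolynomial.induction_on with
  | C a => exact ⟨|a|, 0, fun z => by simp⟩
  | add p q hp hq =>
    obtain ⟨C, N, h⟩ := hp
    obtain ⟨D, K, h'⟩ := hq
    refine ⟨|C| + |D|, N + K, fun z => ?_⟩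
    have h1 : (1 : ℝ) ≤ 1 + ‖z‖ := le_add_of_nonneg_right (norm_nonneg z)
    have e1 : C * (1 + ‖z‖) ^ N ≤ |C| * (1 + ‖z‖) ^ (N + K) :=
      mul_le_mul (le_abs_self C) (pow_le_pow_right₀ h1 (by omega)) (by positivity) (abs_nonneg C)
    have e2 : D * (1 + ‖z‖) ^ K ≤ |D| * (1 + ‖z‖) ^ (N + K) :=
      mul_le_mul (le_abs_self D) (pow_le_pow_right₀ h1 (by omega)) (by positivity) (abs_nonneg D)
    rw [map_add, add_mul]
    exact (abs_add_le _ _).trans (add_le_add ((h z).trans e1) ((h' z).trans e2))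
  | mul_X p i hp =>
    obtain ⟨C, N, h⟩ := hp
    refine ⟨C, N + 1, fun z => ?_⟩
    have hX : |MvPolynomial.eval ![z.1, z.2] (X i : MvPolynomial (Fin 2) ℝ)| ≤ 1 + ‖z‖ := by
      have h1 : |z.1| ≤ ‖z‖ := le_max_left _ _
      have h2 : |z.2| ≤ ‖z‖ := le_max_right _ _
      fin_cases i
      · simpa using h1.trans (le_add_of_nonneg_left zero_le_one)
      · simpa using h2.trans (le_add_of_nonneg_left zero_le_one)
    rw [map_mul, abs_mul, pow_succ, ← mul_assoc]
    exact mul_le_mul (h z) hX (abs_nonneg _) ((abs_nonneg _).trans (h z))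

/-- The polynomial `x ^ l * M(-l, b, -v ^ 3 / (9 x))`. -/
noncomputable def kummerPoly (b : ℝ) (l : ℕ) : MvPolynomial (Fin 2) ℝ :=
  ∑ n ∈ Finset.range (l + 1),
    C (kummerCoeff (-l) b n * (-(1 / 9)) ^ n) * (X 0 ^ (l - n) * X 1 ^ (3 * n))

theorem isKinHomogPoly_kummerPoly (b : ℝ) (l : ℕ) : IsKinHomogPoly (kummerPoly b l) (3 * l) := by
  refine MvPolynomial.IsWeightedHomogeneous.sum _ _ _ fun n hn => ?_
  have h := (isKinHomogPoly_X_pow_mul_X_pow (l - n) (3 * n)).C_mul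
    (kummerCoeff (-l) b n * (-(1 / 9)) ^ n)
  have hn' : n ≤ l := Nat.lt_succ_iff.1 (Finset.mem_range.1 hn)
  rwa [show (3 * (l - n : ℕ) + (3 * n : ℕ) : ℤ) = 3 * l by push_cast [hn']; ring] at h

theorem polyFun_kummerPoly (b : ℝ) (l : ℕ) {z : ℝ × ℝ} (hz : z ∈ halfPlane) :
    polyFun (kummerPoly b l) z = z.1 ^ l * kummerM (-l) b (-z.2 ^ 3 / (9 * z.1)) := by
  have hx : z.1 ≠ 0 := ne_of_gt hz
  have h0 : ∀ n ∉ Finset.range (l + 1),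
      kummerCoeff (-l) b n * (-z.2 ^ 3 / (9 * z.1)) ^ n = 0 := fun n hn => by
    have hn' : l < n := by simpa using hn
    rw [kummerCoeff, ascPochhammer_eval_neg_coe_nat_of_lt hn']
    simp
  rw [kummerM_eq_tsum, tsum_eq_sum h0, Finset.mul_sum]
  simp only [polyFun, kummerPoly, map_sum, map_mul, map_pow, eval_C, eval_X]
  refine Finset.sum_congr rfl fun n hn => ?_
  have hn' : n ≤ l := Nat.lt_succ_iff.1 (Finset.mem_range.1 hn)
  obtain ⟨j, rfl⟩ := Nat.exists_eq_add_of_le hn'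
  simp only [Matrix.cons_val_zero, Matrix.cons_val_one, Nat.add_sub_cancel_left, pow_mul]
  rw [show -z.2 ^ 3 / (9 * z.1) = -(1 / 9) * z.2 ^ 3 / z.1 by field_simp, div_pow, mul_pow, pow_add]
  field_simp

/-- The function `ψ_l` is not a polynomial, since `ψ_l(x, 0) = x ^ (l + 2 / 3)`. -/
theorem eq_zero_of_mul_psi_eq_polyFun {l : ℕ} {c : ℝ}
    (h : ∀ z ∈ halfPlane, c * psi l z = polyFun P z) : c = 0 := by
  set q : Polynomial ℝ := MvPolynomial.aeval ![Polynomial.X, 0] P with hq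
  have hev : ∀ x : ℝ, q.eval x = polyFun P (x, 0) := by
    intro x
    rw [hq, polyFun, ← Polynomial.coe_evalRingHom, MvPolynomial.aeval_def, MvPolynomial.hom_eval₂,
      MvPolynomial.eval, MvPolynomial.coe_eval₂Hom]
    congr 1
    · ext; simp
    · funext i
      fin_cases i <;> simp
  have hpsi : ∀ x : ℝ, 0 < x → psi l (x, 0) ^ 3 = x ^ (3 * l + 2) := by
    intro x hx
    simp only [psi]
    rw [zero_pow three_ne_zero, neg_zero, zero_div, kummerM_zero, zero_div, mul_zero, zero_mul,
      add_zero, mul_one, ← Real.rpow_natCast (x ^ _), ← Real.rpow_mul hx.le, ← Real.rpow_natCast x]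
    congr 1
    push_cast
    ring
  -- for `c ≠ 0` the degrees of the two sides differ modulo three
  have heq : q ^ 3 = Polynomial.C (c ^ 3) * Polynomial.X ^ (3 * l + 2) := by
    refine Polynomial.eq_of_infinite_eval_eq _ _ ((Set.Ioi_infinite (0 : ℝ)).mono fun x hx => ?_)
    have hx0 : 0 < x := hx
    simp only [Set.mem_ofPred_eq, Polynomial.eval_pow, Polynomial.eval_mul, Polynomial.eval_C,
      Polynomial.eval_X]
    rw [hev, ← h (x, 0) hx0, mul_pow, hpsi x hx0]
  by_contra hc
  have hd := congrArg Polynomial.natDegree heq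
  rw [Polynomial.natDegree_pow, Polynomial.natDegree_C_mul_X_pow _ _ (pow_ne_zero 3 hc)] at hd
  omega

end Polynomials

theorem noExpGrowth_of_bound {h : ℝ × ℝ → ℝ} {C : ℝ} {N : ℕ}
    (hb : ∀ z ∈ halfPlane, |h z| ≤ C * (1 + ‖z‖) ^ N) : NoExpGrowth h := by
  intro ε hε
  have h1 : Tendsto (fun s : ℝ => 1 + s) atTop atTop := tendsto_atTop_add_const_left _ _ tendsto_id
  have h2 := ((isLittleO_pow_exp_pos_mul_atTop N hε).comp_tendsto h1).bound one_pos
  obtain ⟨R, hR⟩ := eventually_atTop.1 h2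
  refine ⟨|C| * Real.exp ε, R, fun z hz hzR => (hb z hz).trans ?_⟩
  have h3 := hR ‖z‖ hzR
  have h4 : (0 : ℝ) ≤ 1 + ‖z‖ := by positivity
  simp only [Function.comp, Real.norm_eq_abs, abs_pow, abs_of_nonneg h4, Real.abs_exp,
    one_mul] at h3
  calc C * (1 + ‖z‖) ^ N ≤ |C| * Real.exp (ε * (1 + ‖z‖)) :=
        mul_le_mul (le_abs_self C) h3 (by positivity) (abs_nonneg C)
    _ = |C| * Real.exp ε * Real.exp (ε * ‖z‖) := by
        rw [mul_assoc, ← Real.exp_add]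
        ring_nf

theorem noExpGrowth_polyFun (P : MvPolynomial (Fin 2) ℝ) : NoExpGrowth (polyFun P) := by
  obtain ⟨C, N, h⟩ := exists_abs_polyFun_le P
  exact noExpGrowth_of_bound fun z _ => h z

theorem NoExpGrowth.linear_comb {h k : ℝ × ℝ → ℝ} (hh : NoExpGrowth h) (hk : NoExpGrowth k)
    (c : ℝ) : NoExpGrowth fun z => h z + c * k z := by
  intro ε hε
  obtain ⟨C, R, h1⟩ := hh ε hε
  obtain ⟨D, S, h2⟩ := hk ε hε
  refine ⟨C + |c| * D, max R S, fun z hz hR => ?_⟩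
  have e1 := h1 z hz ((le_max_left _ _).trans hR)
  have e2 := mul_le_mul_of_nonneg_left (h2 z hz ((le_max_right _ _).trans hR)) (abs_nonneg c)
  rw [← abs_mul] at e2
  calc _ ≤ |h z| + |c * k z| := abs_add_le _ _
    _ ≤ _ := by linarith

/-! ### Classification of classical solutions -/

theorem one_add_rpow_le_exp {s : ℝ} (hs : 0 ≤ s) (p : ℝ) :
    (1 + s) ^ p ≤ Real.exp (|p| * s) := by
  have h1 : 0 < 1 + s := by linarith
  have h2 : 0 ≤ Real.log (1 + s) := Real.log_nonneg (by linarith)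
  have h3 : Real.log (1 + s) ≤ s := by linarith [Real.log_le_sub_one_of_pos h1]
  rw [Real.rpow_def_of_pos h1]
  refine Real.exp_le_exp.2 ?_
  calc Real.log (1 + s) * p ≤ Real.log (1 + s) * |p| := by gcongr; exact le_abs_self p
    _ ≤ s * |p| := by gcongr
    _ = |p| * s := mul_comm _ _

theorem exists_abs_profU_le_exp (a : ℝ) :
    ∃ C B : ℝ, 0 ≤ C ∧ 0 ≤ B ∧ ∀ t ≤ 0,
      |profU a t| ≤ C * Real.exp (B * |t|) ∧ |deriv (profU a) t| ≤ C * Real.exp (B * |t|) := by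
  obtain ⟨C, hC, h⟩ := exists_abs_profU_le a
  obtain ⟨D, hD, h'⟩ := exists_abs_deriv_profU_le_Iic a
  refine ⟨C + D, |-(3 * a)| + |-(3 * a) - 1|, by positivity, by positivity, fun t ht => ?_⟩
  have e1 := one_add_rpow_le_exp (abs_nonneg t) (-(3 * a))
  have e2 := one_add_rpow_le_exp (abs_nonneg t) (-(3 * a) - 1)
  have e3 : Real.exp (|-(3 * a)| * |t|) ≤
      Real.exp ((|-(3 * a)| + |-(3 * a) - 1|) * |t|) := by
    gcongr
    exact le_add_of_nonneg_right (abs_nonneg _)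
  have e4 : Real.exp (|-(3 * a) - 1| * |t|) ≤
      Real.exp ((|-(3 * a)| + |-(3 * a) - 1|) * |t|) := by
    gcongr
    exact le_add_of_nonneg_left (abs_nonneg _)
  constructor
  · exact (h t ht).trans (mul_le_mul (by linarith) (e1.trans e3) (by positivity) (by positivity))
  · exact (h' t ht).trans (mul_le_mul (by linarith) (e2.trans e4) (by positivity) (by positivity))

theorem profU_ne_zero (a : ℝ) : profU a 0 ≠ 0 ∨ deriv (profU a) 0 ≠ 0 := by
  by_contra! h
  have h3 : Real.Gamma (1 / 3) ≠ 0 := (Real.Gamma_pos_of_pos (by norm_num)).ne'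
  have h4 : Real.Gamma (-(1 / 3)) ≠ 0 := Gamma_ne_zero_of_six_mul (k := -2) (by norm_num) (by omega)
  rw [profU_zero, deriv_profU_zero, neg_eq_zero, div_eq_zero_iff, div_eq_zero_iff, div_eq_zero_iff,
    or_iff_right h3, or_iff_left (by positivity), or_iff_right h4, Real.Gamma_eq_zero_iff,
    Real.Gamma_eq_zero_iff] at h
  obtain ⟨⟨m, hm⟩, n, hn⟩ := h
  have h5 : (1 : ℝ) = 3 * (n - m) := by linarith
  have h6 : (1 : ℤ) = 3 * (n - m) := by exact_mod_cast h5
  omega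

/-- Every profile which is independent of Tricomi's one grows like `exp(|t| ^ 3 / 9)` as
`t → -∞`: the constant `c` in the Wronskian identity `T * f' - T' * f = c * exp(-t ^ 3 / 9)` must
vanish if `f` grows slower. Since nothing is known about `f'`, the identity is used in the form
`(T * f)' = c * exp(-t ^ 3 / 9) + 2 * T' * f`, with the mean value theorem. -/
theorem IsProfileOn.eq_const_mul_profU {a C B R : ℝ} {f : ℝ → ℝ} (hf : IsProfileOn Set.univ a f)
    (hb : ∀ t ≤ -R, |f t| ≤ C * Real.exp (B * |t|)) : ∃ κ, f = fun t => κ * profU a t := by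
  have hU := isProfileOn_profU a
  obtain ⟨c, hc⟩ := hU.wronskian isOpen_univ convex_univ hf
  have hc0 : c = 0 := by
    obtain ⟨D, E, hD, hE, hT⟩ := exists_abs_profU_le_exp a
    by_contra hne
    have hcpos : 0 < |c| := abs_pos.2 hne
    have hKpos : 0 ≤ 4 * (D * |C|) := by positivity
    set K : ℝ := 4 * (D * |C|) with hK
    set G : ℝ := E + |B| with hG
    have hG0 : 0 ≤ G := by positivity
    -- far out on the left, `T * f` and `T' * f` are bounded by `K / 4 * exp(G * |t|)`
    have hbd : ∀ t ≤ -|R|, ∀ y : ℝ, |y| ≤ D * Real.exp (E * |t|) →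
        |y * f t| ≤ D * |C| * Real.exp (G * |t|) := by
      intro t ht y hy
      have h1 : |f t| ≤ |C| * Real.exp (|B| * |t|) := by
        refine (hb t (ht.trans (neg_le_neg (le_abs_self R)))).trans ?_
        gcongr
        · exact le_abs_self C
        · exact le_abs_self B
      rw [abs_mul]
      calc |y| * |f t| ≤ (D * Real.exp (E * |t|)) * (|C| * Real.exp (|B| * |t|)) := by gcongr
        _ = D * |C| * Real.exp (G * |t|) := by
          rw [hG, add_mul, Real.exp_add]
          ring
    have key : ∀ s : ℝ, |R| ≤ s → 0 ≤ s →
        |c| * Real.exp (s ^ 3 / 9) ≤ K * Real.exp (G * (s + 1)) := by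
      intro s hs hs0
      have hd : ∀ t : ℝ, HasDerivAt (fun t => profU a t * f t)
          (c * Real.exp (-t ^ 3 / 9) + 2 * (deriv (profU a) t * f t)) t := by
        intro t
        refine ((hU.1 t trivial).mul (hf.1 t trivial)).congr_deriv ?_
        rw [← hc t trivial, mul_right_comm, ← Real.exp_add]
        rw [show t ^ 3 / 9 + -t ^ 3 / 9 = 0 by ring, Real.exp_zero]
        ring
      obtain ⟨ξ, hξ, hm⟩ := exists_hasDerivAt_eq_slope (fun t => profU a t * f t) _
        (show -(s + 1) < -s by linarith)
        (fun t _ => (hd t).continuousAt.continuousWithinAt) (fun t _ => hd t)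
      rw [show -s - -(s + 1) = 1 by ring, div_one] at hm
      have hest : ∀ t ≤ -s, -(s + 1) ≤ t → ∀ y : ℝ, |y| ≤ D * Real.exp (E * |t|) →
          |y * f t| ≤ D * |C| * Real.exp (G * (s + 1)) := by
        intro t ht ht2 y hy
        refine (hbd t (ht.trans (neg_le_neg hs)) y hy).trans ?_
        gcongr
        rw [abs_of_nonpos (by linarith)]
        linarith
      have e1 := hest (-s) le_rfl (by linarith) _ (hT (-s) (by linarith)).1
      have e2 := hest (-(s + 1)) (by linarith) le_rfl _ (hT (-(s + 1)) (by linarith)).1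
      have e3 := hest ξ hξ.2.le hξ.1.le _ (hT ξ (by linarith [hξ.2])).2
      have e4 : c * Real.exp (-ξ ^ 3 / 9) = profU a (-s) * f (-s) -
          profU a (-(s + 1)) * f (-(s + 1)) - 2 * (deriv (profU a) ξ * f ξ) := by linarith
      have e5 : |c| * Real.exp (s ^ 3 / 9) ≤ |c * Real.exp (-ξ ^ 3 / 9)| := by
        rw [abs_mul, Real.abs_exp]
        gcongr
        have : s ^ 3 ≤ (-ξ) ^ 3 := by
          gcongr
          linarith [hξ.2]
        linarith [show (-ξ) ^ 3 = -ξ ^ 3 by ring]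
      refine e5.trans ?_
      rw [e4, hK]
      rw [abs_le] at e1 e2 e3 ⊢
      constructor <;> linarith [e1.1, e1.2, e2.1, e2.2, e3.1, e3.2]
    -- the cube in the exponent wins as soon as `s ≥ 9 * (2 * G + 1)`
    set s : ℝ := |R| + 9 * (2 * G + 1) + K / |c| with hs
    have hdiv : 0 ≤ K / |c| := by positivity
    have hs1 : 9 * (2 * G + 1) ≤ s := by linarith [abs_nonneg R]
    have hs2 : 1 ≤ s := by linarith
    have h1 := key s (by linarith) (by linarith)
    have h2 : G * (s + 1) + s ≤ s ^ 3 / 9 := by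
      have h3 : s * (9 * (2 * G + 1)) ≤ s * s := by gcongr
      have h4 : s * s ≤ s * s * s := le_mul_of_one_le_right (by positivity) hs2
      have h5 : G ≤ G * s := le_mul_of_one_le_right hG0 hs2
      linarith [show s ^ 3 = s * s * s by ring]
    have h3 : |c| * (Real.exp (G * (s + 1)) * Real.exp s) ≤ K * Real.exp (G * (s + 1)) := by
      rw [← Real.exp_add]
      exact le_trans (by gcongr) h1
    have h4 : |c| * Real.exp s ≤ K := by
      refine le_of_mul_le_mul_right ?_ (Real.exp_pos (G * (s + 1)))
      linarith
    have h5 : K < |c| * Real.exp s := by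
      have h6 : K / |c| + 1 ≤ Real.exp s := by
        linarith [Real.add_one_le_exp s, abs_nonneg R]
      calc K = |c| * (K / |c|) := by field_simp
        _ < |c| * (K / |c| + 1) := by
          gcongr
          linarith
        _ ≤ |c| * Real.exp s := by gcongr
    linarith
  have hW : profU a 0 * deriv f 0 = deriv (profU a) 0 * f 0 := by
    have := hc 0 trivial
    rw [hc0] at this
    have h1 := (mul_eq_zero.1 this).resolve_left (Real.exp_ne_zero _)
    linarith
  have hd : ∀ κ : ℝ, deriv (fun t => κ * profU a t) 0 = κ * deriv (profU a) 0 :=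
    fun κ => ((hU.1 0 trivial).const_mul κ).deriv
  rcases profU_ne_zero a with h0 | h0
  · refine ⟨f 0 / profU a 0, hf.ext (hU.const_mul isOpen_univ _) ?_ ?_⟩
    · field_simp
    · rw [hd]
      field_simp
      linarith
  · refine ⟨deriv f 0 / deriv (profU a) 0, hf.ext (hU.const_mul isOpen_univ _) ?_ ?_⟩
    · field_simp
      linarith
    · rw [hd]
      field_simp

/-- The self-similar solutions with integer kinetic degree and no exponential growth are the
polynomials which result when the series of one of the Kummer functions terminates, and the
functions `ψ_l`. -/
theorem exists_eq_polyFun_add_psi (lam : ℕ) (κ : ℝ) :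
    ∃ (P : MvPolynomial (Fin 2) ℝ) (μ : ℝ), IsKinHomogPoly P lam ∧
      (∀ z ∈ halfPlane, selfSim ((lam : ℝ) / 3) (fun t => κ * profU (-((lam : ℝ) / 3)) t) z =
        polyFun P z + μ * psi (lam / 3) z) ∧
      (lam % 3 = 0 ∨ lam % 3 = 1 → μ = 0) := by
  obtain ⟨l, hl⟩ : ∃ l, lam / 3 = l := ⟨_, rfl⟩
  have hΓ : Real.Gamma (-(l : ℝ)) = 0 := Real.Gamma_neg_nat_eq_zero l
  have hcases : lam = 3 * l ∨ lam = 3 * l + 1 ∨ lam = 3 * l + 2 := by omega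
  rcases hcases with rfl | rfl | rfl
  -- for `lam = 3 * l` and `lam = 3 * l + 1` one of the two coefficients of `profU` has a pole of `Γ`
  -- in its denominator; it vanishes, since Mathlib's `Γ` is zero at its poles
  · refine ⟨MvPolynomial.C (κ * (Real.Gamma (1 / 3) / Real.Gamma (-(l : ℝ) + 1 / 3))) *
      kummerPoly (2 / 3) l, 0, ?_, fun z hz => ?_, fun _ => rfl⟩
    · have := (isKinHomogPoly_kummerPoly (2 / 3) l).C_mul
        (κ * (Real.Gamma (1 / 3) / Real.Gamma (-(l : ℝ) + 1 / 3)))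
      rw [show ((3 * l : ℕ) : ℤ) = 3 * (l : ℤ) by push_cast; ring]
      exact this
    · have hx : 0 < z.1 := hz
      have e := neg_cube_selfSim_var hx z.2
      have hP := polyFun_kummerPoly (2 / 3) l hz
      unfold polyFun at hP ⊢
      rw [map_mul, hP, show ((3 * l : ℕ) : ℝ) / 3 = l by push_cast; ring]
      simp only [selfSim, profU, profE, hΓ, e, Real.rpow_natCast, MvPolynomial.eval_C]
      simp
      ring
  · have hX : IsKinHomogPoly (MvPolynomial.X 1 * kummerPoly (4 / 3) l) ((3 * l + 1 : ℕ) : ℤ) := by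
      have := (MvPolynomial.isWeightedHomogeneous_X ℝ (![3, 1] : Fin 2 → ℤ) 1).mul
        (isKinHomogPoly_kummerPoly (4 / 3) l)
      rwa [show (![3, 1] : Fin 2 → ℤ) 1 + 3 * (l : ℤ) = ((3 * l + 1 : ℕ) : ℤ) by
        simp; ring] at this
    refine ⟨MvPolynomial.C (κ * -(Real.Gamma (-(1 / 3)) / Real.Gamma (-(l + 1 / 3 : ℝ)) /
      9 ^ (1 / 3 : ℝ))) * (MvPolynomial.X 1 * kummerPoly (4 / 3) l), 0, hX.C_mul _,
      fun z hz => ?_, fun _ => rfl⟩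
    have hx : 0 < z.1 := hz
    have hx3 : 0 < z.1 ^ (1 / 3 : ℝ) := by positivity
    have e := neg_cube_selfSim_var hx z.2
    have hP := polyFun_kummerPoly (4 / 3) l hz
    unfold polyFun at hP ⊢
    simp only [map_mul, hP]
    rw [show ((3 * l + 1 : ℕ) : ℝ) / 3 = l + 1 / 3 by push_cast; ring]
    simp only [selfSim, profU, profO, show -((l : ℝ) + 1 / 3) + 1 / 3 = -l by ring, hΓ, e,
      MvPolynomial.eval_C, MvPolynomial.eval_X, Matrix.cons_val_one,
      Matrix.cons_val_fin_one, div_zero, zero_mul, zero_add,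
      add_zero, Real.rpow_add hx, Real.rpow_natCast]
    field_simp
  · refine ⟨0, κ / psiConst l, MvPolynomial.isWeightedHomogeneous_zero _ _ _, fun z hz => ?_,
      by omega⟩
    rw [hl, psi_eq_selfSim l hz, show ((3 * l + 2 : ℕ) : ℝ) / 3 = l + 2 / 3 by push_cast; ring]
    simp only [selfSim, polyFun, map_zero, zero_add]
    have := psiConst_ne_zero l
    field_simp

/-- A homogeneous solution is self-similar, and its trace on the line `x = 1` is a profile. -/
theorem isProfileOn_of_homogeneous {lam : ℝ} {u : ℝ × ℝ → ℝ} {ux uv uvv : ℝ → ℝ}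
    (hu : IsKinHomogeneous (3 * lam) u)
    (h1 : ∀ v, HasDerivAt (fun y => u (y, v)) (ux v) 1)
    (h2 : ∀ v, HasDerivAt (fun w => u (1, w)) (uv v) v) (h3 : ∀ v, HasDerivAt uv (uvv v) v)
    (he : ∀ v, v * ux v - uvv v = 0) :
    IsProfileOn Set.univ (-lam) (fun t => u (1, t)) ∧
      ∀ z ∈ halfPlane, u z = selfSim lam (fun t => u (1, t)) z := by
  have hs : ∀ z ∈ halfPlane, u z = selfSim lam (fun t => u (1, t)) z := by
    intro z hz
    have hx : 0 < z.1 := hz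
    have hx3 : 0 < z.1 ^ (1 / 3 : ℝ) := by positivity
    have h := hu (z.1 ^ (1 / 3 : ℝ)) hx3 (1, z.2 / z.1 ^ (1 / 3 : ℝ)) (show (0 : ℝ) < 1 from one_pos)
    simp only [mul_one, rpow_one_third_pow hx.le, mul_div_cancel₀ _ hx3.ne'] at h
    rw [← Real.rpow_mul hx.le, show 1 / 3 * (3 * lam) = lam by ring] at h
    exact h
  refine ⟨.of_hasDerivAt isOpen_univ (f' := uv) (fun t _ => h2 t) fun t _ => ?_, hs⟩
  have hd : deriv (fun t => u (1, t)) = uv := funext fun t => (h2 t).deriv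
  have h4 := hasDerivAt_selfSim_x (lam := lam) (f := fun t => u (1, t)) one_pos t
    (by rw [hd]; exact h2 _)
  have h5 : HasDerivAt (fun y => u (y, t)) _ 1 := h4.congr_of_eventuallyEq (by
    filter_upwards [lt_mem_nhds (one_pos : (0 : ℝ) < 1)] with y hy using hs (y, t) hy)
  have h6 := (h1 t).unique h5
  simp only [Real.one_rpow, div_one, one_mul, hd] at h6
  refine (h3 t).congr_deriv ?_
  linear_combination -he t + t * h6

/-- The classification in terms of profiles. Only the growth as `v → -∞` enters. -/
theorem exists_eq_of_profile {lam : ℕ} {f : ℝ → ℝ} {C B R : ℝ}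
    (hf : IsProfileOn Set.univ (-((lam : ℝ) / 3)) f)
    (hb : ∀ t ≤ -R, |f t| ≤ C * Real.exp (B * |t|)) :
    ∃ (P : MvPolynomial (Fin 2) ℝ) (μ : ℝ), IsKinHomogPoly P lam ∧
      (∀ z ∈ halfPlane, selfSim ((lam : ℝ) / 3) f z = polyFun P z + μ * psi (lam / 3) z) ∧
      (lam % 3 = 0 ∨ lam % 3 = 1 → μ = 0) := by
  obtain ⟨κ, rfl⟩ := hf.eq_const_mul_profU hb
  exact exists_eq_polyFun_add_psi lam κ

theorem eq_of_polyFun_add_psi_eq {P P' : MvPolynomial (Fin 2) ℝ} {l : ℕ} {μ μ' : ℝ}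
    (h : ∀ z ∈ halfPlane, polyFun P z + μ * psi l z = polyFun P' z + μ' * psi l z) : μ' = μ := by
  refine (sub_eq_zero.1 (eq_zero_of_mul_psi_eq_polyFun (P := P' - P) (l := l) fun z hz => ?_)).symm
  have := h z hz
  rw [polyFun, map_sub]
  unfold polyFun at this
  linarith

/-- The classification of homogeneous classical solutions. Subtracting a polynomial solution of the
inhomogeneous equation leaves a self-similar solution of the homogeneous one. -/
theorem exists_eq_of_isClassicalSolution {lam : ℕ} {p : MvPolynomial (Fin 2) ℝ} {g : ℝ → ℝ}
    {h : ℝ × ℝ → ℝ} (hp : IsKinHomogPoly p ((lam : ℤ) - 2)) (hh : IsKinHomogeneous lam h)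
    (hg : NoExpGrowth h) (hs : IsClassicalSolution (polyFun p) g h) :
    ∃ (P : MvPolynomial (Fin 2) ℝ) (μ : ℝ), IsKinHomogPoly P lam ∧
      (∀ z ∈ halfPlane, h z = polyFun P z + μ * psi (lam / 3) z) ∧
      (lam % 3 = 0 ∨ lam % 3 = 1 → μ = 0) := by
  obtain ⟨Q, hQ, rfl⟩ := exists_kinOp_eq hp
  set u : ℝ × ℝ → ℝ := fun z => h z + (-1) * polyFun Q z with hu
  have hQh := isKinHomogeneous_polyFun hQ
  have hu_hom : IsKinHomogeneous (3 * ((lam : ℝ) / 3)) u := by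
    rw [mul_div_cancel₀ _ (by norm_num)]
    intro r hr z hz
    simp only [hu]
    rw [hh r hr z hz, hQh r hr z hz]
    ring
  obtain ⟨hf, hself⟩ := isProfileOn_of_homogeneous (u := u)
    (ux := fun v => deriv (fun y => h (y, v)) 1 + (-1) * polyFun (MvPolynomial.pderiv 0 Q) (1, v))
    (uv := fun v => deriv (fun w => h (1, w)) v + (-1) * polyFun (MvPolynomial.pderiv 1 Q) (1, v))
    (uvv := fun v => deriv (deriv fun w => h (1, w)) v +
      (-1) * polyFun (MvPolynomial.pderiv 1 (MvPolynomial.pderiv 1 Q)) (1, v)) hu_hom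
    (fun v => (hs.diff_x 1 v one_pos).hasDerivAt.add
      ((hasDerivAt_polyFun_fst Q 1 v).const_mul (-1)))
    (fun v => (hs.diff_v 1 v one_pos).hasDerivAt.add
      ((hasDerivAt_polyFun_snd Q 1 v).const_mul (-1)))
    (fun v => (hs.diff_vv 1 v one_pos).hasDerivAt.add
      ((hasDerivAt_polyFun_snd _ 1 v).const_mul (-1)))
    fun v => by
      have e1 := hs.equation 1 v one_pos
      have e2 := polyFun_kinOp Q (1, v)
      simp only at e2
      linarith
  obtain ⟨C, R, hCR⟩ := hg.linear_comb (noExpGrowth_polyFun Q) (-1) 1 one_pos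
  have hbd : ∀ t ≤ -(max R 1), |u (1, t)| ≤ C * Real.exp (1 * |t|) := by
    intro t ht
    have h1 : 1 ≤ |t| := by linarith [neg_le_abs t, le_max_right R 1]
    have hn : ‖((1, t) : ℝ × ℝ)‖ = |t| := by
      rw [Prod.norm_mk, Real.norm_eq_abs, Real.norm_eq_abs, abs_one, max_eq_right h1]
    have := hCR (1, t) (show (0 : ℝ) < 1 from one_pos)
      (by rw [hn]; linarith [neg_le_abs t, le_max_left R 1])
    rwa [hn] at this
  obtain ⟨P, μ, hP, hPμ, hμ⟩ := exists_eq_of_profile hf hbd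
  refine ⟨P + Q, μ, hP.add hQ, fun z hz => ?_, hμ⟩
  have e1 := hself z hz
  have e2 := hPμ z hz
  have e3 : polyFun (P + Q) z = polyFun P z + polyFun Q z := map_add _ _ _
  rw [e3]
  simp only [hu] at e1 e2
  linarith

/-! ### Polynomials and `ψ_l` as solutions -/

theorem exists_bound_polyFun (P : MvPolynomial (Fin 2) ℝ) (R : ℝ) :
    ∃ C, 0 ≤ C ∧ ∀ z, ‖z‖ ≤ R → |polyFun P z| ≤ C := by
  obtain ⟨C, hC⟩ := (isCompact_closedBall (0 : ℝ × ℝ) R).exists_bound_of_continuousOn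
    (continuous_polyFun P).continuousOn
  exact ⟨|C|, abs_nonneg C, fun z hz =>
    (hC z (mem_closedBall_zero_iff.2 hz)).trans (le_abs_self C)⟩

theorem exists_psi_eq_selfSim (l : ℕ) :
    ∃ (L : ℝ) (f : ℝ → ℝ), IsAdmissibleProfile (l + 2 / 3) L f ∧
      ∀ z ∈ halfPlane, psi l z = selfSim (l + 2 / 3) f z := by
  obtain ⟨L, hL⟩ := isAdmissibleProfile_profU_neg l
  exact ⟨_, _, hL.const_mul (psiConst l), fun z hz => psi_eq_selfSim l hz⟩

theorem rpow_three_mul_add {s : ℝ} (l : ℕ) : s ^ (3 * ((l : ℝ) + 2 / 3)) = s ^ (3 * l + 2) := by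
  rw [← Real.rpow_natCast]
  congr 1
  push_cast
  ring

theorem noExpGrowth_psi (l : ℕ) : NoExpGrowth (psi l) := by
  obtain ⟨L, f, hL, hψf⟩ := exists_psi_eq_selfSim l
  obtain ⟨C, hC, h⟩ := hL.abs_selfSim_le
  refine noExpGrowth_of_bound (C := C * 2 ^ (3 * l + 2)) (N := 3 * l + 2) fun z hz => ?_
  rw [hψf z hz]
  refine (h z hz).trans ?_
  have hx : 0 < z.1 := hz
  have h1 : z.1 ^ (1 / 3 : ℝ) ≤ 1 + ‖z‖ := by
    have hn : z.1 ≤ ‖z‖ := (le_abs_self _).trans (le_max_left _ _)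
    calc z.1 ^ (1 / 3 : ℝ) ≤ (1 + ‖z‖) ^ (1 / 3 : ℝ) := by gcongr; linarith
      _ ≤ (1 + ‖z‖) ^ (1 : ℝ) :=
        Real.rpow_le_rpow_of_exponent_le (by linarith [norm_nonneg z]) (by norm_num)
      _ = 1 + ‖z‖ := Real.rpow_one _
  have h2 : |z.2| ≤ ‖z‖ := le_max_right _ _
  rw [rpow_three_mul_add, mul_assoc, ← mul_pow]
  gcongr
  linarith

theorem psi_isKinHomogeneous (l : ℕ) : IsKinHomogeneous ((3 * l + 2 : ℕ) : ℝ) (psi l) := by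
  have := isKinHomogeneous_of_eq_selfSim fun _ hz => psi_eq_selfSim l hz
  rwa [show 3 * ((l : ℝ) + 2 / 3) = ((3 * l + 2 : ℕ) : ℝ) by push_cast; ring] at this

/-- Every homogeneous polynomial, with a multiple of `ψ_l` added in degree `3 * l + 2`, solves the
in-flow problem with homogeneous polynomial data. -/
theorem polyFun_add_psi_isSolution {lam : ℕ} {P : MvPolynomial (Fin 2) ℝ} {μ : ℝ}
    (hP : IsKinHomogPoly P lam) (hμ : lam % 3 = 0 ∨ lam % 3 = 1 → μ = 0) :
    IsKinHomogeneous lam (fun z => polyFun P z + μ * psi (lam / 3) z) ∧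
      NoExpGrowth (fun z => polyFun P z + μ * psi (lam / 3) z) ∧
      ∃ (p : MvPolynomial (Fin 2) ℝ) (a : ℝ),
        IsKinHomogPoly p ((lam : ℤ) - 2) ∧
        IsClassicalSolution (polyFun p) (fun v => a * v ^ lam)
          (fun z => polyFun P z + μ * psi (lam / 3) z) ∧
        IsWeakSolution (polyFun p) (fun v => a * v ^ lam)
          (fun z => polyFun P z + μ * psi (lam / 3) z) := by
  obtain ⟨l, hl⟩ : ∃ l, lam / 3 = l := ⟨_, rfl⟩
  rw [hl]
  have hμ' : μ = 0 ∨ lam = 3 * l + 2 := by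
    by_cases h : lam % 3 = 2
    · right; omega
    · left; exact hμ (by omega)
  obtain ⟨L, f, hL, hψf⟩ := exists_psi_eq_selfSim l
  have hl6 : (1 / 6 : ℝ) ≤ l + 2 / 3 := by linarith [(Nat.cast_nonneg l : (0 : ℝ) ≤ l)]
  have hψ := hL.isProfile.hasKinDerivs.congr hψf
  have H := (hasKinDerivs_polyFun P).linear_comb hψ μ
  have he : ∀ z ∈ halfPlane, z.2 * (polyFun (MvPolynomial.pderiv 0 P) z +
      μ * selfSim (l + 2 / 3 - 1) (fun t => (l + 2 / 3) * f t - t / 3 * deriv f t) z) -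
      (polyFun (MvPolynomial.pderiv 1 (MvPolynomial.pderiv 1 P)) z + μ * selfSim (l + 2 / 3 - 2 / 3)
        (fun t => (l + 2 / 3) * t * f t - t ^ 2 / 3 * deriv f t) z) = polyFun (kinOp P) z :=
    fun z hz => by
      linear_combination polyFun_kinOp P z + μ * selfSim_equation ((l : ℝ) + 2 / 3) f hz
  have hb : ∀ v : ℝ, 0 < v → Tendsto (fun z => polyFun P z + μ * psi l z)
      (𝓝[halfPlane] (0, v)) (𝓝 ((polyFun P (0, 1) + μ * L) * v ^ lam)) := by
    intro v hv
    have t1 := ((continuous_polyFun P).tendsto (0, v)).mono_left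
      (nhdsWithin_le_nhds (s := halfPlane))
    have t2 : Tendsto (psi l) (𝓝[halfPlane] (0, v)) (𝓝 (L * v ^ (3 * l + 2))) := by
      have := tendsto_selfSim_boundary hL.tendsto hv
      rw [rpow_three_mul_add] at this
      refine this.congr' ?_
      filter_upwards [self_mem_nhdsWithin] with z hz using (hψf z hz).symm
    have t3 := t1.add (t2.const_mul μ)
    rw [polyFun_zero_left hP] at t3
    convert t3 using 2
    rcases hμ' with h | h
    · rw [h]; ring
    · rw [h]; ring
  have hbd : ∀ R : ℝ, ∃ C, ∀ z ∈ halfPlane, ‖z‖ ≤ R → |polyFun P z + μ * psi l z| ≤ C := by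
    intro R
    obtain ⟨C, -, h1⟩ := exists_bound_polyFun P R
    obtain ⟨D, h2⟩ := hL.exists_bound (by linarith) R
    refine ⟨C + |μ| * D, fun z hz hR => (abs_add_le _ _).trans ?_⟩
    rw [abs_mul, hψf z hz]
    exact add_le_add (h1 z hR) (mul_le_mul_of_nonneg_left (h2 z hz hR) (abs_nonneg μ))
  refine ⟨?_, (noExpGrowth_polyFun P).linear_comb (noExpGrowth_psi l) μ, kinOp P,
    polyFun P (0, 1) + μ * L, isKinHomogPoly_kinOp hP, H.isClassicalSolution he hb,
    H.isWeakSolution (continuous_polyFun _) he hbd hb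
      (isLocL2_of_bound measurableSet_halfPlane H.cont hbd)
      (isLocL2_of_bound_rpow H.cont_v fun R => ?_)⟩
  · intro r hr z hz
    have e1 := isKinHomogeneous_polyFun hP r hr z hz
    simp only [e1]
    rcases hμ' with h | h
    · rw [h]; ring
    · have e2 := psi_isKinHomogeneous l r hr z hz
      rw [← h] at e2
      rw [e2]; ring
  · obtain ⟨C, hC, h1⟩ := exists_bound_polyFun (MvPolynomial.pderiv 1 P) R
    obtain ⟨D, h2⟩ := hL.exists_bound_deriv hl6 R
    refine ⟨C + |μ| * D, fun z hz hR => (abs_add_le _ _).trans ?_⟩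
    have hx : 0 < z.1 := hz
    have h3 : (1 : ℝ) ≤ 1 + z.1 ^ (-(1 / 6) : ℝ) := le_add_of_nonneg_right (by positivity)
    rw [abs_mul, add_mul, mul_assoc]
    exact add_le_add ((h1 z hR).trans (le_mul_of_one_le_right hC h3))
      (mul_le_mul_of_nonneg_left (h2 z hz hR) (abs_nonneg μ))

/-! ### Functions which are homogeneous almost everywhere -/

theorem ae_comp_const_mul {p : ℝ → Prop} (h : ∀ᵐ t, p t) {a : ℝ} (ha : a ≠ 0) :
    ∀ᵐ t, p (a * t) := by
  have := (Measure.quasiMeasurePreserving_smul (volume : Measure ℝ) ha).ae h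
  simpa using this

theorem ae_comp_const_mul_prod {p : ℝ × ℝ → Prop} (h : ∀ᵐ z, p z) {a b : ℝ} (ha : a ≠ 0)
    (hb : b ≠ 0) : ∀ᵐ z : ℝ × ℝ, p (a * z.1, b * z.2) := by
  rw [Measure.volume_eq_prod] at h ⊢
  have := (MeasureTheory.QuasiMeasurePreserving.prodMap
    (Measure.quasiMeasurePreserving_smul (volume : Measure ℝ) ha)
    (Measure.quasiMeasurePreserving_smul (volume : Measure ℝ) hb)).ae h
  exact this

/-- The map `r ↦ r ^ 3 * c` carries null sets to null sets. -/
theorem ae_of_ae_pow_three_mul {p : ℝ → Prop} {c : ℝ} (hc : 0 < c)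
    (h : ∀ᵐ r : ℝ, 0 < r → p (r ^ 3 * c)) : ∀ᵐ y : ℝ, 0 < y → p y := by
  rw [ae_iff] at h ⊢
  refine measure_mono_null (fun y hy => ?_)
    (addHaar_image_eq_zero_of_differentiableOn_of_addHaar_eq_zero volume
      (f := fun r : ℝ => r ^ 3 * c) (by fun_prop) h)
  simp only [Set.mem_ofPred_eq, Classical.not_imp] at hy
  have hy0 : 0 < y / c := div_pos hy.1 hc
  have e : ((y / c) ^ (1 / 3 : ℝ)) ^ 3 * c = y := by
    rw [rpow_one_third_pow hy0.le]
    field_simp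
  refine ⟨(y / c) ^ (1 / 3 : ℝ), ?_, e⟩
  simp only [Set.mem_ofPred_eq, Classical.not_imp, e]
  exact ⟨by positivity, hy.2⟩

/-- A function which is homogeneous almost everywhere is self-similar almost everywhere. Its trace
on a line `x = x₀` with `x₀` large enough is bounded by the growth assumption, so that the profile
is locally bounded. -/
theorem exists_ae_eq_selfSim {lam : ℝ} {u : ℝ × ℝ → ℝ} (hm : Measurable u)
    (hu : ∀ r : ℝ, 0 < r → ∀ᵐ z : ℝ × ℝ, 0 < z.1 → u (r ^ 3 * z.1, r * z.2) = r ^ (3 * lam) * u z)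
    {C R : ℝ} (hb : ∀ᵐ z : ℝ × ℝ, 0 < z.1 → R ≤ ‖z‖ → |u z| ≤ C * Real.exp (1 * ‖z‖)) :
    ∃ (f : ℝ → ℝ) (D B : ℝ), Measurable f ∧ (∀ᵐ t, |f t| ≤ D * Real.exp (B * |t|)) ∧
      ∀ᵐ y : ℝ, 0 < y → ∀ᵐ w : ℝ, u (y, w) = selfSim lam f (y, w) := by
  have hp : MeasurableSet {q : ℝ × (ℝ × ℝ) | 0 < q.1 → 0 < q.2.1 →
      u (q.1 ^ 3 * q.2.1, q.1 * q.2.2) = q.1 ^ (3 * lam) * u q.2} := by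
    refine MeasurableSet.imp (measurableSet_lt measurable_const measurable_fst)
      (MeasurableSet.imp (measurableSet_lt measurable_const (by fun_prop)) ?_)
    exact measurableSet_eq_fun (by fun_prop) (by fun_prop)
  have h1 : ∀ᵐ r : ℝ, ∀ᵐ z : ℝ × ℝ, 0 < r → 0 < z.1 →
      u (r ^ 3 * z.1, r * z.2) = r ^ (3 * lam) * u z := by
    refine ae_of_all _ fun r => ?_
    by_cases hr : 0 < r
    · filter_upwards [hu r hr] with z hz _ using hz
    · exact ae_of_all _ fun z h => absurd h hr
  have h2 := (Measure.ae_ae_comm hp).1 h1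
  rw [Measure.volume_eq_prod] at h2 hb
  have h3 := Measure.ae_ae_of_ae_prod h2
  have h4 := Measure.ae_ae_of_ae_prod hb
  -- a line `x = x₀` beyond `R` on which homogeneity and the growth bound hold almost everywhere
  obtain ⟨x₀, ⟨h5, h6⟩, hx₀⟩ := (Measure.dense_of_ae (h3.and h4)).exists_gt (max R 0)
  have hx : 0 < x₀ := (le_max_right R 0).trans_lt hx₀
  have hR : R ≤ x₀ := (le_max_left R 0).trans hx₀.le
  have hk : 0 < x₀ ^ (1 / 3 : ℝ) := by positivity
  have hp2 : MeasurableSet {q : ℝ × ℝ | 0 < q.2 → 0 < x₀ →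
      u (q.2 ^ 3 * x₀, q.2 * q.1) = q.2 ^ (3 * lam) * u (x₀, q.1)} := by
    refine MeasurableSet.imp (measurableSet_lt measurable_const measurable_snd)
      (MeasurableSet.imp (MeasurableSet.const _) ?_)
    exact measurableSet_eq_fun (by fun_prop) (by fun_prop)
  have h7 := (Measure.ae_ae_comm hp2).1 h5
  refine ⟨fun t => x₀ ^ (-lam) * u (x₀, x₀ ^ (1 / 3 : ℝ) * t), x₀ ^ (-lam) * |C| * Real.exp x₀,
    x₀ ^ (1 / 3 : ℝ), by fun_prop, ?_, ?_⟩
  · filter_upwards [ae_comp_const_mul h6 hk.ne'] with t ht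
    have hn1 : x₀ ≤ ‖((x₀, x₀ ^ (1 / 3 : ℝ) * t) : ℝ × ℝ)‖ :=
      (le_abs_self _).trans (le_max_left _ _)
    have hn2 : ‖((x₀, x₀ ^ (1 / 3 : ℝ) * t) : ℝ × ℝ)‖ ≤ x₀ + x₀ ^ (1 / 3 : ℝ) * |t| := by
      rw [Prod.norm_mk, Real.norm_eq_abs, Real.norm_eq_abs, abs_mul, abs_of_pos hx, abs_of_pos hk]
      exact max_le (le_add_of_nonneg_right (by positivity)) (le_add_of_nonneg_left hx.le)
    have h8 := ht hx (hR.trans hn1)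
    rw [abs_mul, abs_of_pos (by positivity), mul_assoc, mul_assoc]
    gcongr
    refine h8.trans ?_
    rw [← Real.exp_add, one_mul]
    exact mul_le_mul (le_abs_self C) (Real.exp_le_exp.2 hn2) (Real.exp_pos _).le (abs_nonneg C)
  · refine ae_of_ae_pow_three_mul hx ?_
    filter_upwards [h7] with r hr h0
    filter_upwards [ae_comp_const_mul hr (inv_ne_zero h0.ne')] with w hw
    have h8 := hw h0 hx
    rw [mul_inv_cancel_left₀ h0.ne'] at h8
    have e1 : (r ^ 3 * x₀) ^ (1 / 3 : ℝ) = r * x₀ ^ (1 / 3 : ℝ) := by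
      rw [Real.mul_rpow (by positivity) hx.le, ← Real.rpow_natCast, ← Real.rpow_mul h0.le]
      norm_num
    have e2 : (r ^ 3 * x₀) ^ lam = r ^ (3 * lam) * x₀ ^ lam := by
      rw [Real.mul_rpow (by positivity) hx.le, ← Real.rpow_natCast, ← Real.rpow_mul h0.le]
      norm_num
    simp only [selfSim]
    rw [h8, e1, e2, show x₀ ^ (1 / 3 : ℝ) * (w / (r * x₀ ^ (1 / 3 : ℝ))) = r⁻¹ * w by field_simp,
      mul_assoc, ← mul_assoc (x₀ ^ lam), ← Real.rpow_add hx, add_neg_cancel, Real.rpow_zero,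
      one_mul]

/-! ### Self-similar test functions -/

section SelfSimilarTest

variable {η χ : ℝ → ℝ}

/-- The test function `η(x) * χ(v / x ^ (1 / 3))`, smooth if `η` is supported away from zero. -/
noncomputable def simTest (η χ : ℝ → ℝ) (z : ℝ × ℝ) : ℝ := η z.1 * χ (z.2 / z.1 ^ (1 / 3 : ℝ))

theorem contDiff_simTest (hη : ContDiff ℝ ∞ η) (hχ : ContDiff ℝ ∞ χ)
    (h0 : ∀ x, x ∉ Set.Icc (1 : ℝ) 3 → η x = 0) : ContDiff ℝ ∞ (simTest η χ) := by
  refine contDiff_iff_contDiffAt.2 fun z => ?_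
  rcases lt_or_ge 0 z.1 with hz | hz
  · have h1 : ContDiffAt ℝ ∞ (fun z : ℝ × ℝ => z.1 ^ (1 / 3 : ℝ)) z :=
      contDiffAt_fst.rpow_const_of_ne hz.ne'
    exact (hη.contDiffAt.comp z contDiffAt_fst).mul
      (hχ.contDiffAt.comp z (contDiffAt_snd.div h1 (Real.rpow_pos_of_pos hz _).ne'))
  · refine (contDiffAt_const (c := (0 : ℝ))).congr_of_eventuallyEq ?_
    filter_upwards [(isOpen_lt continuous_fst continuous_const).mem_nhds
      (show z.1 < 1 by linarith)] with y hy
    rw [simTest, h0 y.1 fun h => not_le.2 hy h.1, zero_mul]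

theorem simTest_eq_zero {M : ℝ} (h0 : ∀ x, x ∉ Set.Icc (1 : ℝ) 3 → η x = 0)
    (hM : ∀ t, M < |t| → χ t = 0) {z : ℝ × ℝ}
    (hz : z ∉ Set.Icc (1 : ℝ) 3 ×ˢ Set.Icc (-(3 * |M|)) (3 * |M|)) : simTest η χ z = 0 := by
  rw [simTest]
  by_cases hx : z.1 ∈ Set.Icc (1 : ℝ) 3
  · have h1 : 3 * |M| < |z.2| := by
      by_contra! h
      exact hz ⟨hx, abs_le.1 h⟩
    have hx0 : 0 < z.1 := lt_of_lt_of_le one_pos hx.1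
    have hx3 : 0 < z.1 ^ (1 / 3 : ℝ) := by positivity
    have h2 : z.1 ^ (1 / 3 : ℝ) ≤ 3 :=
      (Real.rpow_le_rpow_of_exponent_le hx.1 (by norm_num : (1 / 3 : ℝ) ≤ 1)).trans
        (by rw [Real.rpow_one]; exact hx.2)
    have h3 : M < |z.2 / z.1 ^ (1 / 3 : ℝ)| := by
      rw [abs_div, abs_of_pos hx3, lt_div_iff₀ hx3]
      calc M * z.1 ^ (1 / 3 : ℝ) ≤ |M| * 3 := by
            gcongr
            exact le_abs_self M
        _ < |z.2| := by linarith
    rw [hM _ h3, mul_zero]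
  · rw [h0 _ hx, zero_mul]

theorem exists_abs_lt_eq_zero (hχ : HasCompactSupport χ) : ∃ M, ∀ t, M < |t| → χ t = 0 := by
  obtain ⟨M, hM⟩ := (IsCompact.isBounded hχ).subset_closedBall 0
  refine ⟨M, fun t ht => image_eq_zero_of_notMem_tsupport fun h => ?_⟩
  have := mem_closedBall_zero_iff.1 (hM h)
  rw [Real.norm_eq_abs] at this
  linarith

theorem hasCompactSupport_simTest (h0 : ∀ x, x ∉ Set.Icc (1 : ℝ) 3 → η x = 0)
    (hχ : HasCompactSupport χ) : HasCompactSupport (simTest η χ) := by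
  obtain ⟨M, hM⟩ := exists_abs_lt_eq_zero hχ
  exact HasCompactSupport.intro (isCompact_Icc.prod isCompact_Icc) fun z hz =>
    simTest_eq_zero h0 hM hz

theorem tsupport_simTest_subset (h0 : ∀ x, x ∉ Set.Icc (1 : ℝ) 3 → η x = 0) :
    tsupport (simTest η χ) ⊆ halfPlane := by
  have h : tsupport (simTest η χ) ⊆ {z : ℝ × ℝ | 1 ≤ z.1} := by
    refine closure_minimal (fun z hz => ?_) (isClosed_le continuous_const continuous_fst)
    by_contra hlt
    exact hz (by rw [simTest, h0 z.1 fun h => hlt h.1, zero_mul])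
  exact fun z hz => show 0 < z.1 from lt_of_lt_of_le one_pos (h hz)

theorem dx_simTest (hη : ContDiff ℝ ∞ η) (hχ : ContDiff ℝ ∞ χ)
    (h0 : ∀ x, x ∉ Set.Icc (1 : ℝ) 3 → η x = 0) {x : ℝ} (hx : 0 < x) (v : ℝ) :
    dx (simTest η χ) (x, v) = deriv η x * χ (v / x ^ (1 / 3 : ℝ)) -
      η x * (v / x ^ (1 / 3 : ℝ) / 3 * x⁻¹ * deriv χ (v / x ^ (1 / 3 : ℝ))) := by
  refine (hasDerivAt_dx (contDiff_simTest hη hχ h0) x v).unique ?_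
  have h1 := (hη.differentiable (by simp) x).hasDerivAt
  have h2 := (hχ.differentiable (by simp) (v / x ^ (1 / 3 : ℝ))).hasDerivAt
  refine (h1.mul (h2.comp x (hasDerivAt_selfSim_var hx v))).congr_deriv ?_
  simp only [Function.comp]
  ring

theorem dv_simTest (hη : ContDiff ℝ ∞ η) (hχ : ContDiff ℝ ∞ χ)
    (h0 : ∀ x, x ∉ Set.Icc (1 : ℝ) 3 → η x = 0) (x v : ℝ) :
    dv (simTest η χ) (x, v) = η x * (deriv χ (v / x ^ (1 / 3 : ℝ)) * (x ^ (1 / 3 : ℝ))⁻¹) := by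
  refine (hasDerivAt_dv (contDiff_simTest hη hχ h0) x v).unique ?_
  have h2 := (hχ.differentiable (by simp) (v / x ^ (1 / 3 : ℝ))).hasDerivAt
  refine ((h2.comp v ((hasDerivAt_id v).div_const _)).const_mul (η x)).congr_deriv ?_
  rw [one_div (x ^ (1 / 3 : ℝ))]

theorem contDiff_dv {ψ : ℝ × ℝ → ℝ} (h : ContDiff ℝ ∞ ψ) : ContDiff ℝ ∞ (dv ψ) :=
  (h.fderiv_right (m := ∞) (by simp)).clm_apply contDiff_const

theorem contDiff_deriv (hχ : ContDiff ℝ ∞ χ) : ContDiff ℝ ∞ (deriv χ) :=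
  (contDiff_infty_iff_deriv.1 hχ).2

theorem dv_dv_simTest (hη : ContDiff ℝ ∞ η) (hχ : ContDiff ℝ ∞ χ)
    (h0 : ∀ x, x ∉ Set.Icc (1 : ℝ) 3 → η x = 0) (x v : ℝ) :
    dv (dv (simTest η χ)) (x, v) =
      η x * (deriv (deriv χ) (v / x ^ (1 / 3 : ℝ)) * (x ^ (1 / 3 : ℝ))⁻¹ * (x ^ (1 / 3 : ℝ))⁻¹) := by
  refine (hasDerivAt_dv (contDiff_dv (contDiff_simTest hη hχ h0)) x v).unique ?_
  have h2 := ((contDiff_deriv hχ).differentiable (by simp) (v / x ^ (1 / 3 : ℝ))).hasDerivAt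
  refine ((((h2.comp v ((hasDerivAt_id v).div_const _)).mul_const _).const_mul
    (η x)).congr_deriv ?_).congr_of_eventuallyEq (Eventually.of_forall fun w =>
      dv_simTest hη hχ h0 x w)
  rw [one_div (x ^ (1 / 3 : ℝ))]

end SelfSimilarTest

theorem integrable_mul_of_bound {f θ : ℝ → ℝ} {D B : ℝ} (hf : Measurable f)
    (hb : ∀ᵐ t, |f t| ≤ D * Real.exp (B * |t|)) (hθ : Continuous θ) (hc : HasCompactSupport θ) :
    Integrable fun t => f t * θ t := by
  have h1 : Continuous fun t : ℝ => D * Real.exp (B * |t|) := by fun_prop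
  refine Integrable.mono' ((h1.mul hθ.norm).integrable_of_hasCompactSupport hc.norm.mul_left)
    (hf.aestronglyMeasurable.mul hθ.aestronglyMeasurable) ?_
  filter_upwards [hb] with t ht
  rw [norm_mul]
  exact mul_le_mul_of_nonneg_right ht (norm_nonneg _)

/-- In self-similar variables the operator applied to `η(x) * χ(v / x ^ (1 / 3))` separates. -/
theorem integral_selfSim_mul_simTest {lam : ℝ} {f η χ : ℝ → ℝ} {D B : ℝ} (hf : Measurable f)
    (hb : ∀ᵐ t, |f t| ≤ D * Real.exp (B * |t|)) (hη : ContDiff ℝ ∞ η) (hχ : ContDiff ℝ ∞ χ)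
    (hc : HasCompactSupport χ) (h0 : ∀ x, x ∉ Set.Icc (1 : ℝ) 3 → η x = 0) {x : ℝ} (hx : 0 < x) :
    ∫ v, selfSim lam f (x, v) *
        (v * dx (simTest η χ) (x, v) + dv (dv (simTest η χ)) (x, v)) =
      x ^ (lam + 2 / 3) * deriv η x * (∫ t, f t * (t * χ t)) +
        x ^ (lam - 1 / 3) * η x *
          (∫ t, f t * (deriv (deriv χ) t - t ^ 2 / 3 * deriv χ t)) := by
  have hx3 : 0 < x ^ (1 / 3 : ℝ) := by positivity
  set k : ℝ := x ^ (1 / 3 : ℝ) with hk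
  have hk3 : x = k ^ 3 := (rpow_one_third_pow hx.le).symm
  have hc1 : HasCompactSupport (deriv χ) := hc.deriv
  have c1 := (contDiff_deriv hχ).continuous
  have c2 := (contDiff_deriv (contDiff_deriv hχ)).continuous
  have i1 : Integrable fun t => f t * (t * χ t) :=
    integrable_mul_of_bound hf hb (continuous_id.mul hχ.continuous) hc.mul_left
  have i2 : Integrable fun t => f t * (deriv (deriv χ) t - t ^ 2 / 3 * deriv χ t) := by
    refine integrable_mul_of_bound hf hb (c2.sub ((by fun_prop : Continuous fun t : ℝ =>
      t ^ 2 / 3).mul c1)) ?_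
    have h2 : HasCompactSupport fun t => t ^ 2 / 3 * deriv χ t := hc1.mul_left
    exact hc1.deriv.sub h2
  obtain ⟨K, hK⟩ : ∃ K : ℝ → ℝ, K = fun t => x ^ lam * k * deriv η x * (f t * (t * χ t)) +
      x ^ lam * (k⁻¹ * k⁻¹) * η x * (f t * (deriv (deriv χ) t - t ^ 2 / 3 * deriv χ t)) := ⟨_, rfl⟩
  have e : ∀ v, selfSim lam f (x, v) *
      (v * dx (simTest η χ) (x, v) + dv (dv (simTest η χ)) (x, v)) = K (v / k) := by
    intro v
    rw [hK]
    rw [dx_simTest hη hχ h0 hx, dv_dv_simTest hη hχ h0]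
    simp only [selfSim, ← hk]
    rw [show x⁻¹ = (k ^ 3)⁻¹ by rw [← hk3]]
    field_simp
    ring
  simp_rw [e]
  rw [Measure.integral_comp_div, hK, integral_add (i1.const_mul _) (i2.const_mul _),
    integral_const_mul, integral_const_mul, abs_of_pos hx3, smul_eq_mul]
  have e1 : x ^ (lam + 2 / 3) = x ^ lam * k * k := by
    rw [hk, mul_assoc, ← Real.rpow_add hx, ← Real.rpow_add hx]
    congr 1
    ring
  have e2 : x ^ (lam - 1 / 3) = x ^ lam * k⁻¹ := by
    rw [hk, ← Real.rpow_neg hx.le, ← Real.rpow_add hx]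
    congr 1
  rw [e1, e2]
  generalize (∫ t, f t * (t * χ t)) = I₁
  generalize (∫ t, f t * (deriv (deriv χ) t - t ^ 2 / 3 * deriv χ t)) = I₂
  field_simp

/-- If `x ^ lam * f (v / x ^ (1 / 3))` solves the equation in the sense of distributions, then so
does `f` for the equation of profiles. -/
theorem integral_profile_eq_zero {lam : ℝ} {u : ℝ × ℝ → ℝ} {f : ℝ → ℝ} {D B : ℝ}
    (hf : Measurable f) (hb : ∀ᵐ t, |f t| ≤ D * Real.exp (B * |t|))
    (huf : ∀ᵐ y : ℝ, 0 < y → ∀ᵐ w : ℝ, u (y, w) = selfSim lam f (y, w))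
    (hui : ∀ θ : ℝ × ℝ → ℝ, Continuous θ → HasCompactSupport θ →
      IntegrableOn (fun z => u z * θ z) halfPlane)
    (hu : ∀ ψ : ℝ × ℝ → ℝ, ContDiff ℝ ∞ ψ → HasCompactSupport ψ → tsupport ψ ⊆ halfPlane →
      ∫ z in halfPlane, u z * (z.2 * dx ψ z + dv (dv ψ) z) = 0)
    {χ : ℝ → ℝ} (hχ : ContDiff ℝ ∞ χ) (hc : HasCompactSupport χ) :
    ∫ t, f t * (deriv (deriv χ) t - t ^ 2 / 3 * deriv χ t - (lam + 2 / 3) * (t * χ t)) = 0 := by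
  -- any nonnegative cut-off in `x`, supported away from zero, serves
  let b : ContDiffBump (2 : ℝ) := ⟨1 / 2, 1, by norm_num, by norm_num⟩
  set η : ℝ → ℝ := fun x => b x with hηdef
  have hη : ContDiff ℝ ∞ η := b.contDiff
  have h0 : ∀ x, x ∉ Set.Icc (1 : ℝ) 3 → η x = 0 := by
    intro x hx
    refine b.zero_of_le_dist ?_
    show 1 ≤ dist x 2
    by_contra! h
    rw [Real.dist_eq, abs_lt] at h
    exact hx ⟨by linarith [h.1], by linarith [h.2]⟩
  have hηc : HasCompactSupport η := b.hasCompactSupport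
  have hψ := contDiff_simTest hη hχ h0
  have hψc := hasCompactSupport_simTest h0 hc
  have hθ : Continuous fun z : ℝ × ℝ => z.2 * dx (simTest η χ) z + dv (dv (simTest η χ)) z :=
    (continuous_snd.mul (continuous_dx hψ)).add (continuous_dv (contDiff_dv hψ))
  have hθc : HasCompactSupport
      fun z : ℝ × ℝ => z.2 * dx (simTest η χ) z + dv (dv (simTest η χ)) z := by
    have h1 : HasCompactSupport fun z : ℝ × ℝ => z.2 * dx (simTest η χ) z :=
      (hasCompactSupport_dx hψc).mul_left
    exact h1.add (hasCompactSupport_dv (hasCompactSupport_dv hψc))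
  have h1 := hu _ hψ hψc (tsupport_simTest_subset h0)
  have hI := hui _ hθ hθc
  rw [halfPlane_eq] at h1 hI
  rw [setIntegral_rightOf hI] at h1
  set I₁ : ℝ := ∫ t, f t * (t * χ t) with hI₁
  set I₂ : ℝ := ∫ t, f t * (deriv (deriv χ) t - t ^ 2 / 3 * deriv χ t) with hI₂
  have h2 : ∫ x in Set.Ioi (0 : ℝ), (x ^ (lam + 2 / 3) * deriv η x * I₁ +
      x ^ (lam - 1 / 3) * η x * I₂) = 0 := by
    refine (setIntegral_congr_ae measurableSet_Ioi ?_).trans h1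
    filter_upwards [huf] with x hx hx'
    have hx0 : 0 < x := hx'
    rw [← integral_selfSim_mul_simTest hf hb hη hχ hc h0 hx0]
    refine integral_congr_ae ?_
    filter_upwards [hx hx0] with v hv
    rw [hv]
  -- powers of `x` times functions supported in `[1, 3]` are continuous with compact support
  have hpow : ∀ (p : ℝ) (κ : ℝ → ℝ), Continuous κ → (∀ x, x ∉ Set.Icc (1 : ℝ) 3 → κ x = 0) →
      Continuous (fun x => x ^ p * κ x) ∧ HasCompactSupport fun x => x ^ p * κ x := by
    intro p κ hκ hκ0
    refine ⟨continuous_iff_continuousAt.2 fun x => ?_, HasCompactSupport.intro isCompact_Icc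
      fun x hx => by rw [hκ0 x hx, mul_zero]⟩
    rcases lt_or_ge 0 x with hx | hx
    · exact (Real.continuousAt_rpow_const x p (Or.inl hx.ne')).mul hκ.continuousAt
    · refine (continuousAt_const (y := (0 : ℝ))).congr ?_
      filter_upwards [eventually_lt_nhds (show x < 1 by linarith)] with y hy
      rw [hκ0 y fun h => not_le.2 hy h.1, mul_zero]
  have h0' : ∀ x, x ∉ Set.Icc (1 : ℝ) 3 → deriv η x = 0 := by
    intro x hx
    have : deriv η x = deriv (fun _ : ℝ => (0 : ℝ)) x := by
      refine EventuallyEq.deriv_eq ?_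
      filter_upwards [isClosed_Icc.isOpen_compl.mem_nhds hx] with y hy using h0 y hy
    rw [this, deriv_const]
  obtain ⟨c1, s1⟩ := hpow (lam + 2 / 3) _ (contDiff_deriv hη).continuous h0'
  obtain ⟨c2, s2⟩ := hpow (lam - 1 / 3) _ hη.continuous h0
  obtain ⟨c3, s3⟩ := hpow (lam + 2 / 3) _ hη.continuous h0
  have j1 : Integrable fun x : ℝ => x ^ (lam + 2 / 3) * deriv η x :=
    c1.integrable_of_hasCompactSupport s1
  have j2 : Integrable fun x : ℝ => x ^ (lam - 1 / 3) * η x := c2.integrable_of_hasCompactSupport s2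
  have j3 : Integrable fun x : ℝ => x ^ (lam + 2 / 3) * η x := c3.integrable_of_hasCompactSupport s3
  have hpos : ∀ κ : ℝ → ℝ, (∀ x, x ∉ Set.Icc (1 : ℝ) 3 → κ x = 0) →
      ∫ x in Set.Ioi (0 : ℝ), κ x = ∫ x, κ x := fun κ hκ =>
    setIntegral_eq_integral_of_forall_compl_eq_zero fun x hx => hκ x fun h =>
      hx (lt_of_lt_of_le one_pos h.1)
  rw [hpos _ fun x hx => by rw [h0 x hx, h0' x hx]; ring,
    integral_add (j1.mul_const _) (j2.mul_const _), integral_mul_const, integral_mul_const] at h2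
  -- integration by parts in `x` makes both terms multiples of `∫ x ^ (lam - 1 / 3) * η x > 0`
  have h3 : ∫ x : ℝ, (x ^ (lam + 2 / 3) * deriv η x +
      (lam + 2 / 3) * (x ^ (lam - 1 / 3) * η x)) = 0 := by
    refine integral_eq_zero_of_hasDerivAt_of_integrable (f := fun x : ℝ => x ^ (lam + 2 / 3) * η x)
      (fun x => ?_) (j1.add (j2.const_mul _)) j3
    rcases lt_or_ge 0 x with hx | hx
    · refine ((Real.hasDerivAt_rpow_const (p := lam + 2 / 3) (Or.inl hx.ne')).mul
        (hη.differentiable (by simp) x).hasDerivAt).congr_deriv ?_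
      rw [show lam + 2 / 3 - 1 = lam - 1 / 3 by ring]
      ring
    · have hx1 : x ∉ Set.Icc (1 : ℝ) 3 := fun h => by linarith [h.1]
      rw [h0 x hx1, h0' x hx1, mul_zero, mul_zero, mul_zero, add_zero]
      refine (hasDerivAt_const x (0 : ℝ)).congr_of_eventuallyEq ?_
      filter_upwards [eventually_lt_nhds (show x < 1 by linarith)] with y hy
      rw [h0 y fun h => not_le.2 hy h.1, mul_zero]
  rw [integral_add j1 (j2.const_mul _), integral_const_mul] at h3
  set J : ℝ := ∫ x : ℝ, x ^ (lam - 1 / 3) * η x with hJ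
  have hJpos : 0 < J := by
    refine c2.integral_pos_of_hasCompactSupport_nonneg_nonzero (x := 2) s2 (fun x => ?_) ?_
    · by_cases hx : x ∈ Set.Icc (1 : ℝ) 3
      · have : 0 < x := lt_of_lt_of_le one_pos hx.1
        exact mul_nonneg (by positivity) b.nonneg
      · simp [h0 x hx]
    · have : η 2 = 1 := b.one_of_mem_closedBall (by simp [b])
      rw [this, mul_one]
      positivity
  have h4 : J * (I₂ - (lam + 2 / 3) * I₁) = 0 := by
    linear_combination h2 - I₁ * h3
  have h5 := (mul_eq_zero.1 h4).resolve_left hJpos.ne'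
  rw [← h5, hI₁, hI₂, ← integral_const_mul, ← integral_sub]
  · congr 1
    funext t
    ring
  · refine integrable_mul_of_bound hf hb ((contDiff_deriv (contDiff_deriv hχ)).continuous.sub
      ((by fun_prop : Continuous fun t : ℝ => t ^ 2 / 3).mul (contDiff_deriv hχ).continuous)) ?_
    have h2 : HasCompactSupport fun t => t ^ 2 / 3 * deriv χ t := hc.deriv.mul_left
    exact hc.deriv.deriv.sub h2
  · exact (integrable_mul_of_bound hf hb (continuous_id.mul hχ.continuous) hc.mul_left).const_mul _

/-! ### Regularity of distributional profiles -/

/-- A test function of mean zero is the derivative of a test function. -/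
theorem exists_primitive_of_integral_eq_zero {κ : ℝ → ℝ} (hκ : ContDiff ℝ ∞ κ)
    (hc : HasCompactSupport κ) (h0 : ∫ t, κ t = 0) :
    ∃ A : ℝ → ℝ, ContDiff ℝ ∞ A ∧ HasCompactSupport A ∧ ∀ t, HasDerivAt A (κ t) t := by
  obtain ⟨M, hM⟩ := exists_abs_lt_eq_zero hc
  set N : ℝ := |M| + 1 with hN
  have hMN : M < N := by linarith [le_abs_self M]
  have hd : ∀ t, HasDerivAt (fun t => ∫ s in (-N)..t, κ s) (κ t) t := fun t =>
    (hκ.continuous.integral_hasStrictDerivAt (-N) t).hasDerivAt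
  refine ⟨fun t => ∫ s in (-N)..t, κ s, ?_, ?_, hd⟩
  · refine contDiff_infty_iff_deriv.2 ⟨fun t => (hd t).differentiableAt, ?_⟩
    rwa [funext fun t => (hd t).deriv]
  · refine HasCompactSupport.intro (isCompact_Icc (a := -N) (b := N)) fun t ht => ?_
    rcases lt_or_ge t (-N) with h1 | h1
    · refine (intervalIntegral.integral_congr (g := fun _ => (0 : ℝ)) fun s hs => ?_).trans (by simp)
      rw [Set.uIcc_of_ge h1.le] at hs
      exact hM s (hMN.trans_le (by linarith [hs.2, neg_le_abs s]))
    · have h2 : N < t := by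
        by_contra! h
        exact ht ⟨h1, h⟩
      refine (intervalIntegral.integral_eq_integral_of_support_subset fun s hs => ?_).trans h0
      have h3 : |s| ≤ M := by
        by_contra! h
        exact hs (hM s h)
      rw [abs_le] at h3
      exact ⟨by linarith [h3.1], by linarith [h3.2]⟩

/-- The adjoint of the equation of profiles can be solved with compactly supported functions for
every right-hand side orthogonal to `profE` and `profO`, by variation of constants. -/
theorem exists_adjoint_solution {lam : ℝ} {θ : ℝ → ℝ} (hθ : ContDiff ℝ ∞ θ)
    (hc : HasCompactSupport θ) (h1 : ∫ t, profE (-lam) t * θ t = 0)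
    (h2 : ∫ t, profO (-lam) t * θ t = 0) :
    ∃ χ : ℝ → ℝ, ContDiff ℝ ∞ χ ∧ HasCompactSupport χ ∧
      ∀ t, deriv (deriv χ) t - t ^ 2 / 3 * deriv χ t - (lam + 2 / 3) * (t * χ t) = θ t := by
  set E := profE (-lam) with hE
  set O := profO (-lam) with hO
  have cE : ContDiff ℝ ∞ E := contDiff_profE _
  have cO : ContDiff ℝ ∞ O := contDiff_profO _
  have pE : IsProfileOn Set.univ (-lam) E := isProfileOn_profE _
  have pO : IsProfileOn Set.univ (-lam) O := isProfileOn_profO _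
  obtain ⟨A, cA, sA, dA⟩ := exists_primitive_of_integral_eq_zero (cE.mul hθ) hc.mul_left h1
  obtain ⟨B, cB, sB, dB⟩ := exists_primitive_of_integral_eq_zero (cO.mul hθ) hc.mul_left h2
  have cw : ContDiff ℝ ∞ fun t : ℝ => Real.exp (t ^ 3 / 9) := by fun_prop
  have d1 : ∀ t, HasDerivAt (fun t => Real.exp (t ^ 3 / 9) * (O t * A t - E t * B t))
      (Real.exp (t ^ 3 / 9) * (t ^ 2 / 3 * (O t * A t - E t * B t) +
        (deriv O t * A t - deriv E t * B t))) t := by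
    intro t
    refine ((hasDerivAt_exp_cube t).mul (((pO.1 t trivial).mul (dA t)).sub
      ((pE.1 t trivial).mul (dB t)))).congr_deriv ?_
    simp only [Pi.sub_apply, Pi.mul_apply]
    ring
  have d2 : ∀ t, HasDerivAt (fun t => Real.exp (t ^ 3 / 9) * (t ^ 2 / 3 * (O t * A t - E t * B t) +
        (deriv O t * A t - deriv E t * B t)))
      (t ^ 2 / 3 * (Real.exp (t ^ 3 / 9) * (t ^ 2 / 3 * (O t * A t - E t * B t) +
        (deriv O t * A t - deriv E t * B t))) +
        (lam + 2 / 3) * (t * (Real.exp (t ^ 3 / 9) * (O t * A t - E t * B t))) + θ t) t := by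
    intro t
    have hq : HasDerivAt (fun t : ℝ => t ^ 2 / 3) (2 * t / 3) t := by
      simpa using (hasDerivAt_pow 2 t).div_const 3
    refine ((hasDerivAt_exp_cube t).mul ((hq.mul (((pO.1 t trivial).mul (dA t)).sub
      ((pE.1 t trivial).mul (dB t)))).add (((pO.2 t trivial).mul (dA t)).sub
      ((pE.2 t trivial).mul (dB t))))).congr_deriv ?_
    have hW := wronskian_profE_profO (-lam) t
    rw [← hE, ← hO] at hW
    simp only [Pi.sub_apply, Pi.mul_apply, Pi.add_apply]
    linear_combination θ t * hW
  have e1 := funext fun t => (d1 t).deriv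
  refine ⟨fun t => Real.exp (t ^ 3 / 9) * (O t * A t - E t * B t),
    cw.mul ((cO.mul cA).sub (cE.mul cB)), ?_, fun t => ?_⟩
  · have s1 : HasCompactSupport fun t => O t * A t := sA.mul_left
    have s2 : HasCompactSupport fun t => E t * B t := sB.mul_left
    exact (s1.sub s2).mul_left
  · rw [e1, (d2 t).deriv]
    ring

/-- The space of smooth functions with compact support on the line. -/
def testSpace : Submodule ℝ (ℝ → ℝ) where
  carrier := {θ | ContDiff ℝ ∞ θ ∧ HasCompactSupport θ}
  add_mem' h k := ⟨h.1.add k.1, h.2.add k.2⟩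
  zero_mem' := ⟨contDiff_const, HasCompactSupport.zero⟩
  smul_mem' _ _ h := ⟨contDiff_const.smul h.1, h.2.smul_left⟩

/-- Integration against a function, as a functional on the space of test functions. -/
noncomputable def testFunctional (k : ℝ → ℝ)
    (hk : ∀ θ : ℝ → ℝ, Continuous θ → HasCompactSupport θ → Integrable fun t => k t * θ t) :
    testSpace →ₗ[ℝ] ℝ where
  toFun θ := ∫ t, k t * (θ : ℝ → ℝ) t
  map_add' θ ϑ := by
    rw [← integral_add (hk _ θ.2.1.continuous θ.2.2) (hk _ ϑ.2.1.continuous ϑ.2.2)]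
    congr 1
    funext t
    simp only [Submodule.coe_add, Pi.add_apply]
    ring
  map_smul' c θ := by
    simp only [RingHom.id_apply, smul_eq_mul]
    rw [← integral_const_mul]
    congr 1
    funext t
    simp only [Submodule.coe_smul, Pi.smul_apply, smul_eq_mul]
    ring

theorem integrable_mul_of_continuous {k : ℝ → ℝ} (hk : Continuous k) (θ : ℝ → ℝ)
    (hθ : Continuous θ) (hc : HasCompactSupport θ) : Integrable fun t => k t * θ t :=
  (hk.mul hθ).integrable_of_hasCompactSupport hc.mul_left

/-- Distributional solutions of the equation of profiles are classical. -/
theorem exists_profile_ae_eq {lam D B : ℝ} {f : ℝ → ℝ} (hf : Measurable f)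
    (hb : ∀ᵐ t, |f t| ≤ D * Real.exp (B * |t|))
    (hw : ∀ χ : ℝ → ℝ, ContDiff ℝ ∞ χ → HasCompactSupport χ →
      ∫ t, f t * (deriv (deriv χ) t - t ^ 2 / 3 * deriv χ t - (lam + 2 / 3) * (t * χ t)) = 0) :
    ∃ F, IsProfileOn Set.univ (-lam) F ∧ ∀ᵐ t, f t = F t := by
  have cE := (contDiff_profE (-lam)).continuous
  have cO := (contDiff_profO (-lam)).continuous
  have iF := fun θ => integrable_mul_of_bound (θ := θ) hf hb
  have iE := integrable_mul_of_continuous cE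
  have iO := integrable_mul_of_continuous cO
  let L : Bool → testSpace →ₗ[ℝ] ℝ := fun i =>
    if i then testFunctional (profE (-lam)) iE else testFunctional (profO (-lam)) iO
  -- a functional vanishing on the common kernel of two functionals is a combination of them
  have hker : ⨅ i, LinearMap.ker (L i) ≤ LinearMap.ker (testFunctional f iF) := by
    intro θ hθ
    rw [Submodule.mem_iInf] at hθ
    obtain ⟨χ, hχ, hχc, he⟩ := exists_adjoint_solution θ.2.1 θ.2.2 (hθ true) (hθ false)
    have := hw χ hχ hχc
    simp_rw [he] at this
    exact this
  obtain ⟨c, hc⟩ := (Submodule.mem_span_range_iff_exists_fun ℝ).1 (mem_span_of_iInf_ker_le_ker hker)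
  refine ⟨fun t => c true * profE (-lam) t + c false * profO (-lam) t,
    (isProfileOn_profE _).linear_comb isOpen_univ (isProfileOn_profO _) _ _, ?_⟩
  have hF : Continuous fun t => c true * profE (-lam) t + c false * profO (-lam) t :=
    (cE.const_mul _).add (cO.const_mul _)
  have hloc : LocallyIntegrable f := by
    have h1 : Continuous fun t : ℝ => D * Real.exp (B * |t|) := by fun_prop
    refine h1.locallyIntegrable.mono hf.aestronglyMeasurable ?_
    filter_upwards [hb] with t ht
    exact ht.trans (le_abs_self _)
  have h0 := ae_eq_zero_of_integral_contDiff_smul_eq_zero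
    (hloc.sub hF.locallyIntegrable) fun g hg hgc => by
      have h1 := LinearMap.congr_fun hc ⟨g, hg, hgc⟩
      have h2 : c true * (∫ t, profE (-lam) t * g t) + c false * (∫ t, profO (-lam) t * g t) =
          ∫ t, f t * g t := by
        rw [Fintype.sum_bool] at h1
        exact h1
      have e : ∀ t, g t • (f - fun t => c true * profE (-lam) t + c false * profO (-lam) t) t =
          f t * g t - (c true * (profE (-lam) t * g t) + c false * (profO (-lam) t * g t)) := by
        intro t
        simp only [Pi.sub_apply, smul_eq_mul]
        ring
      simp_rw [e]
      have j1 := (iE g hg.continuous hgc).const_mul (c true)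
      have j2 := (iO g hg.continuous hgc).const_mul (c false)
      have j3 : Integrable fun t => c true * (profE (-lam) t * g t) +
          c false * (profO (-lam) t * g t) := j1.add j2
      rw [integral_sub (iF g hg.continuous hgc) j3, integral_add j1 j2,
        integral_const_mul, integral_const_mul, h2, sub_self]
  filter_upwards [h0] with t ht
  exact sub_eq_zero.1 ht

/-! ### Classification of weak solutions -/

theorem tsupport_dv_subset {ψ : ℝ × ℝ → ℝ} : tsupport (dv ψ) ⊆ tsupport ψ := by
  refine closure_minimal (fun z hz => ?_) isClosed_closure
  by_contra h
  exact hz (dv_eq_zero h)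

/-- A weak solution satisfies the equation in the sense of distributions. -/
theorem integral_mul_adjoint_eq {h w F : ℝ × ℝ → ℝ} (hd : IsWeakDerivV halfPlane h w)
    (hi : ∀ θ : ℝ × ℝ → ℝ, Continuous θ → HasCompactSupport θ →
      IntegrableOn (fun z => h z * θ z) halfPlane)
    {ψ : ℝ × ℝ → ℝ} (hψ : ContDiff ℝ ∞ ψ) (hc : HasCompactSupport ψ)
    (hs : tsupport ψ ⊆ halfPlane)
    (he : -(∫ z in halfPlane, h z * (z.2 * dx ψ z)) + ∫ z in halfPlane, w z * dv ψ z =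
      ∫ z in halfPlane, F z * ψ z) :
    ∫ z in halfPlane, h z * (z.2 * dx ψ z + dv (dv ψ) z) = -∫ z in halfPlane, F z * ψ z := by
  have h1 := hd (dv ψ) (contDiff_dv hψ) (hasCompactSupport_dv hc) (tsupport_dv_subset.trans hs)
  have i1 : IntegrableOn (fun z => h z * (z.2 * dx ψ z)) halfPlane :=
    hi _ (continuous_snd.mul (continuous_dx hψ)) (hasCompactSupport_dx hc).mul_left
  have i2 := hi _ (continuous_dv (contDiff_dv hψ)) (hasCompactSupport_dv (hasCompactSupport_dv hc))
  simp_rw [mul_add]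
  rw [integral_add i1 i2, h1]
  linarith

theorem IsLocL2.aestronglyMeasurable {h : ℝ × ℝ → ℝ} (hh : IsLocL2 halfPlane h) :
    AEStronglyMeasurable h (volume.restrict halfPlane) := by
  have hU : (⋃ n : ℕ, halfPlane ∩ Metric.closedBall (0 : ℝ × ℝ) n) = halfPlane := by
    rw [← Set.inter_iUnion, Metric.iUnion_closedBall_nat, Set.inter_univ]
  rw [← hU]
  exact aestronglyMeasurable_iUnion_iff.2 fun n => (hh n).aestronglyMeasurable

theorem IsProfileOn.abs_le_of_ae {a D B : ℝ} {F : ℝ → ℝ} (hF : IsProfileOn Set.univ a F)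
    (hb : ∀ᵐ t, |F t| ≤ D * Real.exp (B * |t|)) (t : ℝ) : |F t| ≤ D * Real.exp (B * |t|) := by
  have hc : IsClosed {t | |F t| ≤ D * Real.exp (B * |t|)} :=
    isClosed_le hF.continuous.abs (by fun_prop)
  have := (Measure.dense_of_ae hb).closure_eq
  rw [hc.closure_eq] at this
  exact Set.eq_univ_iff_forall.1 this t

theorem measurable_selfSim {lam : ℝ} {F : ℝ → ℝ} (hF : Measurable F) :
    Measurable (selfSim lam F) := by
  unfold selfSim
  fun_prop

/-- The classification for measurable homogeneous solutions in the sense of distributions. -/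
theorem exists_ae_eq_of_distributional {lam : ℕ} {u : ℝ × ℝ → ℝ} (hm : Measurable u)
    (hhom : ∀ r : ℝ, 0 < r →
      ∀ᵐ z : ℝ × ℝ, 0 < z.1 → u (r ^ 3 * z.1, r * z.2) = r ^ (lam : ℝ) * u z)
    {C R : ℝ} (hb : ∀ᵐ z : ℝ × ℝ, 0 < z.1 → R ≤ ‖z‖ → |u z| ≤ C * Real.exp (1 * ‖z‖))
    (hui : ∀ θ : ℝ × ℝ → ℝ, Continuous θ → HasCompactSupport θ →
      IntegrableOn (fun z => u z * θ z) halfPlane)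
    (hu : ∀ ψ : ℝ × ℝ → ℝ, ContDiff ℝ ∞ ψ → HasCompactSupport ψ → tsupport ψ ⊆ halfPlane →
      ∫ z in halfPlane, u z * (z.2 * dx ψ z + dv (dv ψ) z) = 0) :
    ∃ (P : MvPolynomial (Fin 2) ℝ) (μ : ℝ), IsKinHomogPoly P lam ∧
      (∀ᵐ z : ℝ × ℝ, 0 < z.1 → u z = polyFun P z + μ * psi (lam / 3) z) ∧
      (lam % 3 = 0 ∨ lam % 3 = 1 → μ = 0) := by
  obtain ⟨f, D, B, hf, hfb, hfu⟩ := exists_ae_eq_selfSim (lam := (lam : ℝ) / 3) hm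
    (by rwa [mul_div_cancel₀ _ (by norm_num)]) hb
  obtain ⟨F, hF, hfF⟩ := exists_profile_ae_eq hf hfb fun χ hχ hχc =>
    integral_profile_eq_zero hf hfb hfu hui hu hχ hχc
  have hFb : ∀ᵐ t, |F t| ≤ D * Real.exp (B * |t|) := by
    filter_upwards [hfb, hfF] with t h1 h2
    rwa [← h2]
  obtain ⟨P, μ, hP, hPμ, hμ⟩ := exists_eq_of_profile (R := 0) hF fun t _ => hF.abs_le_of_ae hFb t
  refine ⟨P, μ, hP, ?_, hμ⟩
  have hmeas : MeasurableSet {z : ℝ × ℝ | 0 < z.1 → u z = selfSim ((lam : ℝ) / 3) F z} :=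
    MeasurableSet.imp (measurableSet_lt measurable_const measurable_fst)
      (measurableSet_eq_fun hm (measurable_selfSim hF.continuous.measurable))
  have h1 : ∀ᵐ z : ℝ × ℝ, 0 < z.1 → u z = selfSim ((lam : ℝ) / 3) F z := by
    rw [Measure.volume_eq_prod]
    refine (Measure.ae_prod_iff_ae_ae hmeas).2 ?_
    filter_upwards [hfu] with y hy
    by_cases h0 : 0 < y
    · have hk : (y ^ (1 / 3 : ℝ))⁻¹ ≠ 0 := by positivity
      filter_upwards [hy h0, ae_comp_const_mul hfF hk] with w hw hw2 _
      rw [hw]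
      simp only [selfSim]
      rw [div_eq_inv_mul w, hw2]
    · exact ae_of_all _ fun w h => absurd h h0
  filter_upwards [h1] with z hz h0
  rw [hz h0, hPμ z h0]

/-- The classification of homogeneous weak solutions. Test functions supported in the open half-plane
suffice, and the polynomial solving the inhomogeneous equation is subtracted in the weak formulation. -/
theorem exists_ae_eq_of_isWeakSolution {lam : ℕ} {p : MvPolynomial (Fin 2) ℝ} {g : ℝ → ℝ}
    {h : ℝ × ℝ → ℝ} (hp : IsKinHomogPoly p ((lam : ℤ) - 2)) (hh : IsKinHomogeneousAE lam h)
    (hg : NoExpGrowthAE h) (hs : IsWeakSolution (polyFun p) g h) :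
    ∃ (P : MvPolynomial (Fin 2) ℝ) (μ : ℝ), IsKinHomogPoly P lam ∧
      (∀ᵐ z ∂(volume.restrict halfPlane), h z = polyFun P z + μ * psi (lam / 3) z) ∧
      (lam % 3 = 0 ∨ lam % 3 = 1 → μ = 0) := by
  obtain ⟨Q, hQ, rfl⟩ := exists_kinOp_eq hp
  obtain ⟨w, hL, -, hd, he⟩ := hs
  -- a measurable representative, as needed for the arguments with null sets on lines
  have hmeas := hL.aestronglyMeasurable
  have hk : Measurable (hmeas.mk h) := hmeas.stronglyMeasurable_mk.measurable
  have hkh : ∀ᵐ z : ℝ × ℝ, 0 < z.1 → h z = hmeas.mk h z :=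
    (ae_restrict_iff' measurableSet_halfPlane).1 hmeas.ae_eq_mk
  generalize hmeas.mk h = k at hk hkh
  have hQc := continuous_polyFun Q
  have ih := fun θ => integrableOn_mul_of_isLocL2 (θ := θ) measurableSet_halfPlane hL
  have iQ : ∀ θ : ℝ × ℝ → ℝ, Continuous θ → HasCompactSupport θ →
      IntegrableOn (fun z => polyFun Q z * θ z) halfPlane := fun θ hθ hc =>
    ((hQc.mul hθ).integrable_of_hasCompactSupport hc.mul_left).integrableOn
  have hkθ : ∀ θ : ℝ × ℝ → ℝ, (fun z => (k z + (-1) * polyFun Q z) * θ z) =ᵐ[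
      volume.restrict halfPlane] fun z => h z * θ z - polyFun Q z * θ z := by
    intro θ
    refine (ae_restrict_iff' measurableSet_halfPlane).2 ?_
    filter_upwards [hkh] with z hz h0
    rw [← hz h0]
    ring
  obtain ⟨C₁, R₁, hb₁⟩ := hg 1 one_pos
  obtain ⟨C₂, R₂, hb₂⟩ := noExpGrowth_polyFun Q 1 one_pos
  rw [ae_restrict_iff' measurableSet_halfPlane] at hb₁
  have key : ∃ (P : MvPolynomial (Fin 2) ℝ) (μ : ℝ), IsKinHomogPoly P lam ∧
      (∀ᵐ z : ℝ × ℝ, 0 < z.1 → k z + (-1) * polyFun Q z = polyFun P z + μ * psi (lam / 3) z) ∧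
      (lam % 3 = 0 ∨ lam % 3 = 1 → μ = 0) := by
    refine exists_ae_eq_of_distributional (u := fun z => k z + (-1) * polyFun Q z)
      (C := C₁ + C₂) (R := max R₁ R₂) (hk.add (hQc.measurable.const_mul _)) ?_ ?_ ?_ ?_
    · intro r hr
      have h1 := (ae_restrict_iff' measurableSet_halfPlane).1 (hh r hr)
      filter_upwards [h1, hkh, ae_comp_const_mul_prod hkh (pow_ne_zero 3 hr.ne') hr.ne']
        with z e1 e2 e3 h0
      have h0' : 0 < r ^ 3 * z.1 := by positivity
      rw [← e3 h0', ← e2 h0, e1 h0, isKinHomogeneous_polyFun hQ r hr z h0]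
      ring
    · filter_upwards [hb₁, hkh] with z h1 h2 h0 hR
      have e1 := h1 h0 ((le_max_left _ _).trans hR)
      have e2 := hb₂ z h0 ((le_max_right _ _).trans hR)
      rw [← h2 h0, add_mul]
      refine (abs_add_le _ _).trans (add_le_add e1 ?_)
      rwa [neg_one_mul, abs_neg]
    · intro θ hθ hc
      exact Integrable.congr ((ih θ hθ hc).sub (iQ θ hθ hc)) (hkθ θ).symm
    · intro ψ hψ hc hsub
      have hθ : Continuous fun z : ℝ × ℝ => z.2 * dx ψ z + dv (dv ψ) z :=
        (continuous_snd.mul (continuous_dx hψ)).add (continuous_dv (contDiff_dv hψ))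
      have hθc : HasCompactSupport fun z : ℝ × ℝ => z.2 * dx ψ z + dv (dv ψ) z := by
        have h1 : HasCompactSupport fun z : ℝ × ℝ => z.2 * dx ψ z :=
          (hasCompactSupport_dx hc).mul_left
        exact h1.add (hasCompactSupport_dv (hasCompactSupport_dv hc))
      have hbdry : ∀ v : ℝ, ψ (0, v) = 0 := fun v =>
        image_eq_zero_of_notMem_tsupport fun h0 => lt_irrefl (0 : ℝ) (hsub h0)
      have e1 := he ψ hψ hc fun z hz hz0 => absurd (hsub hz) (by simp [halfPlane, hz0])
      simp only [hbdry, mul_zero, zero_mul, integral_zero, zero_add] at e1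
      have e2 := (hasKinDerivs_polyFun Q).weak_interior (F := polyFun (kinOp Q))
        (fun z _ => polyFun_kinOp Q z) subset_rfl hψ hc hsub
      rw [integral_congr_ae (hkθ _), integral_sub (ih _ hθ hθc) (iQ _ hθ hθc),
        integral_mul_adjoint_eq hd ih hψ hc hsub e1,
        integral_mul_adjoint_eq ((hasKinDerivs_polyFun Q).isWeakDerivV subset_rfl) iQ hψ hc hsub e2,
        sub_self]
  obtain ⟨P, μ, hP, hPμ, hμ⟩ := key
  refine ⟨P + Q, μ, hP.add hQ, (ae_restrict_iff' measurableSet_halfPlane).2 ?_, hμ⟩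
  filter_upwards [hPμ, hkh] with z h1 h2 h0
  have e3 : polyFun (P + Q) z = polyFun P z + polyFun Q z := map_add _ _ _
  rw [e3, h2 h0]
  linarith [h1 h0]

theorem continuousOn_psi (l : ℕ) : ContinuousOn (psi l) halfPlane := by
  obtain ⟨L, f, hL, hψf⟩ := exists_psi_eq_selfSim l
  exact hL.isProfile.hasKinDerivs.cont.congr hψf

theorem eq_of_polyFun_add_psi_ae_eq {P P' : MvPolynomial (Fin 2) ℝ} {l : ℕ} {μ μ' : ℝ}
    (h : ∀ᵐ z ∂(volume.restrict halfPlane),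
      polyFun P z + μ * psi l z = polyFun P' z + μ' * psi l z) : μ' = μ := by
  have hc : ∀ (P : MvPolynomial (Fin 2) ℝ) (μ : ℝ),
      ContinuousOn (fun z => polyFun P z + μ * psi l z) halfPlane := fun P μ =>
    (continuous_polyFun P).continuousOn.add ((continuousOn_psi l).const_mul μ)
  exact eq_of_polyFun_add_psi_eq
    (Measure.eqOn_open_of_ae_eq h isOpen_halfPlane (hc P μ) (hc P' μ'))

theorem lemmaC1 :
    -- the functions `φ_m` are homogeneous classical solutions with absorbing boundary condition
    (∀ m : ℤ, -1 ≤ m →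
      IsKinHomogeneous (3 * lamExp m) (phi m) ∧
      IsClassicalSolution (fun _ => 0) (fun _ => 0) (phi m)) ∧
    -- for `m ≥ 0` they are weak solutions
    (∀ m : ℤ, 0 ≤ m → IsWeakSolution (fun _ => 0) (fun _ => 0) (phi m)) ∧
    -- `φ_{-1}` is a weak solution away from the grazing point and the in-flow boundary
    (∀ R : ℝ, 0 < R →
      IsWeakSolutionIn {z | 1 / R ^ 3 < z.1 ∨ (0 < z.1 ∧ z.2 < -(1 / R))} (fun _ => 0)
        (phi (-1))) ∧
    -- classification of homogeneous classical solutions of the in-flow problem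
    (∀ (lam : ℕ) (p : MvPolynomial (Fin 2) ℝ) (a : ℝ) (h : ℝ × ℝ → ℝ),
      IsKinHomogPoly p ((lam : ℤ) - 2) → (p ≠ 0 ∨ a ≠ 0) →
      IsKinHomogeneous lam h → NoExpGrowth h →
      IsClassicalSolution (polyFun p) (fun v => a * v ^ lam) h →
      ∃ (P : MvPolynomial (Fin 2) ℝ) (μ : ℝ),
        IsKinHomogPoly P lam ∧
        (∀ z ∈ halfPlane, h z = polyFun P z + μ * psi (lam / 3) z) ∧
        (lam % 3 = 0 ∨ lam % 3 = 1 → μ = 0) ∧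
        ∀ (P' : MvPolynomial (Fin 2) ℝ) (μ' : ℝ), IsKinPoly P' lam →
          (∀ z ∈ halfPlane, h z = polyFun P' z + μ' * psi (lam / 3) z) → μ' = μ) ∧
    -- classification of homogeneous weak solutions of the in-flow problem
    (∀ (lam : ℕ) (p : MvPolynomial (Fin 2) ℝ) (a : ℝ) (h : ℝ × ℝ → ℝ),
      IsKinHomogPoly p ((lam : ℤ) - 2) → (p ≠ 0 ∨ a ≠ 0) →
      IsKinHomogeneousAE lam h → NoExpGrowthAE h →
      IsWeakSolution (polyFun p) (fun v => a * v ^ lam) h →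
      ∃ (P : MvPolynomial (Fin 2) ℝ) (μ : ℝ),
        IsKinHomogPoly P lam ∧
        (∀ᵐ z ∂(volume.restrict halfPlane), h z = polyFun P z + μ * psi (lam / 3) z) ∧
        (lam % 3 = 0 ∨ lam % 3 = 1 → μ = 0) ∧
        ∀ (P' : MvPolynomial (Fin 2) ℝ) (μ' : ℝ), IsKinPoly P' lam →
          (∀ᵐ z ∂(volume.restrict halfPlane),
            h z = polyFun P' z + μ' * psi (lam / 3) z) → μ' = μ) ∧
    -- conversely, all these functions are solutions of such a problem
    (∀ (lam : ℕ) (P : MvPolynomial (Fin 2) ℝ) (μ : ℝ),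
      IsKinHomogPoly P lam → (lam % 3 = 0 ∨ lam % 3 = 1 → μ = 0) →
      IsKinHomogeneous lam (fun z => polyFun P z + μ * psi (lam / 3) z) ∧
      NoExpGrowth (fun z => polyFun P z + μ * psi (lam / 3) z) ∧
      ∃ (p : MvPolynomial (Fin 2) ℝ) (a : ℝ),
        IsKinHomogPoly p ((lam : ℤ) - 2) ∧
        IsClassicalSolution (polyFun p) (fun v => a * v ^ lam)
          (fun z => polyFun P z + μ * psi (lam / 3) z) ∧
        IsWeakSolution (polyFun p) (fun v => a * v ^ lam)
          (fun z => polyFun P z + μ * psi (lam / 3) z)) := by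

  refine ⟨fun m _ => ⟨phi_isKinHomogeneous m, phi_isClassicalSolution m⟩,
    fun m hm => phi_isWeakSolution hm, fun R hR => phi_isWeakSolutionIn (-1) hR,
    fun lam p a h hp _ hh hg hs => ?_, fun lam p a h hp _ hh hg hs => ?_,
    fun lam P μ hP hμ => polyFun_add_psi_isSolution hP hμ⟩
  · obtain ⟨P, μ, hP, hPμ, hμ⟩ := exists_eq_of_isClassicalSolution hp hh hg hs
    exact ⟨P, μ, hP, hPμ, hμ, fun P' μ' _ h' =>
      eq_of_polyFun_add_psi_eq fun z hz => (hPμ z hz).symm.trans (h' z hz)⟩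
  · obtain ⟨P, μ, hP, hPμ, hμ⟩ := exists_ae_eq_of_isWeakSolution hp hh hg hs
    exact ⟨P, μ, hP, hPμ, hμ, fun P' μ' _ h' => eq_of_polyFun_add_psi_ae_eq (by
      filter_upwards [hPμ, h'] with z h1 h2 using h1.symm.trans h2)⟩
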